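/- **Theorem.** For a positive integer $U$ let $[U]=\{1,\dots,U\}$. A disk is a closed Euclidean disk in $\mathbb{R}^2$ (of radius $\ge 0$); it is *integral* if its center has integral coordinates. Two disks $D_1,D_2$ *bichromatically cover* a collection $T$ of pairs of points if in every pair of $T$ one point can be colored red and the other one blue such that $D_1$ contains all red points and $D_2$ contains all blue points. The *integral bichromatic 2-center problem* (IB2C) asks, given $U$ and a list $T$ of $m$ pairs of points in $[U]\times[U]$, for two integral disks that bichromatically cover $T$ such that the radius of the larger one is minimum among all pairs of integral disks that bichromatically cover $T$. There is a deterministic algorithm that solves the IB2C problem in $O(m+U^3\log^2 U)$ time. More precisely, there is a single program for a word RAM with words of $O(\log(m+U+2))$ bits and unit-cost operations (reading and writing registers and memory cells, addition, truncated subtraction, multiplication, division rounded down, comparisons, conditional branching and loops), and there is an absolute constant $C$, such that for every $U$ and every such input $T$ (the coordinates of the pairs being given in consecutive memory cells) the program halts after at most $C\,(m+U^3\log^2 U+1)$ steps and outputs the centers and the squared radii of two integral disks that form an optimal solution (there is always an optimal solution whose squared radii are integers). -/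

import Mathlib

/-! ## A word RAM with a step count

Registers and memory cells hold words, that is, natural numbers below a word bound `W`
(words of `log₂ W` bits).  Memory is addressed by words.  Every operation is exact: a program that
would produce a value `≥ W` has no execution.  Each elementary operation costs one step. -/

namespace WordRAM

/-- The elementary operations on words: addition, truncated subtraction, multiplication, division
rounded down (with `x / 0 = 0`), and the comparisons `<` and `=` with value `0` or `1`. -/
inductive BinOp where
  | add
  | sub
  | mul
  | div
  | lt
  | eq

def BinOp.eval : BinOp → ℕ → ℕ → ℕ
  | .add, x, y => x + y
  | .sub, x, y => x - y
  | .mul, x, y => x * y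
  | .div, x, y => x / y
  | .lt, x, y => if x < y then 1 else 0
  | .eq, x, y => if x = y then 1 else 0

/-- The contents of the registers and of the memory. -/
structure State where
  reg : ℕ → ℕ
  mem : ℕ → ℕ

/-- Expressions: a constant, the content of a register, the content of the memory cell whose
address is given by an expression, or an elementary operation. -/
inductive Expr where
  | const (n : ℕ)
  | reg (x : ℕ)
  | load (addr : Expr)
  | op (o : BinOp) (e₁ e₂ : Expr)

def Expr.eval (s : State) : Expr → ℕ
  | .const n => n
  | .reg x => s.reg x
  | .load a => s.mem (a.eval s)
  | .op o e₁ e₂ => o.eval (e₁.eval s) (e₂.eval s)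

/-- All values that occur in the evaluation of the expression (addresses included) are words. -/
def Expr.Fits (W : ℕ) (s : State) : Expr → Prop
  | .const n => n < W
  | .reg x => s.reg x < W
  | .load a => a.Fits W s ∧ s.mem (a.eval s) < W
  | .op o e₁ e₂ => e₁.Fits W s ∧ e₂.Fits W s ∧ o.eval (e₁.eval s) (e₂.eval s) < W

/-- The number of steps of an evaluation: one for each node of the expression. -/
def Expr.cost : Expr → ℕ
  | .const _ => 1
  | .reg _ => 1
  | .load a => a.cost + 1
  | .op _ e₁ e₂ => e₁.cost + e₂.cost + 1

/-- Programs.  A program is a finite object that does not depend on the input. -/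
inductive Program where
  | skip
  /-- Write the value of `e` into the register `x`. -/
  | assign (x : ℕ) (e : Expr)
  /-- Write the value of `e` into the memory cell with address `addr`. -/
  | store (addr e : Expr)
  | seq (p q : Program)
  /-- Run `p` if `e` is nonzero, and `q` otherwise. -/
  | branch (e : Expr) (p q : Program)
  /-- Run `p` again and again as long as `e` is nonzero. -/
  | loop (e : Expr) (p : Program)

/-- `Exec W P s t n`: with word bound `W`, the program `P` started in the state `s` halts in the
state `t` after exactly `n` steps, and all values that occur on the way are words. -/
inductive Exec (W : ℕ) : Program → State → State → ℕ → Prop where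
  | skip (s : State) : Exec W .skip s s 1
  | assign (x : ℕ) (e : Expr) (s : State) (he : e.Fits W s) :
      Exec W (.assign x e) s ⟨Function.update s.reg x (e.eval s), s.mem⟩ (e.cost + 1)
  | store (a e : Expr) (s : State) (ha : a.Fits W s) (he : e.Fits W s) :
      Exec W (.store a e) s ⟨s.reg, Function.update s.mem (a.eval s) (e.eval s)⟩
        (a.cost + e.cost + 1)
  | seq {p q : Program} {s t u : State} {k l : ℕ}
      (hp : Exec W p s t k) (hq : Exec W q t u l) : Exec W (.seq p q) s u (k + l)
  | branch_true {e : Expr} {p q : Program} {s t : State} {k : ℕ} (he : e.Fits W s)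
      (h : e.eval s ≠ 0) (hp : Exec W p s t k) : Exec W (.branch e p q) s t (e.cost + 1 + k)
  | branch_false {e : Expr} {p q : Program} {s t : State} {k : ℕ} (he : e.Fits W s)
      (h : e.eval s = 0) (hq : Exec W q s t k) : Exec W (.branch e p q) s t (e.cost + 1 + k)
  | loop_done {e : Expr} {p : Program} {s : State} (he : e.Fits W s)
      (h : e.eval s = 0) : Exec W (.loop e p) s s (e.cost + 1)
  | loop_step {e : Expr} {p : Program} {s t u : State} {k l : ℕ} (he : e.Fits W s)
      (h : e.eval s ≠ 0) (hp : Exec W p s t k) (hl : Exec W (.loop e p) t u l) :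
      Exec W (.loop e p) s u (e.cost + 1 + k + l)

end WordRAM

/-! ## The integral bichromatic 2-center problem -/

namespace IB2C

/-- The integral point with coordinates `a.1` and `a.2` in the Euclidean plane. -/
noncomputable def gridPoint (a : ℤ × ℤ) : EuclideanSpace ℝ (Fin 2) :=
  !₂[(a.1 : ℝ), (a.2 : ℝ)]

/-- A pair of points with natural coordinates. -/
abbrev PointPair : Type := (ℕ × ℕ) × (ℕ × ℕ)

/-- Both points of the pair lie in `[U] × [U]`, where `[U] = {1, …, U}`. -/
def PointPair.InGrid (U : ℕ) (p : PointPair) : Prop :=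
  (p.1.1 ∈ Set.Icc 1 U ∧ p.1.2 ∈ Set.Icc 1 U) ∧ (p.2.1 ∈ Set.Icc 1 U ∧ p.2.2 ∈ Set.Icc 1 U)

/-- The first point of the pair, in the Euclidean plane. -/
noncomputable def PointPair.firstPoint (p : PointPair) : EuclideanSpace ℝ (Fin 2) :=
  gridPoint (p.1.1, p.1.2)

/-- The second point of the pair, in the Euclidean plane. -/
noncomputable def PointPair.secondPoint (p : PointPair) : EuclideanSpace ℝ (Fin 2) :=
  gridPoint (p.2.1, p.2.2)

/-- A disk whose center is an integral point; the radius is any nonnegative real number. -/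
structure IntegralDisk where
  center : ℤ × ℤ
  radius : ℝ
  radius_nonneg : 0 ≤ radius

/-- The (closed, Euclidean) disk as a set of points. -/
def IntegralDisk.toSet (D : IntegralDisk) : Set (EuclideanSpace ℝ (Fin 2)) :=
  Metric.closedBall (gridPoint D.center) D.radius

/-- In every pair one point can be colored red and the other one blue in such a way that `D₁`
covers all red points and `D₂` covers all blue points. -/
def BichromaticallyCover (D₁ D₂ : IntegralDisk) (T : List PointPair) : Prop :=
  ∀ p ∈ T, (p.firstPoint ∈ D₁.toSet ∧ p.secondPoint ∈ D₂.toSet) ∨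
    (p.secondPoint ∈ D₁.toSet ∧ p.firstPoint ∈ D₂.toSet)

/-- Two integral disks that bichromatically cover `T` such that the radius of the larger one is
minimum among all such pairs of integral disks. -/
def IsSolution (T : List PointPair) (D₁ D₂ : IntegralDisk) : Prop :=
  BichromaticallyCover D₁ D₂ T ∧
    ∀ E₁ E₂ : IntegralDisk, BichromaticallyCover E₁ E₂ T →
      max D₁.radius D₂.radius ≤ max E₁.radius E₂.radius

/-- The four coordinates of a pair, in the order in which they are written into memory. -/
def PointPair.coords (p : PointPair) : List ℕ :=
  [p.1.1, p.1.2, p.2.1, p.2.2]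

/-- The initial state: `U` and the number `m` of pairs in registers `0` and `1`, the coordinates
of the pairs in the memory cells `0, …, 4 m - 1`, and `0` everywhere else. -/
def inputState (U : ℕ) (T : List PointPair) : WordRAM.State where
  reg x := if x = 0 then U else if x = 1 then T.length else 0
  mem i := (T.flatMap PointPair.coords).getD i 0

/-- The disk whose center has its coordinates in registers `x` and `x + 1` and whose squared radius
is in register `x + 2`. -/
noncomputable def outputDisk (s : WordRAM.State) (x : ℕ) : IntegralDisk where
  center := (s.reg x, s.reg (x + 1))
  radius := √(s.reg (x + 2) : ℝ)
  radius_nonneg := Real.sqrt_nonneg _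

end IB2C

/-! Reduction to a finite problem. Moving a center coordinatewise to the nearest point of `[U] ×
[U]` brings it no farther from any input point, and squared distances between integral points are
integers. So it suffices to find the least integer `R ≤ 2U²` for which two disks with centers in the
grid and squared radius `R` cover `T`. Feasibility is monotone in `R`, so binary search calls a
decision procedure `O(log U)` times, and each call must cost `O(U³ log U)`.

Decision for fixed `R`. By Hall's condition for two points and two disks (`covers_iff`), two disks
cover `T` bichromatically exactly when each disk meets every pair and their union contains every
input point. The first requirement concerns one center at a time, and the second no longer mentions
pairs.

The basic tool: for a set of grid points, the centers in a given column whose disks contain the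
whole set form an interval, and both ends of all `U` intervals are found in `O(U log U)` time
(`bounds_spec`). The lower end in column `X` is governed by the maximum over `x` of (weight of
column `x`) + `arc (|X - x|)`, where only the highest point of column `x` matters; the upper end is
the same after reflection. `arc` is a circle scaled by `2U` and rounded to integers. The scale is
chosen so that the comparison stays exact (`arc_le_iff`) and so that the rounded function is still
convex (`sqrt_concave`, `arc_convex`). Convexity gives the Monge inequality (`arc_monge`), hence the
maximizing column is monotone in `X`, and divide and conquer over dyadic step widths finds all
maxima with `O(U)` work per level (`PartialLevel.step`, `sweep_spec`).

Centers that meet all pairs: a center fails if for some point `p` its disk contains neither `p` nor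
all partners of `p` (`meets_iff`). For fixed `p`, the good centers of a column form a union of two
intervals, so the bad ones form four ranges of heights. Over the `U²` points `p` this costs `O(U³
log U)` (`forbid_spec`), and one pass per column merges the ranges.

Choice of the second center: for each first center that meets all pairs, the tops of the missed
points in every column come from a table, the tool yields the interval of second centers in each
column, and a table of the next admissible center below a height answers whether the interval
contains one (`probe_spec`). This costs `O(U log U)` for each of the `U²` first centers.

For the machine model, the algorithm is written in a small language with named registers and arrays,
whose programs are compiled to the word RAM with constant overhead (`HExec.compile`). Correctness
and cost are proved together by weakest preconditions `WP` whose postconditions also mention the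
number of executed commands. -/

/-! ## A structured language with named registers and named arrays, compiled to the word RAM -/

namespace Structured

open WordRAM

/-- Register names. -/
inductive Reg where
  | U | m | N | N2 | OFF | K | R | lo | hi | found
  | bx1 | by1 | bx2 | by2 | fx1 | fy1 | fx2 | fy2
  | i | px | py | qx | qy | d | s | t | vx | vy | vX | st | ax | av | e | cur
  | la | lb
  deriving DecidableEq

/-- Array names.  Arrays have three indices; most of them use only the first ones. -/
inductive Arr where
  | F (b : Bool) | A (b : Bool) | Q (b : Bool) | P (b : Bool)
  | S | G | arg | reach | V
  deriving DecidableEq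

def Reg.code (x : Reg) : ℕ := x.ctorIdx

def Arr.code : Arr → ℕ
  | .F b => b.toNat
  | .A b => 2 + b.toNat
  | .Q b => 4 + b.toNat
  | .P b => 6 + b.toNat
  | .S => 8
  | .G => 9
  | .arg => 10
  | .reach => 11
  | .V => 12

theorem Reg.code_injective : Function.Injective Reg.code := by
  intro a b h
  have : Reg.ofNat a.ctorIdx = Reg.ofNat b.ctorIdx := congrArg _ h
  simpa [Reg.ofNat_ctorIdx] using this

theorem Arr.code_injective : Function.Injective Arr.code := by
  rintro (_ | _ | _ | _ | _ | _ | _ | _ | _) (_ | _ | _ | _ | _ | _ | _ | _ | _) h <;>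
    simp only [Arr.code] at h <;> first
    | rfl
    | (rename_i b c; revert h; revert b c; decide)
    | (rename_i b; revert h; revert b; decide)
    | (revert h; decide)

theorem Arr.code_lt (k : Arr) : k.code < 13 := by
  rcases k with (_ | _) | (_ | _) | (_ | _) | (_ | _) | _ | _ | _ | _ | _ <;> decide

/-- The contents of registers and arrays, and the (read-only) input. -/
structure HState where
  v : Reg → ℕ
  a : Arr → ℕ → ℕ → ℕ → ℕ
  inp : List ℕ

def HState.set (h : HState) (x : Reg) (n : ℕ) : HState :=
  { h with v := Function.update h.v x n }

def HState.put (h : HState) (k : Arr) (i j l n : ℕ) : HState :=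
  { h with a := fun k' i' j' l' =>
      if k' = k ∧ i' = i ∧ j' = j ∧ l' = l then n else h.a k' i' j' l' }

@[simp] theorem HState.set_v (h : HState) (x y : Reg) (n : ℕ) :
    (h.set x n).v y = if y = x then n else h.v y := by
  simp [HState.set, Function.update_apply]

@[simp] theorem HState.set_a (h : HState) (x : Reg) (n : ℕ) : (h.set x n).a = h.a := rfl

@[simp] theorem HState.set_inp (h : HState) (x : Reg) (n : ℕ) : (h.set x n).inp = h.inp := rfl

@[simp] theorem HState.put_v (h : HState) (k : Arr) (i j l n : ℕ) :
    (h.put k i j l n).v = h.v := rfl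

@[simp] theorem HState.put_a (h : HState) (k k' : Arr) (i j l n i' j' l' : ℕ) :
    (h.put k i j l n).a k' i' j' l' =
      if k' = k ∧ i' = i ∧ j' = j ∧ l' = l then n else h.a k' i' j' l' := rfl

@[simp] theorem HState.put_inp (h : HState) (k : Arr) (i j l n : ℕ) :
    (h.put k i j l n).inp = h.inp := rfl

inductive HExpr where
  | const (n : ℕ)
  | var (x : Reg)
  | get (k : Arr) (i j l : HExpr)
  | input (e : HExpr)
  | op (o : BinOp) (e₁ e₂ : HExpr)

namespace HExpr

def eval (h : HState) : HExpr → ℕ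
  | const n => n
  | var x => h.v x
  | get k i j l => h.a k (i.eval h) (j.eval h) (l.eval h)
  | input e => h.inp.getD (e.eval h) 0
  | op o e₁ e₂ => o.eval (e₁.eval h) (e₂.eval h)

/-- The side condition of an elementary operation; only sums and products can be too large. -/
def opFits (M : ℕ) : BinOp → ℕ → ℕ → Prop
  | .add, x, y => x + y < M
  | .mul, x, y => x * y < M
  | _, _, _ => True

def Fits (M : ℕ) (h : HState) : HExpr → Prop
  | const n => n < M
  | var _ => True
  | get _ i j l => i.Fits M h ∧ j.Fits M h ∧ l.Fits M h
  | input e => e.Fits M h ∧ e.eval h < h.inp.length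
  | op o e₁ e₂ => e₁.Fits M h ∧ e₂.Fits M h ∧ opFits M o (e₁.eval h) (e₂.eval h)

instance (n : ℕ) : OfNat HExpr n := ⟨const n⟩
instance : Add HExpr := ⟨op .add⟩
instance : Sub HExpr := ⟨op .sub⟩
instance : Mul HExpr := ⟨op .mul⟩
instance : Div HExpr := ⟨op .div⟩

/-- `1` if the first value is smaller than the second one, and `0` otherwise. -/
def lt (e₁ e₂ : HExpr) : HExpr := op .lt e₁ e₂

/-- `1` if the values are equal, and `0` otherwise. -/
def eq (e₁ e₂ : HExpr) : HExpr := op .eq e₁ e₂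

/-- Truncated subtraction gives maximum, minimum and absolute difference without branching. The
minimum creates no value above its arguments and therefore needs no size condition of its own. -/
def max (e₁ e₂ : HExpr) : HExpr := e₁ + (e₂ - e₁)

def min (e₁ e₂ : HExpr) : HExpr := e₁ - (e₁ - e₂)

def dist (e₁ e₂ : HExpr) : HExpr := (e₁ - e₂) + (e₂ - e₁)

variable (M : ℕ) (h : HState) (e₁ e₂ : HExpr)

@[simp] theorem eval_ofNat (n : ℕ) : eval h (no_index (OfNat.ofNat n)) = n := rfl
@[simp] theorem eval_var (x : Reg) : eval h (var x) = h.v x := rfl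
@[simp] theorem eval_get (k : Arr) (i j l : HExpr) :
    eval h (get k i j l) = h.a k (i.eval h) (j.eval h) (l.eval h) := rfl
@[simp] theorem eval_input : eval h (input e₁) = h.inp.getD (e₁.eval h) 0 := rfl
@[simp] theorem eval_add : eval h (e₁ + e₂) = e₁.eval h + e₂.eval h := rfl
@[simp] theorem eval_sub : eval h (e₁ - e₂) = e₁.eval h - e₂.eval h := rfl
@[simp] theorem eval_mul : eval h (e₁ * e₂) = e₁.eval h * e₂.eval h := rfl
@[simp] theorem eval_div : eval h (e₁ / e₂) = e₁.eval h / e₂.eval h := rfl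
@[simp] theorem eval_lt :
    eval h (lt e₁ e₂) = if e₁.eval h < e₂.eval h then 1 else 0 := rfl
@[simp] theorem eval_eq :
    eval h (eq e₁ e₂) = if e₁.eval h = e₂.eval h then 1 else 0 := rfl
@[simp] theorem eval_max : eval h (max e₁ e₂) = Max.max (e₁.eval h) (e₂.eval h) := by
  simp only [max, eval_add, eval_sub]; omega
@[simp] theorem eval_min : eval h (min e₁ e₂) = Min.min (e₁.eval h) (e₂.eval h) := by
  simp only [min, eval_sub]; omega
@[simp] theorem eval_dist :
    eval h (dist e₁ e₂) = (e₁.eval h - e₂.eval h) + (e₂.eval h - e₁.eval h) := rfl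

@[simp] theorem fits_ofNat (n : ℕ) : Fits M h (no_index (OfNat.ofNat n)) ↔ n < M := Iff.rfl
@[simp] theorem fits_var (x : Reg) : Fits M h (var x) := trivial
@[simp] theorem fits_get (k : Arr) (i j l : HExpr) :
    Fits M h (get k i j l) ↔ i.Fits M h ∧ j.Fits M h ∧ l.Fits M h := Iff.rfl
@[simp] theorem fits_input :
    Fits M h (input e₁) ↔ e₁.Fits M h ∧ e₁.eval h < h.inp.length := Iff.rfl
@[simp] theorem fits_add : Fits M h (e₁ + e₂) ↔
    e₁.Fits M h ∧ e₂.Fits M h ∧ e₁.eval h + e₂.eval h < M := Iff.rfl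
@[simp] theorem fits_mul : Fits M h (e₁ * e₂) ↔
    e₁.Fits M h ∧ e₂.Fits M h ∧ e₁.eval h * e₂.eval h < M := Iff.rfl
@[simp] theorem fits_sub : Fits M h (e₁ - e₂) ↔ e₁.Fits M h ∧ e₂.Fits M h := by
  change _ ∧ _ ∧ True ↔ _; simp
@[simp] theorem fits_div : Fits M h (e₁ / e₂) ↔ e₁.Fits M h ∧ e₂.Fits M h := by
  change _ ∧ _ ∧ True ↔ _; simp
@[simp] theorem fits_lt : Fits M h (lt e₁ e₂) ↔ e₁.Fits M h ∧ e₂.Fits M h := by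
  change _ ∧ _ ∧ True ↔ _; simp
@[simp] theorem fits_eq : Fits M h (eq e₁ e₂) ↔ e₁.Fits M h ∧ e₂.Fits M h := by
  change _ ∧ _ ∧ True ↔ _; simp
@[simp] theorem fits_min : Fits M h (min e₁ e₂) ↔ e₁.Fits M h ∧ e₂.Fits M h := by
  simp only [min, fits_sub]; tauto
@[simp] theorem fits_max : Fits M h (max e₁ e₂) ↔
    e₁.Fits M h ∧ e₂.Fits M h ∧ Max.max (e₁.eval h) (e₂.eval h) < M := by
  simp only [max, fits_add, fits_sub, eval_sub]
  rw [show e₁.eval h + (e₂.eval h - e₁.eval h) = Max.max (e₁.eval h) (e₂.eval h) by omega]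
  tauto
@[simp] theorem fits_dist : Fits M h (dist e₁ e₂) ↔
    e₁.Fits M h ∧ e₂.Fits M h ∧ (e₁.eval h - e₂.eval h) + (e₂.eval h - e₁.eval h) < M := by
  simp only [dist, fits_add, fits_sub, eval_sub]; tauto

end HExpr

inductive HProg where
  | skip
  | assign (x : Reg) (e : HExpr)
  | put (k : Arr) (i j l e : HExpr)
  | seq (p q : HProg)
  | ite (e : HExpr) (p q : HProg)
  | loop (e : HExpr) (p : HProg)

infixr:60 " ;; " => HProg.seq
infix:62 " <== " => HProg.assign

namespace HProg

/-- Run `p` for `x = a, …, b - 1`. -/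
def forRange (x : Reg) (a b : HExpr) (p : HProg) : HProg :=
  x <== a ;; .loop (.lt (.var x) b) (p ;; x <== .var x + 1)

/-- The registers that a program may write. -/
def regs : HProg → List Reg
  | skip => []
  | assign x _ => [x]
  | put _ _ _ _ _ => []
  | seq p q => p.regs ++ q.regs
  | ite _ p q => p.regs ++ q.regs
  | .loop _ p => p.regs

/-- The arrays that a program may write. -/
def arrs : HProg → List Arr
  | skip => []
  | assign _ _ => []
  | put k _ _ _ _ => [k]
  | seq p q => p.arrs ++ q.arrs
  | ite _ p q => p.arrs ++ q.arrs
  | .loop _ p => p.arrs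

end HProg

/-- `HExec M P h h' n`: the program `P` started in `h` halts in `h'` after executing `n` elementary
commands and tests, and all values that occur on the way are below `M`. -/
inductive HExec (M : ℕ) : HProg → HState → HState → ℕ → Prop where
  | skip (h : HState) : HExec M .skip h h 1
  | assign (x : Reg) (e : HExpr) (h : HState) (he : e.Fits M h) :
      HExec M (.assign x e) h (h.set x (e.eval h)) 1
  | put (k : Arr) (i j l e : HExpr) (h : HState) (hi : i.Fits M h) (hj : j.Fits M h)
      (hl : l.Fits M h) (he : e.Fits M h) :
      HExec M (.put k i j l e) h (h.put k (i.eval h) (j.eval h) (l.eval h) (e.eval h)) 1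
  | seq {p q : HProg} {h h' h'' : HState} {n n' : ℕ}
      (hp : HExec M p h h' n) (hq : HExec M q h' h'' n') : HExec M (.seq p q) h h'' (n + n')
  | ite_true {e : HExpr} {p q : HProg} {h h' : HState} {n : ℕ} (he : e.Fits M h)
      (hc : e.eval h ≠ 0) (hp : HExec M p h h' n) : HExec M (.ite e p q) h h' (1 + n)
  | ite_false {e : HExpr} {p q : HProg} {h h' : HState} {n : ℕ} (he : e.Fits M h)
      (hc : e.eval h = 0) (hq : HExec M q h h' n) : HExec M (.ite e p q) h h' (1 + n)
  | loop_done {e : HExpr} {p : HProg} {h : HState} (he : e.Fits M h)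
      (hc : e.eval h = 0) : HExec M (.loop e p) h h 1
  | loop_step {e : HExpr} {p : HProg} {h h' h'' : HState} {n n' : ℕ} (he : e.Fits M h)
      (hc : e.eval h ≠ 0) (hp : HExec M p h h' n) (hl : HExec M (.loop e p) h' h'' n') :
      HExec M (.loop e p) h h'' (1 + n + n')

/-- The states agree outside the given registers and arrays. -/
structure Frame (rs : List Reg) (as : List Arr) (h h' : HState) : Prop where
  v : ∀ x, x ∉ rs → h'.v x = h.v x
  a : ∀ k, k ∉ as → h'.a k = h.a k
  inp : h'.inp = h.inp

theorem Frame.refl (rs : List Reg) (as : List Arr) (h : HState) : Frame rs as h h :=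
  ⟨fun _ _ => rfl, fun _ _ => rfl, rfl⟩

theorem Frame.trans {rs : List Reg} {as : List Arr} {h h' h'' : HState} (H : Frame rs as h h')
    (H' : Frame rs as h' h'') : Frame rs as h h'' :=
  ⟨fun x hx => (H'.v x hx).trans (H.v x hx), fun x hx => (H'.a x hx).trans (H.a x hx),
    H'.inp.trans H.inp⟩

theorem Frame.mono {rs rs' : List Reg} {as as' : List Arr} {h h' : HState}
    (H : Frame rs as h h') (hr : rs ⊆ rs') (ha : as ⊆ as') : Frame rs' as' h h' :=
  ⟨fun x hx => H.v x fun h => hx (hr h), fun x hx => H.a x fun h => hx (ha h), H.inp⟩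

theorem Frame.of_set {rs : List Reg} {as : List Arr} {h h' : HState} {x : Reg} {n : ℕ}
    (H : Frame rs as (h.set x n) h') : Frame (x :: rs) as h h' :=
  ⟨fun y hy => by
    simp only [List.mem_cons, not_or] at hy
    rw [H.v y hy.2]; simp [hy.1], H.a, H.inp⟩

theorem Frame.of_put {rs : List Reg} {as : List Arr} {h h' : HState} {k : Arr} {i j l n : ℕ}
    (H : Frame rs as (h.put k i j l n) h') : Frame rs (k :: as) h h' :=
  ⟨H.v, fun k' hk => by
    simp only [List.mem_cons, not_or] at hk
    rw [H.a k' hk.2]; funext; simp [hk.1], H.inp⟩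

/-- The write sets `regs` and `arrs` are computed from the syntax, so that noninterference between
program parts becomes a decidable membership question. All later specifications mention only what
changes and recover the rest from this frame. -/
theorem HExec.frame {M : ℕ} {p : HProg} {h h' : HState} {n : ℕ} (H : HExec M p h h' n) :
    Frame p.regs p.arrs h h' := by
  induction H with
  | skip h => exact Frame.refl _ _ _
  | assign x e h he =>
    exact ⟨fun y hy => by simp [HProg.regs] at hy; simp [hy], fun _ _ => rfl, rfl⟩
  | put k i j l e h =>
    refine ⟨fun _ _ => rfl, fun k' hk => ?_, rfl⟩
    simp only [HProg.arrs, List.mem_singleton] at hk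
    funext; simp [hk]
  | seq _ _ ih ih' =>
    exact (ih.mono (by simp [HProg.regs]) (by simp [HProg.arrs])).trans
      (ih'.mono (by simp [HProg.regs]) (by simp [HProg.arrs]))
  | ite_true _ _ _ ih => exact ih.mono (by simp [HProg.regs]) (by simp [HProg.arrs])
  | ite_false _ _ _ ih => exact ih.mono (by simp [HProg.regs]) (by simp [HProg.arrs])
  | loop_done => exact Frame.refl _ _ _
  | loop_step _ _ _ _ ih ih' => exact Frame.trans ih ih'

/-! ### Compilation -/

/-- An injective polynomial pairing of natural numbers. -/
def pairing (a b : ℕ) : ℕ := (a + b) * (a + b) + a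

/-- The value lies between the consecutive squares `(a + b)²` and `(a + b + 1)²`, so it determines
`a + b`, and then `a`. -/
theorem pairing_inj {a b a' b' : ℕ} (h : pairing a b = pairing a' b') : a = a' ∧ b = b' := by
  unfold pairing at h
  have h1 : a + b = a' + b' := by
    rcases lt_trichotomy (a + b) (a' + b') with hlt | heq | hlt
    · nlinarith
    · exact heq
    · nlinarith
  rw [h1] at h
  omega

def pairExpr (a b : Expr) : Expr :=
  .op .add (.op .mul (.op .add a b) (.op .add a b)) a

theorem pairExpr_eval (s : State) (a b : Expr) :
    (pairExpr a b).eval s = pairing (a.eval s) (b.eval s) := rfl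

theorem pairExpr_fits {W : ℕ} {s : State} {a b : Expr} (ha : a.Fits W s) (hb : b.Fits W s)
    (h : pairing (a.eval s) (b.eval s) < W) : (pairExpr a b).Fits W s := by
  unfold pairing at h
  have h1 : a.eval s + b.eval s ≤ (a.eval s + b.eval s) * (a.eval s + b.eval s) :=
    Nat.le_mul_self _
  refine ⟨⟨⟨ha, hb, ?_⟩, ⟨ha, hb, ?_⟩, ?_⟩, ha, ?_⟩ <;> simp only [BinOp.eval, Expr.eval] <;> omega

/-- The position of an array cell in the memory above the input. -/
def cell (k : Arr) (i j l : ℕ) : ℕ := pairing (pairing (pairing i j) l) k.code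

theorem cell_inj {k k' : Arr} {i j l i' j' l' : ℕ} (h : cell k i j l = cell k' i' j' l') :
    k = k' ∧ i = i' ∧ j = j' ∧ l = l' := by
  obtain ⟨h, hk⟩ := pairing_inj h
  obtain ⟨h, hl⟩ := pairing_inj h
  obtain ⟨hi, hj⟩ := pairing_inj h
  exact ⟨Arr.code_injective hk, hi, hj, hl⟩

def cellExpr (k : Arr) (i j l : Expr) : Expr :=
  .op .add (.reg 8) (pairExpr (pairExpr (pairExpr i j) l) (.const k.code))

def HExpr.compile : HExpr → Expr
  | .const n => .const n
  | .var x => .reg (x.code + 10)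
  | .get k i j l => .load (cellExpr k i.compile j.compile l.compile)
  | .input e => .load e.compile
  | .op o e₁ e₂ => .op o e₁.compile e₂.compile

def HProg.compile : HProg → Program
  | .skip => .skip
  | .assign x e => .assign (x.code + 10) e.compile
  | .put k i j l e => .store (cellExpr k i.compile j.compile l.compile) e.compile
  | .seq p q => .seq p.compile q.compile
  | .ite e p q => .branch e.compile p.compile q.compile
  | .loop e p => .loop e.compile p.compile

/-- A bound for the number of word RAM steps per command. -/
def HProg.weight : HProg → ℕ
  | .skip => 1
  | .assign _ e => e.compile.cost + 1
  | .put k i j l e => (cellExpr k i.compile j.compile l.compile).cost + e.compile.cost + 1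
  | .seq p q => max p.weight q.weight
  | .ite e p q => max (e.compile.cost + 1) (max p.weight q.weight)
  | .loop e p => max (e.compile.cost + 1) p.weight

/-- The word RAM state `s` represents the state `h`. -/
structure Rep (h : HState) (s : State) : Prop where
  reg : ∀ x : Reg, s.reg (x.code + 10) = h.v x
  base : s.reg 8 = h.inp.length
  mem : ∀ k i j l, s.mem (h.inp.length + cell k i j l) = h.a k i j l
  inp : ∀ i < h.inp.length, s.mem i = h.inp.getD i 0

/-- All values in the state are below `M`. -/
structure HState.Bounded (M : ℕ) (h : HState) : Prop where
  v : ∀ x, h.v x < M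
  a : ∀ k i j l, h.a k i j l < M
  inp : ∀ i, h.inp.getD i 0 < M
  length : h.inp.length < M

theorem pairing_lt {a b A B : ℕ} (ha : a < A) (hb : b < B) : pairing a b < (A + B) ^ 2 := by
  unfold pairing
  nlinarith

/-- Each of the three nested pairings squares the magnitude, so addresses are of order `M ^ 8`; with
`20 ≤ M` the constants and the base address fit into `M ^ 12`. -/
theorem cellExpr_spec {M W : ℕ} (hM : 20 ≤ M) (hW : M ^ 12 ≤ W) {h : HState} {s : State}
    (hr : Rep h s) (hb : h.Bounded M) {k : Arr} {i j l : Expr}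
    (hi : i.Fits W s) (hj : j.Fits W s) (hl : l.Fits W s)
    (hi' : i.eval s < M) (hj' : j.eval s < M) (hl' : l.eval s < M) :
    (cellExpr k i j l).Fits W s ∧
      (cellExpr k i j l).eval s = h.inp.length + cell k (i.eval s) (j.eval s) (l.eval s) := by
  have hk : k.code < M := by have := k.code_lt; omega
  have h1 := pairing_lt hi' hj'
  have h2 := pairing_lt h1 hl'
  have h3 := pairing_lt h2 hk
  have hlen := hb.length
  have e1 : (M + M) ^ 2 ≤ M ^ 3 := by nlinarith [sq_nonneg M]
  have e2 : ((M + M) ^ 2 + M) ^ 2 ≤ M ^ 5 := by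
    calc ((M + M) ^ 2 + M) ^ 2 = M ^ 2 * (4 * M + 1) ^ 2 := by ring
      _ ≤ M ^ 2 * M ^ 3 := Nat.mul_le_mul_left _ (by nlinarith [sq_nonneg M])
      _ = M ^ 5 := by ring
  have e3 : (((M + M) ^ 2 + M) ^ 2 + M) ^ 2 + M ≤ M ^ 12 := by
    calc (((M + M) ^ 2 + M) ^ 2 + M) ^ 2 + M ≤ (M ^ 5 + M ^ 5) ^ 2 + M ^ 10 := by
          gcongr
          · exact le_self_pow₀ (by omega) (by norm_num)
          · exact le_self_pow₀ (by omega) (by norm_num)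
      _ = 5 * M ^ 10 := by ring
      _ ≤ M ^ 2 * M ^ 10 := by gcongr; nlinarith
      _ = M ^ 12 := by ring
  have e0 : M ≤ M ^ 12 := le_self_pow₀ (by omega) (by norm_num)
  have e5 : M ^ 3 ≤ M ^ 12 := Nat.pow_le_pow_right (by omega) (by norm_num)
  have e6 : M ^ 5 ≤ M ^ 12 := Nat.pow_le_pow_right (by omega) (by norm_num)
  refine ⟨⟨?_, ?_, ?_⟩, ?_⟩
  · change s.reg 8 < W
    rw [hr.base]; omega
  · refine pairExpr_fits (pairExpr_fits (pairExpr_fits hi hj ?_) hl ?_) ?_ ?_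
    · omega
    · rw [pairExpr_eval]; omega
    · change k.code < W; omega
    · simp only [pairExpr_eval, Expr.eval]; omega
  · simp only [BinOp.eval, pairExpr_eval, Expr.eval, hr.base]; omega
  · simp only [cellExpr, Expr.eval, BinOp.eval, pairExpr_eval, hr.base, cell]

theorem HExpr.compile_spec {M W : ℕ} (hM : 20 ≤ M) (hW : M ^ 12 ≤ W) {h : HState} {s : State}
    (hr : Rep h s) (hb : h.Bounded M) (e : HExpr) (he : e.Fits M h) :
    e.compile.Fits W s ∧ e.compile.eval s = e.eval h ∧ e.eval h < M := by
  have e0 : M ≤ M ^ 12 := le_self_pow₀ (by omega) (by norm_num)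
  induction e with
  | const n => exact ⟨lt_of_lt_of_le he (e0.trans hW), rfl, he⟩
  | var x =>
    have := hb.v x
    refine ⟨?_, hr.reg x, this⟩
    change s.reg _ < W
    rw [hr.reg]; omega
  | get k i j l ihi ihj ihl =>
    obtain ⟨hi, hj, hl⟩ := he
    obtain ⟨fi, ei, bi⟩ := ihi hi
    obtain ⟨fj, ej, bj⟩ := ihj hj
    obtain ⟨fl, el, bl⟩ := ihl hl
    obtain ⟨f, e⟩ := cellExpr_spec hM hW hr hb (k := k) fi fj fl (by omega) (by omega) (by omega)
    have key : s.mem ((cellExpr k i.compile j.compile l.compile).eval s) =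
        h.a k (i.eval h) (j.eval h) (l.eval h) := by
      rw [e, hr.mem, ei, ej, el]
    have hlt := hb.a k (i.eval h) (j.eval h) (l.eval h)
    refine ⟨⟨f, ?_⟩, key, hlt⟩
    rw [key]; omega
  | input e ih =>
    obtain ⟨he, hlt⟩ := he
    obtain ⟨f, ee, b⟩ := ih he
    have key : s.mem (e.compile.eval s) = h.inp.getD (e.eval h) 0 := by
      rw [ee, hr.inp _ hlt]
    have := hb.inp (e.eval h)
    refine ⟨⟨f, ?_⟩, key, this⟩
    rw [key]; omega
  | op o e₁ e₂ ih₁ ih₂ =>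
    obtain ⟨h1, h2, h3⟩ := he
    obtain ⟨f1, ee1, b1⟩ := ih₁ h1
    obtain ⟨f2, ee2, b2⟩ := ih₂ h2
    have hlt : o.eval (e₁.eval h) (e₂.eval h) < M := by
      cases o <;> simp only [BinOp.eval, opFits] at h3 ⊢
      · exact h3
      · omega
      · exact h3
      · exact lt_of_le_of_lt (Nat.div_le_self _ _) b1
      · split <;> omega
      · split <;> omega
    refine ⟨⟨f1, f2, ?_⟩, ?_, hlt⟩
    · rw [ee1, ee2]; omega
    · change o.eval _ _ = _
      rw [ee1, ee2]; rfl

theorem Rep.set {h : HState} {s : State} (hr : Rep h s) (x : Reg) (n : ℕ) :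
    Rep (h.set x n) ⟨Function.update s.reg (x.code + 10) n, s.mem⟩ := by
  refine ⟨fun y => ?_, ?_, hr.mem, hr.inp⟩
  · by_cases hy : y = x
    · simp [hy]
    · have : y.code ≠ x.code := fun h => hy (Reg.code_injective h)
      simp [hy, this, hr.reg]
  · simpa using hr.base

theorem Rep.put {h : HState} {s : State} (hr : Rep h s) (k : Arr) (i j l n : ℕ) :
    Rep (h.put k i j l n)
      ⟨s.reg, Function.update s.mem (h.inp.length + cell k i j l) n⟩ := by
  refine ⟨hr.reg, hr.base, fun k' i' j' l' => ?_, fun i' hi' => ?_⟩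
  · simp only [HState.put_a, HState.put_inp, Function.update_apply]
    by_cases hc : k' = k ∧ i' = i ∧ j' = j ∧ l' = l
    · obtain ⟨rfl, rfl, rfl, rfl⟩ := hc
      simp
    · rw [if_neg hc, if_neg, hr.mem]
      intro he
      exact hc (cell_inj (by omega))
  · simp only [HState.put_inp] at hi' ⊢
    rw [Function.update_apply, if_neg (by omega), hr.inp _ hi']

theorem HState.Bounded.set {M : ℕ} {h : HState} (hb : h.Bounded M) (x : Reg) {n : ℕ}
    (hn : n < M) : (h.set x n).Bounded M :=
  ⟨fun y => by have := hb.v y; simp only [HState.set_v]; split <;> assumption,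
    hb.a, hb.inp, hb.length⟩

theorem HState.Bounded.put {M : ℕ} {h : HState} (hb : h.Bounded M) (k : Arr) (i j l : ℕ) {n : ℕ}
    (hn : n < M) : (h.put k i j l n).Bounded M :=
  ⟨hb.v, fun k' i' j' l' => by
    have := hb.a k' i' j' l'; simp only [HState.put_a]; split <;> assumption, hb.inp, hb.length⟩

/-- The compiled program simulates the structured one with constant overhead. -/
theorem HExec.compile {M W : ℕ} (hM : 20 ≤ M) (hW : M ^ 12 ≤ W) {p : HProg} {h h' : HState}
    {n : ℕ} (H : HExec M p h h' n) :
    ∀ s, Rep h s → h.Bounded M → ∃ s' n', Exec W p.compile s s' n' ∧ Rep h' s' ∧ h'.Bounded M ∧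
      n' ≤ p.weight * n := by
  induction H with
  | skip h =>
    intro s hr hb
    exact ⟨s, 1, .skip s, hr, hb, by simp [HProg.weight]⟩
  | assign x e h he =>
    intro s hr hb
    obtain ⟨f, ee, b⟩ := e.compile_spec hM hW hr hb he
    refine ⟨_, _, .assign _ _ s f, ?_, hb.set x b, by simp [HProg.weight]⟩
    rw [ee]
    exact hr.set x _
  | put k i j l e h hi hj hl he =>
    intro s hr hb
    obtain ⟨f, ee, b⟩ := e.compile_spec hM hW hr hb he
    obtain ⟨fi, ei, bi⟩ := i.compile_spec hM hW hr hb hi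
    obtain ⟨fj, ej, bj⟩ := j.compile_spec hM hW hr hb hj
    obtain ⟨fl, el, bl⟩ := l.compile_spec hM hW hr hb hl
    obtain ⟨fc, ec⟩ := cellExpr_spec hM hW hr hb (k := k) fi fj fl (by omega) (by omega) (by omega)
    refine ⟨_, _, .store _ _ s fc f, ?_, hb.put k _ _ _ b, by simp [HProg.weight]⟩
    rw [ee, ec, ei, ej, el]
    exact hr.put k _ _ _ _
  | seq _ _ ih ih' =>
    intro s hr hb
    obtain ⟨s1, n1, x1, r1, b1, c1⟩ := ih s hr hb
    obtain ⟨s2, n2, x2, r2, b2, c2⟩ := ih' s1 r1 b1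
    refine ⟨s2, _, .seq x1 x2, r2, b2, ?_⟩
    simp only [HProg.weight, mul_add]
    exact add_le_add (c1.trans (Nat.mul_le_mul_right _ (le_max_left _ _)))
      (c2.trans (Nat.mul_le_mul_right _ (le_max_right _ _)))
  | @ite_true e p q _ _ _ he hc _ ih =>
    intro s hr hb
    obtain ⟨f, ee, b⟩ := e.compile_spec hM hW hr hb he
    obtain ⟨s1, n1, x1, r1, b1, c1⟩ := ih s hr hb
    refine ⟨s1, _, .branch_true f (by rwa [ee]) x1, r1, b1, ?_⟩
    simp only [HProg.weight, mul_add, mul_one]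
    exact add_le_add (le_max_left _ _) (c1.trans (Nat.mul_le_mul_right _
      ((le_max_left _ _).trans (le_max_right _ _))))
  | @ite_false e p q _ _ _ he hc _ ih =>
    intro s hr hb
    obtain ⟨f, ee, b⟩ := e.compile_spec hM hW hr hb he
    obtain ⟨s1, n1, x1, r1, b1, c1⟩ := ih s hr hb
    refine ⟨s1, _, .branch_false f (by rwa [ee]) x1, r1, b1, ?_⟩
    simp only [HProg.weight, mul_add, mul_one]
    exact add_le_add (le_max_left _ _) (c1.trans (Nat.mul_le_mul_right _
      ((le_max_right _ _).trans (le_max_right _ _))))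
  | @loop_done e p _ he hc =>
    intro s hr hb
    obtain ⟨f, ee, b⟩ := e.compile_spec hM hW hr hb he
    exact ⟨s, _, .loop_done f (by rwa [ee]), hr, hb, by simp [HProg.weight]⟩
  | @loop_step e p _ _ _ _ _ he hc _ _ ih ih' =>
    intro s hr hb
    obtain ⟨f, ee, b⟩ := e.compile_spec hM hW hr hb he
    obtain ⟨s1, n1, x1, r1, b1, c1⟩ := ih s hr hb
    obtain ⟨s2, n2, x2, r2, b2, c2⟩ := ih' s1 r1 b1
    refine ⟨s2, _, .loop_step f (by rwa [ee]) x1 x2, r2, b2, ?_⟩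
    simp only [HProg.weight, mul_add, mul_one] at c2 ⊢
    exact add_le_add (add_le_add (le_max_left _ _)
      (c1.trans (Nat.mul_le_mul_right _ (le_max_right _ _)))) c2

/-! ### Weakest preconditions with cost -/

/-- The program halts, and the final state and the number of commands satisfy `Q`. -/
def WP (M : ℕ) (p : HProg) (h : HState) (Q : HState → ℕ → Prop) : Prop :=
  ∃ h' n, HExec M p h h' n ∧ Q h' n

namespace WP

variable {M : ℕ} {p q : HProg} {h : HState} {Q Q' : HState → ℕ → Prop} {e : HExpr}

theorem skip (hQ : Q h 1) : WP M .skip h Q := ⟨h, 1, .skip h, hQ⟩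

theorem assign {x : Reg} (he : e.Fits M h) (hQ : Q (h.set x (e.eval h)) 1) :
    WP M (x <== e) h Q := ⟨_, 1, .assign x e h he, hQ⟩

theorem put {k : Arr} {i j l : HExpr} (hi : i.Fits M h) (hj : j.Fits M h) (hl : l.Fits M h)
    (he : e.Fits M h)
    (hQ : Q (h.put k (i.eval h) (j.eval h) (l.eval h) (e.eval h)) 1) :
    WP M (.put k i j l e) h Q := ⟨_, 1, .put k i j l e h hi hj hl he, hQ⟩

theorem seq (H : WP M p h fun h' n => WP M q h' fun h'' n' => Q h'' (n + n')) :
    WP M (p ;; q) h Q := by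
  obtain ⟨h', n, H1, h'', n', H2, H3⟩ := H
  exact ⟨h'', _, .seq H1 H2, H3⟩

theorem ite (he : e.Fits M h) (ht : e.eval h ≠ 0 → WP M p h fun h' n => Q h' (1 + n))
    (hf : e.eval h = 0 → WP M q h fun h' n => Q h' (1 + n)) : WP M (.ite e p q) h Q := by
  by_cases hc : e.eval h = 0
  · obtain ⟨h', n, H, H'⟩ := hf hc
    exact ⟨h', _, .ite_false he hc H, H'⟩
  · obtain ⟨h', n, H, H'⟩ := ht hc
    exact ⟨h', _, .ite_true he hc H, H'⟩

theorem mono (H : WP M p h Q) (hQ : ∀ h' n, Frame p.regs p.arrs h h' → Q h' n → Q' h' n) :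
    WP M p h Q' := by
  obtain ⟨h', n, H1, H2⟩ := H
  exact ⟨h', n, H1, hQ h' n H1.frame H2⟩

theorem loop (I : HState → ℕ → Prop) (μ : HState → ℕ) (h0 : I h 0)
    (step : ∀ h' n, Frame p.regs p.arrs h h' → I h' n →
      e.Fits M h' ∧ (e.eval h' = 0 → Q h' (n + 1)) ∧
      (e.eval h' ≠ 0 → WP M p h' fun h'' k => I h'' (n + 1 + k) ∧ μ h'' < μ h')) :
    WP M (.loop e p) h Q := by
  -- Induction on a strict bound for the measure, for all intermediate states and all numbers of
  -- commands already spent.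
  suffices H : ∀ (N : ℕ) (h' : HState) (n : ℕ), μ h' < N → Frame p.regs p.arrs h h' → I h' n →
      ∃ h'' k, HExec M (.loop e p) h' h'' k ∧ Q h'' (n + k) by
    obtain ⟨h'', k, H1, H2⟩ := H _ h 0 (Nat.lt_succ_self _) (Frame.refl _ _ _) h0
    exact ⟨h'', k, H1, by simpa using H2⟩
  intro N
  induction N with
  | zero => intro h' n hN; omega
  | succ N ih =>
    intro h' n hN hf hI
    obtain ⟨he, hd, hs⟩ := step h' n hf hI
    by_cases hc : e.eval h' = 0
    · exact ⟨h', 1, .loop_done he hc, hd hc⟩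
    · obtain ⟨h1, k1, x1, I1, m1⟩ := hs hc
      obtain ⟨h2, k2, x2, q2⟩ := ih h1 _ (by omega) (hf.trans x1.frame) I1
      refine ⟨h2, _, .loop_step he hc x1 x2, ?_⟩
      rwa [show n + (1 + k1 + k2) = n + 1 + k1 + k2 by omega]

/-- Counting loops: the invariant `I j h n` holds before the round `x = j`, after `n` commands. -/
theorem forRange {x : Reg} {a b : HExpr} (I : ℕ → HState → ℕ → Prop) (B : ℕ)
    (ha : a.Fits M h) (hab : a.eval h ≤ B) (h0 : I (a.eval h) (h.set x (a.eval h)) 0)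
    (bound : ∀ j h' n, Frame (x :: p.regs) p.arrs h h' → a.eval h ≤ j → j ≤ B → h'.v x = j →
      I j h' n → b.Fits M h' ∧ b.eval h' = B)
    (hx : x ∉ p.regs) (hB : B < M)
    (body : ∀ j h' n, Frame (x :: p.regs) p.arrs h h' → a.eval h ≤ j → j < B → h'.v x = j →
      I j h' n → WP M p h' fun h'' k => I (j + 1) (h''.set x (j + 1)) (n + k + 2))
    (post : ∀ h' n, Frame (x :: p.regs) p.arrs h h' → h'.v x = B → I B h' n → Q h' (n + 2)) :
    WP M (.forRange x a b p) h Q := by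
  -- Each round pays a test and an increment besides its body; the initial assignment and the last,
  -- failing test account for the final 2.
  refine seq (assign ha ?_)
  refine WP.loop (fun h' n => Frame (x :: p.regs) p.arrs h h' ∧ a.eval h ≤ h'.v x ∧ h'.v x ≤ B ∧
    I (h'.v x) h' n) (fun h' => B - h'.v x) ⟨⟨fun y hy => ?_, fun _ _ => rfl, rfl⟩, ?_, ?_, ?_⟩ ?_
  · simp only [List.mem_cons, not_or] at hy
    simp [hy.1]
  · simp
  · simpa using hab
  · simpa using h0
  · rintro h' n - ⟨hf, hl, hu, hI⟩
    obtain ⟨fb, eb⟩ := bound _ h' n hf hl hu rfl hI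
    refine ⟨by simpa using fb, fun hc => ?_, fun hc => ?_⟩
    · simp only [HExpr.eval_lt, HExpr.eval_var, eb, ite_eq_right_iff, one_ne_zero, imp_false,
        not_lt] at hc
      rw [show 1 + (n + 1) = n + 2 by omega]
      have hBx : h'.v x = B := le_antisymm hu hc
      exact post h' n hf hBx (hBx ▸ hI)
    · simp only [HExpr.eval_lt, HExpr.eval_var, eb, ne_eq, ite_eq_right_iff, one_ne_zero, imp_false,
        not_lt, not_le] at hc
      refine seq ((body _ h' n hf hl hc rfl hI).mono fun h1 n1 f1 I1 => ?_)
      have hx1 : h1.v x = h'.v x := f1.v x hx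
      refine assign ?_ ⟨⟨?_, ?_, ?_, ?_⟩, ?_⟩
      · simp [hx1]; omega
      · refine ⟨fun y hy => ?_, fun k hk => ?_, f1.inp.trans hf.inp⟩
        · simp only [List.mem_cons, not_or] at hy
          simp only [HState.set_v, hy.1, if_false]
          rw [f1.v y hy.2, hf.v y (by simp [hy])]
        · simp only [HState.set_a]
          rw [f1.a k hk, hf.a k hk]
      · simp [hx1]; omega
      · simp [hx1]; omega
      · simp only [HExpr.eval_add, HExpr.eval_var, HExpr.eval_ofNat, hx1, HState.set_v, if_true]
        rwa [show n + 1 + (n1 + 1) = n + n1 + 2 by omega]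
      · simp [hx1]; omega

end WP

end Structured

/-! ## Disks on the grid, described by an integral convex function -/

namespace GridDisk

/-- `|x - y|` for natural numbers. -/
def gap (x y : ℕ) : ℕ := (x - y) + (y - x)

theorem gap_eq_natAbs (x y : ℕ) : gap x y = ((x : ℤ) - y).natAbs := by
  unfold gap; omega

theorem gap_sq (x y : ℕ) : ((gap x y * gap x y : ℕ) : ℤ) = ((x : ℤ) - y) ^ 2 := by
  rw [gap_eq_natAbs]
  push_cast
  rw [abs_mul_abs_self]; ring

theorem gap_le {U x y : ℕ} (hx : x ≤ U) (hy : y ≤ U) : gap x y ≤ U := by unfold gap; omega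

/-- The lower half of the circle of squared radius `R`, scaled by `2 U`, shifted by `(2 U) ^ 2`,
rounded, and continued convexly beyond the radius. -/
def arc (U R d : ℕ) : ℕ :=
  2 * U * (2 * U) - Nat.sqrt (2 * U * (2 * U) * (R - d * d)) + 2 * U * (2 * U) * (d * d - R)

/-- With `R ≤ N` the subtraction of the root in `arc` is never truncated. -/
theorem sqrt_le_scale {N R d : ℕ} (hR : R ≤ N) : Nat.sqrt (N * (R - d)) ≤ N := by
  calc Nat.sqrt (N * (R - d)) ≤ Nat.sqrt (N * N) := Nat.sqrt_le_sqrt (Nat.mul_le_mul_left _ (by omega))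
    _ = N := Nat.sqrt_eq N

theorem arc_of_le {U R d : ℕ} (h : d * d ≤ R) :
    arc U R d = 2 * U * (2 * U) - Nat.sqrt (2 * U * (2 * U) * (R - d * d)) := by
  simp [arc, Nat.sub_eq_zero_of_le h]

theorem arc_of_lt {U R d : ℕ} (h : R < d * d) :
    arc U R d = 2 * U * (2 * U) + 2 * U * (2 * U) * (d * d - R) := by
  simp [arc, Nat.sub_eq_zero_of_le h.le]

theorem arc_le {U R d : ℕ} : arc U R d ≤ 2 * U * (2 * U) + 2 * U * (2 * U) * (d * d) := by
  unfold arc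
  exact add_le_add (Nat.sub_le _ _) (Nat.mul_le_mul_left _ (Nat.sub_le _ _))

/-- The scale makes the circle so strongly curved that rounding cannot destroy concavity. Let `a`,
`c`, `b` be the roots at `d + 2`, `d + 1`, `d`. If `a + b ≥ 2c + 1`, then `(2c + 1)² ≤ 2(a² + b²)`,
which bounds `c` above in terms of the average radicand; this average is smaller than the middle
radicand by exactly `N`, and `(c + 1)²` exceeds the middle one. Comparison forces `c ≥ N`, hence `N`
is at most the average without its factor `N`, which is less than `R ≤ N`. -/
theorem sqrt_concave {N R d : ℕ} (hN : 0 < N) (hR : R ≤ N) (h : (d + 2) * (d + 2) ≤ R) :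
    Nat.sqrt (N * (R - (d + 2) * (d + 2))) + Nat.sqrt (N * (R - d * d)) ≤
      2 * Nat.sqrt (N * (R - (d + 1) * (d + 1))) := by
  by_contra! hc
  have h1 : (d + 1) * (d + 1) ≤ R := by nlinarith
  have h0 : d * d ≤ R := by nlinarith
  obtain ⟨x, hx⟩ := Nat.exists_eq_add_of_le h
  have e2 : R - (d + 2) * (d + 2) = x := by omega
  have e1 : R - (d + 1) * (d + 1) = x + (2 * d + 3) := by
    have : (d + 2) * (d + 2) = (d + 1) * (d + 1) + (2 * d + 3) := by ring
    omega
  have e0 : R - d * d = x + (4 * d + 4) := by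
    have : (d + 2) * (d + 2) = d * d + (4 * d + 4) := by ring
    omega
  rw [e2, e1, e0] at hc
  have ha := Nat.sqrt_le (N * x)
  have hb := Nat.sqrt_le (N * (x + (4 * d + 4)))
  have hcc := Nat.lt_succ_sqrt (N * (x + (2 * d + 3)))
  simp only [Nat.succ_eq_add_one] at hcc
  set a := Nat.sqrt (N * x)
  set b := Nat.sqrt (N * (x + (4 * d + 4)))
  set c := Nat.sqrt (N * (x + (2 * d + 3)))
  have hA : x + (2 * d + 3) ≤ N := by rw [← e1]; omega
  have ht : (2 * c + 1) * (2 * c + 1) ≤ (a + b) * (a + b) := Nat.mul_self_le_mul_self (by omega)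
  have hab : (a + b) * (a + b) ≤ 2 * (a * a + b * b) := by
    zify; nlinarith [sq_nonneg ((a : ℤ) - b)]
  have key : (2 * c + 1) * (2 * c + 1) ≤ 4 * (N * (x + (2 * d + 2))) := by nlinarith
  have hNc : N ≤ c := by
    have i1 : (2 * c + 1) * (2 * c + 1) = 4 * (c * c) + 4 * c + 1 := by ring
    have i2 : (c + 1) * (c + 1) = c * c + 2 * c + 1 := by ring
    have i3 : N * (x + (2 * d + 3)) = N * (x + (2 * d + 2)) + N := by ring
    omega
  have : N * N ≤ N * (x + (2 * d + 2)) := by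
    have := Nat.mul_self_le_mul_self (show 2 * N ≤ 2 * c + 1 by omega)
    rw [show 2 * N * (2 * N) = 4 * (N * N) by ring] at this
    omega
  have := Nat.le_of_mul_le_mul_left this hN
  omega

/-- Inside the radius this is concavity of the rounded root. Where the circle ends, the penalty is
at least one full unit `(2U)²`, which dominates because values inside never exceed `(2U)²`; outside,
the penalty is a multiple of the convex function `d² - R`. -/
theorem arc_convex {U R : ℕ} (hU : 0 < U) (hR : R ≤ 2 * U * (2 * U)) (d : ℕ) :
    2 * arc U R (d + 1) ≤ arc U R (d + 2) + arc U R d := by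
  have hN : 0 < 2 * U * (2 * U) := by positivity
  have e2 : (d + 2) * (d + 2) = d * d + 4 * d + 4 := by ring
  have e1 : (d + 1) * (d + 1) = d * d + 2 * d + 1 := by ring
  rcases le_or_gt ((d + 2) * (d + 2)) R with h2 | h2
  · rw [arc_of_le h2, arc_of_le (d := d) (by omega), arc_of_le (d := d + 1) (by omega)]
    have := sqrt_concave hN hR h2
    have i0 := sqrt_le_scale (d := d * d) hR
    have i1 := sqrt_le_scale (d := (d + 1) * (d + 1)) hR
    have i2 := sqrt_le_scale (d := (d + 2) * (d + 2)) hR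
    omega
  · rw [arc_of_lt h2]
    rcases le_or_gt ((d + 1) * (d + 1)) R with h1 | h1
    · rw [arc_of_le h1]
      have : 2 * U * (2 * U) * 1 ≤ 2 * U * (2 * U) * ((d + 2) * (d + 2) - R) :=
        Nat.mul_le_mul_left _ (by omega)
      omega
    · rw [arc_of_lt h1]
      rcases le_or_gt (d * d) R with h0 | h0
      · have : 2 * U * (2 * U) * (2 * ((d + 1) * (d + 1) - R) + 1) ≤
            2 * U * (2 * U) * ((d + 2) * (d + 2) - R) := Nat.mul_le_mul_left _ (by omega)
        rw [mul_add _ (2 * _), mul_left_comm _ 2] at this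
        omega
      · rw [arc_of_lt h0]
        have : 2 * U * (2 * U) * (2 * ((d + 1) * (d + 1) - R)) ≤
            2 * U * (2 * U) * (((d + 2) * (d + 2) - R) + (d * d - R)) :=
          Nat.mul_le_mul_left _ (by omega)
        rw [mul_add _ ((d + 2) * (d + 2) - R), mul_left_comm _ 2] at this
        omega

/-- This is convexity at the origin of the even extension of `arc` to negative arguments. -/
theorem arc_zero_le_one {U R : ℕ} (hR : R ≤ 2 * U * (2 * U)) :
    arc U R 0 ≤ arc U R 1 := by
  rw [arc_of_le (by simp)]
  rcases le_or_gt (1 * 1) R with h | h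
  · rw [arc_of_le h]
    have : Nat.sqrt (2 * U * (2 * U) * (R - 1 * 1)) ≤ Nat.sqrt (2 * U * (2 * U) * (R - 0 * 0)) :=
      Nat.sqrt_le_sqrt (Nat.mul_le_mul_left _ (by omega))
    omega
  · rw [arc_of_lt h]; omega

/-- Convexity in local form says that unit increments grow; summing over the length and then
iterating the shift gives it for all lengths and shifts. -/
theorem increments_mono {G : ℤ → ℤ} (hG : ∀ k, 2 * G (k + 1) ≤ G (k + 2) + G k) (a : ℤ)
    (m n : ℕ) : G (a + n) - G a ≤ G (a + m + n) - G (a + m) := by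
  have step : ∀ (n : ℕ) (a : ℤ), G (a + n) - G a ≤ G (a + 1 + n) - G (a + 1) := by
    intro n
    induction n with
    | zero => intro a; simp
    | succ n ih =>
      intro a
      have h1 := ih a
      have h2 := hG (a + n)
      rw [show a + 1 + (n : ℤ) = a + n + 1 by ring] at h1
      push_cast
      rw [show a + 1 + ((n : ℤ) + 1) = a + n + 2 by ring, show a + ((n : ℤ) + 1) = a + n + 1 by ring]
      linarith
  induction m with
  | zero => simp
  | succ m ih =>
    have := step n (a + m)
    push_cast
    rw [show a + ((m : ℤ) + 1) = a + m + 1 by ring]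
    linarith

/-- The Monge property of convex functions of the distance. -/
theorem arc_monge {U R : ℕ} (hU : 0 < U) (hR : R ≤ 2 * U * (2 * U)) {x x' X X' : ℕ}
    (hx : x ≤ x') (hX : X ≤ X') :
    arc U R (gap X x) + arc U R (gap X' x') ≤ arc U R (gap X' x) + arc U R (gap X x') := by
  have hG : ∀ k : ℤ, 2 * (arc U R (k + 1).natAbs : ℤ) ≤
      arc U R (k + 2).natAbs + arc U R k.natAbs := by
    intro k
    rcases lt_trichotomy k (-1) with h | h | h
    · obtain ⟨d, hd⟩ : ∃ d : ℕ, k = -(d + 2) := ⟨(-k - 2).toNat, by omega⟩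
      have := arc_convex hU hR d
      rw [show (k + 1).natAbs = d + 1 by omega, show (k + 2).natAbs = d by omega,
        show k.natAbs = d + 2 by omega]
      exact_mod_cast (by omega : 2 * arc U R (d + 1) ≤ arc U R d + arc U R (d + 2))
    · subst h
      have := arc_zero_le_one hR
      simp only [Int.reduceNeg, Int.reduceAdd, Int.natAbs_zero, Int.natAbs_one, Int.natAbs_neg]
      omega
    · obtain ⟨d, hd⟩ : ∃ d : ℕ, k = d := ⟨k.toNat, by omega⟩
      have := arc_convex hU hR d
      rw [show (k + 1).natAbs = d + 1 by omega, show (k + 2).natAbs = d + 2 by omega,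
        show k.natAbs = d by omega]
      exact_mod_cast this
  -- With base `X - x'`, length `x' - x` and shift `X' - X`, the four endpoints are the four
  -- differences of the Monge inequality.
  have := increments_mono (G := fun k => (arc U R k.natAbs : ℤ)) hG ((X : ℤ) - x') (x' - x) (X' - X)
  simp only [gap_eq_natAbs]
  rw [show (X : ℤ) - x' + ((X' - X : ℕ) : ℤ) = X' - x' by omega,
    show (X : ℤ) - x' + ((x' - x : ℕ) : ℤ) + ((X' - X : ℕ) : ℤ) = X' - x by omega,
    show (X : ℤ) - x' + ((x' - x : ℕ) : ℤ) = X - x by omega] at this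
  omega

/-- Rounding loses nothing, since an integer is at most a square root iff it is at most its integer
part; squaring then lets the factor `(2U)²` cancel. The truncated `y - Y` makes the condition
one-sided. Beyond the radius, `arc` is at least twice `(2U)²`, while the right-hand side is smaller
because `Y ≤ U`. -/
theorem arc_le_iff {U R d y Y : ℕ} (hU : 0 < U) (hR : R ≤ 2 * U * (2 * U)) (hY : Y ≤ U) :
    2 * U * y + arc U R d ≤ 2 * U * Y + 2 * U * (2 * U) ↔
      d * d ≤ R ∧ (y - Y) * (y - Y) + d * d ≤ R := by
  rcases le_or_gt (d * d) R with h | h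
  · have i := sqrt_le_scale (d := d * d) hR
    rw [arc_of_le h]
    have e1 : 2 * U * y + (2 * U * (2 * U) - Nat.sqrt (2 * U * (2 * U) * (R - d * d))) ≤
        2 * U * Y + 2 * U * (2 * U) ↔
        2 * U * (y - Y) ≤ Nat.sqrt (2 * U * (2 * U) * (R - d * d)) := by
      rw [Nat.mul_sub (2 * U) y Y]; omega
    rw [e1, Nat.le_sqrt, show 2 * U * (y - Y) * (2 * U * (y - Y)) =
      2 * U * (2 * U) * ((y - Y) * (y - Y)) by ring, mul_le_mul_iff_right₀ (by positivity)]
    omega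
  · rw [arc_of_lt h]
    refine iff_of_false ?_ (by omega)
    have h1 : 2 * U * (2 * U) * 1 ≤ 2 * U * (2 * U) * (d * d - R) :=
      Nat.mul_le_mul_left _ (by omega)
    have h2 : 2 * U * Y < 2 * U * (2 * U) := Nat.mul_lt_mul_of_pos_left (by omega) (by omega)
    omega

/-- The grid points `p` and `c` have squared distance at most `R`. -/
def Near (R : ℕ) (p c : ℕ × ℕ) : Prop :=
  ((p.1 : ℤ) - c.1) ^ 2 + ((p.2 : ℤ) - c.2) ^ 2 ≤ R

/-- A two-sided bound on `y - Y` is the one-sided bound for the heights together with the one-sided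
bound for the reflected heights. -/
theorem near_iff {U R x y X Y : ℕ} (hU : 0 < U) (hR : R ≤ 2 * U * (2 * U)) (hy : y ≤ U)
    (hY : Y ≤ U) : Near R (x, y) (X, Y) ↔
      2 * U * y + arc U R (gap X x) ≤ 2 * U * Y + 2 * U * (2 * U) ∧
      2 * U * (U + 1 - y) + arc U R (gap X x) ≤ 2 * U * (U + 1 - Y) + 2 * U * (2 * U) := by
  have hgap := gap_sq X x
  rw [arc_le_iff hU hR hY]
  have key : Near R (x, y) (X, Y) ↔ gap y Y * gap y Y + gap X x * gap X x ≤ R := by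
    unfold Near
    have := gap_sq y Y
    zify
    push_cast at this hgap
    rw [this, hgap]
    constructor <;> intro h <;> nlinarith
  rw [key]
  -- For `Y = 0` the reflected height `U + 1` is outside the range of `arc_le_iff`, so this case is
  -- treated by hand.
  rcases Nat.eq_zero_or_pos Y with h0 | h0
  · subst h0
    rcases Nat.eq_zero_or_pos y with h1 | h1
    · subst h1
      have e : 2 * U * (U + 1 - 0) + arc U R (gap X x) ≤
          2 * U * (U + 1 - 0) + 2 * U * (2 * U) ↔
        2 * U * 0 + arc U R (gap X x) ≤ 2 * U * 0 + 2 * U * (2 * U) := by omega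
      rw [e, arc_le_iff hU hR (by omega)]
      simp [gap]
    · rw [show gap y 0 = y by simp [gap]]
      have hle : 2 * U * (U + 1 - y) ≤ 2 * U * (U + 1 - 0) := Nat.mul_le_mul_left _ (by omega)
      constructor
      · intro h
        have h2 := (arc_le_iff (y := y) (Y := 0) (d := gap X x) hU hR (by omega)).2
          ⟨by omega, by simpa using h⟩
        have h3 : 2 * U * 0 ≤ 2 * U * y := Nat.mul_le_mul_left _ (by omega)
        refine ⟨⟨by omega, by simpa using h⟩, by omega⟩
      · rintro ⟨⟨-, h⟩, -⟩
        simpa using h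
  · rw [arc_le_iff hU hR (by omega)]
    rcases le_total y Y with h | h
    · rw [show gap y Y = Y - y by unfold gap; omega, show U + 1 - y - (U + 1 - Y) = Y - y by omega,
        Nat.sub_eq_zero_of_le h]
      constructor
      · intro h1; refine ⟨⟨by omega, by omega⟩, by omega, h1⟩
      · exact fun h1 => h1.2.2
    · rw [show gap y Y = y - Y by unfold gap; omega,
        Nat.sub_eq_zero_of_le (n := U + 1 - y) (m := U + 1 - Y) (by omega)]
      constructor
      · intro h1; refine ⟨⟨by omega, h1⟩, by omega, by omega⟩
      · exact fun h1 => h1.1.2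

/-- The least `Y` with `a ≤ N * Y + b`, or `U + 1` if that is smaller. -/
def clip (U N b a : ℕ) : ℕ := min (U + 1) ((a - b + (N - 1)) / N)

theorem clip_le (U N b a : ℕ) : clip U N b a ≤ U + 1 := min_le_left _ _

theorem clip_le_iff {U N b a Y : ℕ} (hN : 0 < N) (hY : Y ≤ U) :
    clip U N b a ≤ Y ↔ a ≤ N * Y + b := by
  unfold clip
  have : (a - b + (N - 1)) / N ≤ Y ↔ a ≤ N * Y + b := by
    rw [← Nat.lt_add_one_iff, Nat.div_lt_iff_lt_mul hN, Nat.succ_mul, mul_comm Y N]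
    omega
  rw [min_le_iff, this]
  omega

/-- The lower boundary, in a column at distance `d`, of the disk around a point of height `y`. -/
def low (U R y d : ℕ) : ℕ := clip U (2 * U) (2 * U * (2 * U)) (2 * U * y + arc U R d)

theorem near_iff_low {U R x y X Y : ℕ} (hU : 0 < U) (hR : R ≤ 2 * U * (2 * U)) (hy : y ≤ U)
    (hY : 1 ≤ Y) (hY' : Y ≤ U) : Near R (x, y) (X, Y) ↔
      low U R y (gap X x) ≤ Y ∧ low U R (U + 1 - y) (gap X x) ≤ U + 1 - Y := by
  rw [near_iff hU hR hy hY', low, low, clip_le_iff (by omega) hY',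
    clip_le_iff (by omega) (by omega)]

theorem near_comm {R : ℕ} {p c : ℕ × ℕ} : Near R p c ↔ Near R c p := by
  unfold Near
  constructor <;> intro h <;> nlinarith

/-! ### Column tops -/

/-- `f x` is the largest height of a point of `P` in column `x`, and `0` if there is none. -/
def IsTop (U : ℕ) (P : ℕ → ℕ → Prop) (f : ℕ → ℕ) : Prop :=
  ∀ x, 1 ≤ x → x ≤ U → (∀ y, P x y → y ≤ f x) ∧ (f x ≠ 0 → P x (f x))

/-- The reflection of a set of grid points in the horizontal middle line. -/
def mirror (U : ℕ) (P : ℕ → ℕ → Prop) (x y : ℕ) : Prop := 1 ≤ y ∧ y ≤ U ∧ P x (U + 1 - y)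

/-- The set itself, or its reflection. -/
def flip (U : ℕ) : Bool → (ℕ → ℕ → Prop) → ℕ → ℕ → Prop
  | false, P => P
  | true, P => mirror U P

/-- The height itself, or its reflection. -/
def flipY (U : ℕ) : Bool → ℕ → ℕ
  | false, y => y
  | true, y => U + 1 - y

/-- All points of `P` lie in the grid. -/
def InBox (U : ℕ) (P : ℕ → ℕ → Prop) : Prop :=
  ∀ x y, P x y → (1 ≤ x ∧ x ≤ U) ∧ 1 ≤ y ∧ y ≤ U

/-- The weight of a column with top `f`. -/
def enc (U f : ℕ) : ℕ :=
  if f = 0 then 0 else 2 * U * f + 2 * U * (2 * U) * (2 * U * (2 * U))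

theorem enc_le {U f : ℕ} (hf : f ≤ U) :
    enc U f ≤ 2 * U * U + 2 * U * (2 * U) * (2 * U * (2 * U)) := by
  unfold enc
  split
  · exact Nat.zero_le _
  · exact Nat.add_le_add_right (Nat.mul_le_mul_left _ hf) _

theorem IsTop.le {U : ℕ} {P : ℕ → ℕ → Prop} {f : ℕ → ℕ} (hP : InBox U P) (hf : IsTop U P f)
    {x : ℕ} (hx : 1 ≤ x) (hx' : x ≤ U) : f x ≤ U := by
  by_cases h : f x = 0
  · omega
  · exact (hP _ _ ((hf x hx hx').2 h)).2.2

/-- The offset is the square of `(2U)²`. At distances up to `U`, `arc` is at most `(2U)²` plus this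
offset, so an empty column, of weight 0, never constrains a center; in a nonempty column the offset
cancels. Thus the maximum may run over all columns, and the Monge property is not disturbed by
missing ones. -/
theorem enc_arc_le_iff {U R f d Y : ℕ} (hd : d ≤ U) :
    enc U f + arc U R d ≤ 2 * U * Y + (2 * U * (2 * U) + 2 * U * (2 * U) * (2 * U * (2 * U))) ↔
      (f ≠ 0 → 2 * U * f + arc U R d ≤ 2 * U * Y + 2 * U * (2 * U)) := by
  unfold enc
  split_ifs with h
  · have h1 := @arc_le U R d
    have h2 : 2 * U * (2 * U) * (d * d) ≤ 2 * U * (2 * U) * (2 * U * (2 * U)) :=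
      Nat.mul_le_mul_left _ (Nat.mul_le_mul (by omega) (by omega))
    simp only [h, ne_eq, not_true_eq_false, false_imp_iff, iff_true]
    omega
  · simp only [ne_eq, h, not_false_eq_true, true_imp_iff]
    omega

/-- `a` bounds the centers in column `X` whose disks contain all points with the given weights. -/
def IsBound (U R : ℕ) (w : ℕ → ℕ) (X a : ℕ) : Prop :=
  a ≤ U + 1 ∧ ∀ Y ≤ U, a ≤ Y ↔ ∀ x, 1 ≤ x → x ≤ U →
    w x + arc U R (gap X x) ≤ 2 * U * Y + (2 * U * (2 * U) + 2 * U * (2 * U) * (2 * U * (2 * U)))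

/-- A disk contains a set of grid points if and only if its center satisfies the two bounds. -/
theorem forall_near_iff {U R : ℕ} (hU : 0 < U) (hR : R ≤ 2 * U * (2 * U)) {P : ℕ → ℕ → Prop}
    (hP : InBox U P) {f : Bool → ℕ → ℕ} (hf : ∀ b, IsTop U (flip U b P) (f b)) {X : ℕ}
    (hX : X ≤ U) {a : Bool → ℕ} (ha : ∀ b, IsBound U R (fun x => enc U (f b x)) X (a b))
    {Y : ℕ} (hY : 1 ≤ Y) (hY' : Y ≤ U) :
    (∀ x y, P x y → Near R (x, y) (X, Y)) ↔ a false ≤ Y ∧ a true ≤ U + 1 - Y := by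
  have h0 := (ha false).2 Y hY'
  have h1 := (ha true).2 (U + 1 - Y) (by omega)
  have ht0 := hf false
  have ht1 := hf true
  simp only [flip] at ht0 ht1
  rw [h0, h1]
  constructor
  · intro h
    refine ⟨fun x hx hx' => (enc_arc_le_iff (gap_le hX hx')).2 fun hne => ?_,
      fun x hx hx' => (enc_arc_le_iff (gap_le hX hx')).2 fun hne => ?_⟩
    · have hp := (ht0 x hx hx').2 hne
      have hb := hP _ _ hp
      exact ((near_iff hU hR hb.2.2 hY').1 (h _ _ hp)).1
    · obtain ⟨hb, hb', hp⟩ := (ht1 x hx hx').2 hne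
      have := ((near_iff hU hR (by omega) hY').1 (h _ _ hp)).2
      rwa [show U + 1 - (U + 1 - f true x) = f true x by omega] at this
  · rintro ⟨h2, h3⟩ x y hp
    obtain ⟨⟨hx, hx'⟩, hy, hy'⟩ := hP _ _ hp
    have i0 := (ht0 x hx hx').1 y hp
    have i1 := (ht1 x hx hx').1 (U + 1 - y)
      ⟨by omega, by omega, by rwa [show U + 1 - (U + 1 - y) = y by omega]⟩
    have j0 := (enc_arc_le_iff (gap_le hX hx')).1 (h2 x hx hx') (by omega)
    have j1 := (enc_arc_le_iff (gap_le hX hx')).1 (h3 x hx hx') (by omega)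
    -- The condition is monotone in the height, so the column's top, in each orientation, is the
    -- only point that counts.
    have k0 : 2 * U * y ≤ 2 * U * f false x := Nat.mul_le_mul_left _ i0
    have k1 : 2 * U * (U + 1 - y) ≤ 2 * U * f true x := Nat.mul_le_mul_left _ i1
    exact (near_iff hU hR hy' hY').2 ⟨by omega, by omega⟩

/-! ### Largest elements below a bound -/

/-- `v` is the largest positive element of `S` up to `n`, and `0` if there is none. -/
def IsPrev (S : ℕ → Prop) (n v : ℕ) : Prop :=
  v ≤ n ∧ (v ≠ 0 → S v) ∧ ∀ z, 1 ≤ z → z ≤ n → S z → z ≤ v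

theorem IsPrev.zero (S : ℕ → Prop) : IsPrev S 0 0 :=
  ⟨le_rfl, fun h => absurd rfl h, fun z h h' _ => by omega⟩

theorem IsPrev.succ_of_mem {S : ℕ → Prop} {n : ℕ} (h : S (n + 1)) : IsPrev S (n + 1) (n + 1) :=
  ⟨le_rfl, fun _ => h, fun _ _ h' _ => h'⟩

theorem IsPrev.succ_of_notMem {S : ℕ → Prop} {n v : ℕ} (hv : IsPrev S n v) (h : ¬ S (n + 1)) :
    IsPrev S (n + 1) v := by
  refine ⟨hv.1.trans (Nat.le_succ _), hv.2.1, fun z h1 h2 h3 => ?_⟩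
  rcases Nat.lt_or_ge n z with h4 | h4
  · exact absurd (show S (n + 1) by rwa [show n + 1 = z by omega]) h
  · exact hv.2.2 z h1 h4 h3

/-- The points of `S` that a disk with column bounds `a` misses. -/
def missed (U : ℕ) (S : ℕ → ℕ → Prop) (a : Bool → ℕ → ℕ) (x y : ℕ) : Prop :=
  S x y ∧ (y < a false x ∨ U + 1 - y < a true x)

/-- A disk meets a column in an interval. If the highest point of the column lies above the
interval, it is the highest missed point; otherwise every missed point lies below the interval, and
the largest element under its lower end is wanted. Reflection exchanges the two ends, so one
argument with abstract bounds serves both orientations. -/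
theorem isTop_missed {U : ℕ} {S : ℕ → ℕ → Prop} (hS : InBox U S) {a : Bool → ℕ → ℕ}
    (ha : ∀ b x, a b x ≤ U + 1) {p : Bool → ℕ → ℕ → ℕ}
    (hp : ∀ b x, 1 ≤ x → x ≤ U → ∀ y ≤ U, IsPrev (flip U b S x) y (p b x y)) (b : Bool) :
    IsTop U (flip U b (missed U S a)) fun x =>
      if U + 1 < a (!b) x + p b x U then p b x U else p b x (a b x - 1) := by
  have main : ∀ (S : ℕ → ℕ → Prop) (a a' : ℕ → ℕ) (p : ℕ → ℕ → ℕ),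
      (∀ x y, S x y → 1 ≤ y ∧ y ≤ U) → (∀ x, a x ≤ U + 1) → (∀ x, a' x ≤ U + 1) →
      (∀ x, 1 ≤ x → x ≤ U → ∀ y ≤ U, IsPrev (S x) y (p x y)) →
      IsTop U (fun x y => S x y ∧ (y < a x ∨ U + 1 - y < a' x)) fun x =>
        if U + 1 < a' x + p x U then p x U else p x (a x - 1) := by
    intro S a a' p hS ha ha' hp x hx hx'
    have h1 := hp x hx hx' U le_rfl
    have h2 := hp x hx hx' (a x - 1) (by have := ha x; omega)
    have h3 := ha' x
    simp only
    split_ifs with hc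
    · exact ⟨fun y hy => h1.2.2 y (hS _ _ hy.1).1 (hS _ _ hy.1).2 hy.1,
        fun h0 => ⟨h1.2.1 h0, by have := h1.1; omega⟩⟩
    · refine ⟨fun y hy => ?_, fun h0 => ⟨h2.2.1 h0, by have := h2.1; omega⟩⟩
      have hy1 := hS _ _ hy.1
      have := h1.2.2 y hy1.1 hy1.2 hy.1
      exact h2.2.2 y hy1.1 (by omega) hy.1
  cases b
  · exact main S (a false) (a true) (p false) (fun x y h => (hS x y h).2) (ha _) (ha _)
      (hp false)
  · have := main (mirror U S) (a true) (a false) (p true) (fun x y h => ⟨h.1, h.2.1⟩) (ha _) (ha _)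
      (hp true)
    intro x hx hx'
    obtain ⟨i1, i2⟩ := this x hx hx'
    refine ⟨fun y hy => i1 y ?_, fun h0 => ?_⟩
    · obtain ⟨j1, j2, j3, j4⟩ := hy
      exact ⟨⟨j1, j2, j3⟩, by omega⟩
    · obtain ⟨⟨j1, j2, j3⟩, j4⟩ := i2 h0
      refine ⟨j1, j2, j3, ?_⟩
      simp only [Bool.not_true] at j1 j2 j4 ⊢
      omega

/-! ### Blocked heights -/

/-- The height `Y` is blocked by one of the ranges `l ≤ Y < r l`. -/
def Blocked (r : ℕ → ℕ) (Y : ℕ) : Prop := ∃ l, 1 ≤ l ∧ l ≤ Y ∧ Y < r l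

/-- The new condition means `U + 2 - v ≤ Y < u`, and ranges with the same left end are merged by
keeping the larger right end. For `v = 0` the left end `U + 2` is above every height, so nothing is
blocked. -/
theorem blocked_update {U : ℕ} {r r' : ℕ → ℕ} {u v Y : ℕ} (hY : Y ≤ U) (hv : v ≤ U + 1)
    (hr : ∀ l, r' l = if l = U + 2 - v then max (r (U + 2 - v)) u else r l) :
    Blocked r' Y ↔ Blocked r Y ∨ Y < u ∧ U + 1 - Y < v := by
  unfold Blocked
  constructor
  · rintro ⟨l, h1, h2, h3⟩
    rw [hr] at h3
    split_ifs at h3 with hl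
    · rcases lt_max_iff.1 h3 with h4 | h4
      · exact Or.inl ⟨l, h1, h2, by rwa [hl]⟩
      · exact Or.inr ⟨h4, by omega⟩
    · exact Or.inl ⟨l, h1, h2, h3⟩
  · rintro (⟨l, h1, h2, h3⟩ | ⟨h1, h2⟩)
    · refine ⟨l, h1, h2, ?_⟩
      rw [hr]
      split_ifs with hl
      · rw [← hl]; exact h3.trans_le (le_max_left _ _)
      · exact h3
    · refine ⟨U + 2 - v, by omega, by omega, ?_⟩
      rw [hr, if_pos rfl]
      exact h1.trans_le (le_max_right _ _)

/-! ### Bichromatic covers by disks with grid centers -/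

open IB2C

/-- `p` and `q` form a pair of `T`. -/
def Adj (T : List PointPair) (p : ℕ × ℕ) (x y : ℕ) : Prop :=
  (p, (x, y)) ∈ T ∨ ((x, y), p) ∈ T

/-- The points that occur in `T`. -/
def Pts (T : List PointPair) (x y : ℕ) : Prop :=
  ∃ p ∈ T, p.1 = (x, y) ∨ p.2 = (x, y)

/-- The disks with squared radius `R` around `c₁` and `c₂` bichromatically cover `T`. -/
def Covers (R : ℕ) (T : List PointPair) (c₁ c₂ : ℕ × ℕ) : Prop :=
  ∀ p ∈ T, Near R p.1 c₁ ∧ Near R p.2 c₂ ∨ Near R p.2 c₁ ∧ Near R p.1 c₂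

/-- The disk with squared radius `R` around `c` meets all pairs. -/
def Meets (R : ℕ) (T : List PointPair) (c : ℕ × ℕ) : Prop :=
  ∀ p ∈ T, Near R p.1 c ∨ Near R p.2 c

/-- For two points and two disks, a bijective assignment exists as soon as each disk contains a
point and each point lies in a disk: this is Hall's condition. -/
theorem covers_iff {R : ℕ} {T : List PointPair} {c₁ c₂ : ℕ × ℕ} :
    Covers R T c₁ c₂ ↔ Meets R T c₁ ∧ Meets R T c₂ ∧
      ∀ x y, Pts T x y → Near R (x, y) c₁ ∨ Near R (x, y) c₂ := by
  constructor
  · intro h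
    refine ⟨fun p hp => ?_, fun p hp => ?_, ?_⟩
    · rcases h p hp with h | h
      · exact Or.inl h.1
      · exact Or.inr h.1
    · rcases h p hp with h | h
      · exact Or.inr h.2
      · exact Or.inl h.2
    · rintro x y ⟨p, hp, h1 | h1⟩ <;> rw [← h1] <;> rcases h p hp with h | h
      · exact Or.inl h.1
      · exact Or.inr h.2
      · exact Or.inr h.2
      · exact Or.inl h.1
  · rintro ⟨h1, h2, h3⟩ p hp
    have a1 := h1 p hp
    have a2 := h2 p hp
    have a3 := h3 _ _ ⟨p, hp, Or.inl rfl⟩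
    have a4 := h3 _ _ ⟨p, hp, Or.inr rfl⟩
    simp only [Prod.mk.eta] at a3 a4
    tauto

/-- Grouping the pairs by a point `p` treats all partners of `p` as one point set, which makes the
cost independent of the number of pairs. -/
theorem meets_iff {R : ℕ} {T : List PointPair} {c : ℕ × ℕ} :
    Meets R T c ↔ ∀ p, Near R p c ∨ ∀ x y, Adj T p x y → Near R (x, y) c := by
  constructor
  · intro h p
    by_cases hp : Near R p c
    · exact Or.inl hp
    · refine Or.inr fun x y hq => ?_
      rcases hq with hq | hq
      · exact (h _ hq).resolve_left hp
      · exact (h _ hq).resolve_right hp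
  · intro h p hp
    exact (h p.1).imp id fun h' => h' _ _ (Or.inl hp)

theorem adj_inBox {U : ℕ} {T : List PointPair} (hT : ∀ p ∈ T, p.InGrid U) (p : ℕ × ℕ) :
    InBox U (Adj T p) := by
  rintro x y (h | h)
  · exact (hT _ h).2
  · exact (hT _ h).1

theorem pts_inBox {U : ℕ} {T : List PointPair} (hT : ∀ p ∈ T, p.InGrid U) : InBox U (Pts T) := by
  rintro x y ⟨p, hp, h | h⟩
  · have := (hT _ hp).1; rw [h] at this; exact this
  · have := (hT _ hp).2; rw [h] at this; exact this

theorem adj_left_inBox {U : ℕ} {T : List PointPair} (hT : ∀ p ∈ T, p.InGrid U) {p : ℕ × ℕ}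
    {x y : ℕ} (h : Adj T p x y) : (1 ≤ p.1 ∧ p.1 ≤ U) ∧ 1 ≤ p.2 ∧ p.2 ≤ U := by
  rcases h with h | h
  · exact (hT _ h).1
  · exact (hT _ h).2

end GridDisk

/-! ## Column bounds by divide and conquer -/

namespace GridDisk

/-- `a` maximizes `val X` on `[1, U]`. -/
structure Opt (U : ℕ) (val : ℕ → ℕ → ℕ) (X a : ℕ) : Prop where
  one_le : 1 ≤ a
  le : a ≤ U
  max : ∀ x, 1 ≤ x → x ≤ U → val X x ≤ val X a

/-- The Monge condition. -/
def Monge (val : ℕ → ℕ → ℕ) : Prop :=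
  ∀ X X' x x', X ≤ X' → x ≤ x' → val X x + val X' x' ≤ val X' x + val X x'

/-- `f` holds maximizers for all multiples of `st`. -/
structure Level (U : ℕ) (val : ℕ → ℕ → ℕ) (st : ℕ) (f : ℕ → ℕ) : Prop where
  zero : f 0 = U
  big : ∀ X, U < X → X ≤ 3 * U → f X = 1
  opt : ∀ i, 1 ≤ i * st → i * st ≤ U → Opt U val (i * st) (f (i * st))
  mono : ∀ i, i * st ≤ U → f (i * st + st) ≤ f (i * st)

/-- `f` holds maximizers for all even multiples of `st` and for the first `j` odd ones. -/
structure PartialLevel (U : ℕ) (val : ℕ → ℕ → ℕ) (st j : ℕ) (f : ℕ → ℕ) : Prop where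
  zero : f 0 = U
  big : ∀ X, U < X → X ≤ 3 * U → f X = 1
  even : ∀ i, 1 ≤ 2 * (i * st) → 2 * (i * st) ≤ U → Opt U val (2 * (i * st)) (f (2 * (i * st)))
  odd : ∀ i < j, Opt U val (2 * (i * st) + st) (f (2 * (i * st) + st))
  mono : ∀ i, 2 * (i * st) ≤ U → f (2 * (i * st) + 2 * st) ≤ f (2 * (i * st))
  mono₁ : ∀ i < j, f (2 * (i * st) + st) ≤ f (2 * (i * st))
  mono₂ : ∀ i < j, f (2 * (i * st) + 2 * st) ≤ f (2 * (i * st) + st)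

variable {U : ℕ} {val : ℕ → ℕ → ℕ} {st j : ℕ} {f : ℕ → ℕ}

/-- When the step exceeds `U`, the only multiple in range is 0, and only the sentinels `U` at 0 and
`1` beyond `U` remain. -/
theorem Level.init (hU : 1 ≤ U) (hst : U < st) (hst' : st ≤ 2 * U) (h0 : f 0 = U)
    (h1 : ∀ X, 1 ≤ X → X ≤ 3 * U → f X = 1) : Level U val st f := by
  have key : ∀ i, i * st ≤ U → i = 0 := by
    intro i hi
    by_contra hc
    have := Nat.le_mul_of_pos_left st (Nat.pos_of_ne_zero hc)
    omega
  refine ⟨h0, fun X h h' => h1 X (by omega) h', fun i h h' => ?_, fun i h => ?_⟩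
  · rw [key i h'] at h; omega
  · rw [key i h, zero_mul, h0, h1 _ (by omega) (by omega)]; exact hU

theorem Level.toPartial (h : Level U val (2 * st) f) : PartialLevel U val st 0 f := by
  have e : ∀ i, i * (2 * st) = 2 * (i * st) := fun i => by ring
  refine ⟨h.zero, h.big, fun i h1 h2 => ?_, fun i hi => absurd hi (Nat.not_lt_zero _),
    fun i h1 => ?_, fun i hi => absurd hi (Nat.not_lt_zero _),
    fun i hi => absurd hi (Nat.not_lt_zero _)⟩
  · have := h.opt i; rw [e] at this; exact this h1 h2
  · have := h.mono i; rw [e] at this; exact this h1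

theorem PartialLevel.toLevel (hst : 1 ≤ st) (hstU : st ≤ U) (h : PartialLevel U val st j f)
    (hj : U < 2 * (j * st) + st) : Level U val st f := by
  have odd_lt : ∀ i, 2 * (i * st) + st ≤ U → i < j := by
    intro i hi
    by_contra! hc
    have := Nat.mul_le_mul_right st hc
    omega
  have one_le : ∀ i, i * st ≤ U → 1 ≤ f (i * st) := by
    intro i hi
    rcases Nat.even_or_odd' i with ⟨k, rfl | rfl⟩
    · rcases Nat.eq_zero_or_pos (2 * k * st) with h0 | h0
      · rw [h0, h.zero]; omega
      · have := (h.even k (by rw [← mul_assoc]; omega) (by rw [← mul_assoc]; omega)).one_le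
        rwa [← mul_assoc] at this
    · have e : (2 * k + 1) * st = 2 * (k * st) + st := by ring
      rw [e] at hi ⊢
      exact (h.odd k (odd_lt k hi)).one_le
  refine ⟨h.zero, h.big, fun i h1 h2 => ?_, fun i h1 => ?_⟩
  · rcases Nat.even_or_odd' i with ⟨k, rfl | rfl⟩
    · have e : 2 * k * st = 2 * (k * st) := by ring
      rw [e] at h1 h2 ⊢
      exact h.even k h1 h2
    · have e : (2 * k + 1) * st = 2 * (k * st) + st := by ring
      rw [e] at h2 ⊢
      exact h.odd k (odd_lt k h2)
  · by_cases hbig : U < i * st + st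
    · rw [h.big _ hbig (by omega)]
      exact one_le i h1
    · rcases Nat.even_or_odd' i with ⟨k, rfl | rfl⟩
      · have e : 2 * k * st = 2 * (k * st) := by ring
        rw [e] at hbig ⊢
        exact h.mono₁ k (odd_lt k (by omega))
      · have e : (2 * k + 1) * st = 2 * (k * st) + st := by ring
        rw [e] at h1 ⊢
        have := h.mono₂ k (odd_lt k h1)
        rwa [show 2 * (k * st) + st + st = 2 * (k * st) + 2 * st by ring]

theorem PartialLevel.low_le (hst : 1 ≤ st) (hstU : st ≤ U) (h : PartialLevel U val st j f)
    (hj : 2 * (j * st) + st ≤ U) : 1 ≤ f (2 * (j * st) + 2 * st) ∧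
      f (2 * (j * st) + 2 * st) ≤ f (2 * (j * st)) ∧ f (2 * (j * st)) ≤ U := by
  refine ⟨?_, h.mono j (by omega), ?_⟩
  · by_cases hbig : U < 2 * (j * st) + 2 * st
    · rw [h.big _ hbig (by omega)]
    · have := h.even (j + 1)
      rw [add_mul, one_mul, mul_add] at this
      exact (this (by omega) (by omega)).one_le
  · rcases Nat.eq_zero_or_pos (2 * (j * st)) with h0 | h0
    · rw [h0, h.zero]
    · exact (h.even j h0 (by omega)).le

/-- By the Monge inequality, a column to the left of the maximizer for the right neighbor cannot
beat that maximizer, and a column to the right of the maximizer for the left neighbor cannot beat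
that one. Hence a maximum over the columns between the two is a maximum over all columns. -/
theorem PartialLevel.step (hval : Monge val) (hst : 1 ≤ st)
    (h : PartialLevel U val st j f) (hj : 2 * (j * st) + st ≤ U) {a : ℕ}
    (ha : f (2 * (j * st) + 2 * st) ≤ a) (ha' : a ≤ f (2 * (j * st)))
    (hmax : ∀ x, f (2 * (j * st) + 2 * st) ≤ x → x ≤ f (2 * (j * st)) →
      val (2 * (j * st) + st) x ≤ val (2 * (j * st) + st) a) {f' : ℕ → ℕ}
    (hf' : ∀ X, f' X = if X = 2 * (j * st) + st then a else f X) :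
    PartialLevel U val st (j + 1) f' := by
  obtain ⟨hl1, hl2, hl3⟩ := h.low_le hst (by omega) hj
  have hopt : Opt U val (2 * (j * st) + st) a := by
    refine ⟨by omega, by omega, fun x hx hx' => ?_⟩
    rcases lt_or_ge x (f (2 * (j * st) + 2 * st)) with h1 | h1
    · by_cases hbig : U < 2 * (j * st) + 2 * st
      · rw [h.big _ hbig (by omega)] at h1; omega
      · have hE := h.even (j + 1)
        rw [add_mul, one_mul, mul_add] at hE
        have i1 := (hE (by omega) (by omega)).max x hx hx'
        have i2 := hval (2 * (j * st) + st) (2 * (j * st) + 2 * st) x _ (by omega) h1.le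
        have i3 := hmax _ le_rfl hl2
        omega
    · rcases le_or_gt x (f (2 * (j * st))) with h2 | h2
      · exact hmax x h1 h2
      · rcases Nat.eq_zero_or_pos (2 * (j * st)) with h0 | h0
        · rw [h0, h.zero] at h2; omega
        · have i1 := (h.even j h0 (by omega)).max x hx hx'
          have i2 := hval (2 * (j * st)) (2 * (j * st) + st) _ x (by omega) h2.le
          have i3 := hmax _ hl2 le_rfl
          omega
  have ne_even : ∀ i, f' (2 * (i * st)) = f (2 * (i * st)) := by
    intro i
    rw [hf', if_neg]
    intro he
    have : (2 * i) * st = (2 * j + 1) * st := by rw [add_mul, mul_assoc, mul_assoc]; omega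
    have := Nat.eq_of_mul_eq_mul_right (by omega) this
    omega
  have ne_even' : ∀ i, f' (2 * (i * st) + 2 * st) = f (2 * (i * st) + 2 * st) := by
    intro i
    have := ne_even (i + 1)
    rwa [add_mul, one_mul, mul_add] at this
  have ne_odd : ∀ i < j, f' (2 * (i * st) + st) = f (2 * (i * st) + st) := by
    intro i hi
    rw [hf', if_neg]
    intro he
    have := Nat.eq_of_mul_eq_mul_right (by omega) (show i * st = j * st by omega)
    omega
  have at_j : f' (2 * (j * st) + st) = a := by rw [hf', if_pos rfl]
  refine ⟨?_, fun X h1 h2 => ?_, fun i h1 h2 => ?_, fun i hi => ?_, fun i h1 => ?_, fun i hi => ?_,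
    fun i hi => ?_⟩
  · have := ne_even 0
    simp only [zero_mul, mul_zero] at this
    rw [this, h.zero]
  · rw [hf', if_neg (by omega), h.big X h1 h2]
  · rw [ne_even]; exact h.even i h1 h2
  · rcases Nat.lt_succ_iff_lt_or_eq.1 hi with h1 | rfl
    · rw [ne_odd i h1]; exact h.odd i h1
    · rw [at_j]; exact hopt
  · rw [ne_even, ne_even']; exact h.mono i h1
  · rcases Nat.lt_succ_iff_lt_or_eq.1 hi with h1 | rfl
    · rw [ne_odd i h1, ne_even]; exact h.mono₁ i h1
    · rw [at_j, ne_even]; exact ha'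
  · rcases Nat.lt_succ_iff_lt_or_eq.1 hi with h1 | rfl
    · rw [ne_odd i h1, ne_even']; exact h.mono₂ i h1
    · rw [at_j, ne_even']; exact ha

end GridDisk

/-! ### Program for the column maxima and its amortized cost. -/

namespace Structured

open GridDisk HExpr

/-- The entry of a one-dimensional array. -/
def get₁ (k : Arr) (i : HExpr) : HExpr := .get k i 0 0

def get₂ (k : Arr) (i j : HExpr) : HExpr := .get k i j 0

@[simp] theorem eval_get₁ (h : HState) (k : Arr) (i : HExpr) :
    (get₁ k i).eval h = h.a k (i.eval h) 0 0 := rfl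

@[simp] theorem eval_get₂ (h : HState) (k : Arr) (i j : HExpr) :
    (get₂ k i j).eval h = h.a k (i.eval h) (j.eval h) 0 := rfl

@[simp] theorem fits_get₁ {M : ℕ} (h : HState) (k : Arr) (i : HExpr) :
    (get₁ k i).Fits M h ↔ i.Fits M h ∧ 0 < M := by
  simp only [get₁, fits_get, fits_ofNat]; tauto

@[simp] theorem fits_get₂ {M : ℕ} (h : HState) (k : Arr) (i j : HExpr) :
    (get₂ k i j).Fits M h ↔ i.Fits M h ∧ j.Fits M h ∧ 0 < M := by
  simp only [get₂, fits_get, fits_ofNat]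

def put₁ (k : Arr) (i e : HExpr) : HProg := .put k i 0 0 e

def put₂ (k : Arr) (i j e : HExpr) : HProg := .put k i j 0 e

theorem WP.put₁ {M : ℕ} {h : HState} {Q : HState → ℕ → Prop} {k : Arr} {i e : HExpr}
    (hi : i.Fits M h) (he : e.Fits M h) (hM : 0 < M)
    (hQ : Q (h.put k (i.eval h) 0 0 (e.eval h)) 1) : WP M (put₁ k i e) h Q :=
  WP.put hi hM hM he hQ

theorem WP.put₂ {M : ℕ} {h : HState} {Q : HState → ℕ → Prop} {k : Arr} {i j e : HExpr}
    (hi : i.Fits M h) (hj : j.Fits M h) (he : e.Fits M h) (hM : 0 < M)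
    (hQ : Q (h.put k (i.eval h) (j.eval h) 0 (e.eval h)) 1) : WP M (Structured.put₂ k i j e) h Q :=
  WP.put hi hj hM he hQ

open Reg Arr

/-- Find the best column for the column `vX`, between the best columns for its neighbors at
distance `st`. -/
def scan (b : Bool) : HProg :=
  ax <== get₁ arg (var vX + var st) ;;
  av <== 0 ;;
  e <== get₁ arg (var vX - var st) + 1 ;;
  .forRange vx (get₁ arg (var vX + var st)) (var e)
    (t <== get₁ (F b) (var vx) + get₁ G (dist (var vX) (var vx)) ;;
      .ite (lt (var av) (var t)) (av <== var t ;; ax <== var vx) .skip) ;;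
  put₁ arg (var vX) (var ax)

/-- Only odd multiples of the step are visited; both neighbors at distance `st` are even multiples,
known from the coarser level. -/
def sweep (b : Bool) : HProg :=
  vX <== var st ;;
  .loop (lt (var vX) (var U + 1)) (scan b ;; vX <== var vX + 2 * var st)

/-- Compute the array `A b` of column bounds for the weights in the array `F b`. -/
def bounds (b : Bool) : HProg :=
  -- The sentinels `1` beyond `U` and `U` at index 0 delimit the scans at both ends of the grid.
  .forRange vX 0 (3 * var U + 1) (put₁ arg (var vX) 1) ;;
  put₁ arg 0 (var U) ;;
  st <== var K ;;
  .loop (lt 1 (var st)) (st <== var st / 2 ;; sweep b) ;;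
  .forRange vX 1 (var U + 1)
    (t <== get₁ arg (var vX) ;;
      put₁ (A b) (var vX) (min (var U + 1)
        ((get₁ (F b) (var t) + get₁ G (dist (var vX) (var t)) - (var N2 + var OFF) + (var N - 1))
          / var N)))

/-- The registers that hold constants. -/
structure Consts (U L : ℕ) (h : HState) : Prop where
  U_pos : 1 ≤ U
  vU : h.v .U = U
  vN : h.v N = 2 * U
  vN2 : h.v N2 = 2 * U * (2 * U)
  vOFF : h.v OFF = 2 * U * (2 * U) * (2 * U * (2 * U))
  vK : h.v K = 2 ^ L
  lt_pow : U < 2 ^ L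
  pow_le : 2 ^ L ≤ 2 * U

theorem Consts.frame {U L : ℕ} {h h' : HState} {rs : List Reg} {as : List Arr}
    (H : Consts U L h) (hf : Frame rs as h h')
    (hrs : Reg.U ∉ rs ∧ N ∉ rs ∧ N2 ∉ rs ∧ OFF ∉ rs ∧ K ∉ rs) : Consts U L h' := by
  obtain ⟨h1, h2, h3, h4, h5⟩ := hrs
  refine ⟨H.U_pos, ?_, ?_, ?_, ?_, ?_, H.lt_pow, H.pow_le⟩
  · rw [hf.v _ h1, H.vU]
  · rw [hf.v _ h2, H.vN]
  · rw [hf.v _ h3, H.vN2]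
  · rw [hf.v _ h4, H.vOFF]
  · rw [hf.v _ h5, H.vK]

/-- The array `G` holds the function `arc U R`. -/
structure HasArc (U R : ℕ) (h : HState) : Prop where
  R_le : R ≤ 2 * U * (2 * U)
  arr : ∀ d ≤ U, h.a G d 0 0 = arc U R d

theorem HasArc.frame {U R : ℕ} {h h' : HState} {rs : List Reg} {as : List Arr}
    (H : HasArc U R h) (hf : Frame rs as h h') (has : G ∉ as) : HasArc U R h' :=
  ⟨H.R_le, fun d hd => by rw [hf.a _ has, H.arr d hd]⟩

/-- A single inequality from which all size conditions follow: the largest intermediate values are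
sums of the weights, the right-hand constant of `IsBound` and the arcs, all of degree 4 in `U`. -/
theorem size_bound {U M : ℕ} (hM : 100 * (U + 2) ^ 4 ≤ M) :
    2 * U * U + 2 * U * (2 * U) * (2 * U * (2 * U)) +
      (2 * U * (2 * U) + 2 * U * (2 * U) * (2 * U * (2 * U))) +
      (2 * U * (2 * U) + 2 * U * (2 * U) * (U * U)) + 20 * U + 100 < M := by
  have : 100 * (U + 2) ^ 4 = (2 * U * U + 2 * U * (2 * U) * (2 * U * (2 * U)) +
      (2 * U * (2 * U) + 2 * U * (2 * U) * (2 * U * (2 * U))) +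
      (2 * U * (2 * U) + 2 * U * (2 * U) * (U * U)) + 20 * U + 100) +
      (64 * U ^ 4 + 800 * U ^ 3 + 2390 * U ^ 2 + 3180 * U + 1500) := by ring
  omega

theorem arc_le_of_le {U R d : ℕ} (hd : d ≤ U) :
    arc U R d ≤ 2 * U * (2 * U) + 2 * U * (2 * U) * (U * U) :=
  arc_le.trans (Nat.add_le_add_left (Nat.mul_le_mul_left _ (Nat.mul_le_mul hd hd)) _)

theorem scan_spec {M U R : ℕ} {b : Bool} {h : HState} (hM : 100 * (U + 2) ^ 4 ≤ M)
    (hG : HasArc U R h)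
    (hF : ∀ x, 1 ≤ x → x ≤ U →
      h.a (F b) x 0 0 ≤ 2 * U * U + 2 * U * (2 * U) * (2 * U * (2 * U)))
    {X s lo hi : ℕ} (hX : h.v vX = X) (hXU : X ≤ U) (hs : h.v st = s) (hsU : s ≤ U)
    (hlo : h.a arg (X + s) 0 0 = lo) (hhi : h.a arg (X - s) 0 0 = hi) (h1 : 1 ≤ lo)
    (h2 : lo ≤ hi) (h3 : hi ≤ U) :
    WP M (scan b) h fun h' n =>
      (∃ a, lo ≤ a ∧ a ≤ hi ∧
        (∀ x, lo ≤ x → x ≤ hi → h.a (F b) x 0 0 + arc U R (gap X x) ≤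
          h.a (F b) a 0 0 + arc U R (gap X a)) ∧
        ∀ i, h'.a arg i 0 0 = if i = X then a else h.a arg i 0 0) ∧
      n ≤ 6 * (hi - lo) + 12 := by
  have hsz := size_bound hM
  refine WP.seq (WP.assign (by simp [hX, hs]; omega) ?_)
  refine WP.seq (WP.assign (by simp; omega) ?_)
  refine WP.seq (WP.assign (by simp [hX, hs, hhi]; omega) ?_)
  simp only [eval_get₁, eval_add, eval_sub, eval_var, eval_ofNat, hX, hs, hlo, hhi, HState.set_v,
    HState.set_a, reduceCtorEq, if_false]
  -- `av` is only required not to exceed the value at `ax`, so 0 is a valid start before any column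
  -- has been scanned.
  refine WP.seq (WP.forRange (fun j h' n => n ≤ 6 * (j - lo) ∧ lo ≤ h'.v ax ∧ h'.v ax ≤ hi ∧
      h'.v av ≤ h.a (F b) (h'.v ax) 0 0 + arc U R (gap X (h'.v ax)) ∧
      ∀ x, lo ≤ x → x < j → h.a (F b) x 0 0 + arc U R (gap X x) ≤ h'.v av) (hi + 1)
    ?_ ?_ ?_ ?_ ?_ ?_ ?_ ?_)
  · simp [hX, hs]; omega
  · simp [hX, hs, hlo]; omega
  · simp only [eval_get₁, eval_add, eval_var, hX, hs, hlo, HState.set_v,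
      HState.set_a, reduceCtorEq, if_false, if_true]
    refine ⟨by omega, le_rfl, h2, Nat.zero_le _, fun x hx hx' => by omega⟩
  · intro j h' n hf _ _ _ _
    have := hf.v e (by cases b <;> decide)
    simp only [HState.set_v, if_true] at this
    exact ⟨fits_var _ _ _, this⟩
  · cases b <;> decide
  · omega
  · rintro j h' n hf hj hj' hx ⟨hn, i1, i2, i3, i4⟩
    simp only [eval_get₁, eval_add, eval_var, hX, hs, hlo, HState.set_v,
      HState.set_a, reduceCtorEq, if_false] at hj
    have hX' : h'.v vX = X := by
      have := hf.v vX (by cases b <;> decide)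
      simpa [hX] using this
    have hF' : ∀ x, h'.a (F b) x 0 0 = h.a (F b) x 0 0 := by
      intro x
      have := hf.a (F b) (by simp [HProg.arrs])
      rw [this]; rfl
    have hG' : h'.a G (gap X j) 0 0 = arc U R (gap X j) := by
      have := hf.a G (by simp [HProg.arrs])
      rw [this]
      exact hG.arr _ (gap_le hXU (by omega))
    have hgap : gap X j ≤ U := gap_le hXU (by omega)
    have harc := @arc_le_of_le U R _ hgap
    have hFj := hF j (by omega) (by omega)
    have hgap' : X - j + (j - X) = gap X j := rfl
    refine WP.seq (WP.assign ?_ (WP.ite ?_ ?_ ?_))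
    · simp only [fits_add, fits_get₁, fits_var, fits_dist, eval_var, eval_get₁, eval_dist, hX', hx,
        hgap', hF', hG', true_and]
      omega
    · simp
    · simp only [eval_lt, eval_var, eval_add, eval_get₁, eval_dist, hX', hx, hgap', hF', hG',
        HState.set_v, reduceCtorEq, if_false, if_true, ne_eq, ite_eq_right_iff, one_ne_zero,
        imp_false, not_lt, not_le]
      intro hlt
      refine WP.seq (WP.assign (by simp) (WP.assign (by simp) ?_))
      simp only [eval_var, HState.set_v, reduceCtorEq, if_false, if_true, hx]
      refine ⟨by omega, by omega, by omega, le_rfl, fun x hx1 hx2 => ?_⟩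
      rcases Nat.lt_succ_iff_lt_or_eq.1 hx2 with h4 | rfl
      · exact (i4 x hx1 h4).trans hlt.le
      · exact le_rfl
    · simp only [eval_lt, eval_var, eval_add, eval_get₁, eval_dist, hX', hx, hgap', hF', hG',
        HState.set_v, reduceCtorEq, if_false, if_true, ite_eq_right_iff, one_ne_zero,
        imp_false, not_lt]
      intro hle
      refine WP.skip ?_
      simp only [HState.set_v, reduceCtorEq, if_false]
      refine ⟨by omega, i1, i2, i3, fun x hx1 hx2 => ?_⟩
      rcases Nat.lt_succ_iff_lt_or_eq.1 hx2 with h4 | rfl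
      · exact i4 x hx1 h4
      · exact hle
  · rintro h' n hf hv ⟨hn, i1, i2, i3, i4⟩
    refine WP.put₁ (by simp) (by simp) (by omega) ⟨⟨h'.v ax, i1, i2, fun x hx1 hx2 =>
      (i4 x hx1 (by omega)).trans i3, fun i => ?_⟩, by omega⟩
    have hX' : h'.v vX = X := by
      have := hf.v vX (by cases b <;> decide)
      simpa [hX] using this
    have ha : h'.a arg = h.a arg := by
      have := hf.a arg (by simp [HProg.arrs])
      rw [this]; rfl
    simp [hX', ha]

/-- A scan costs six commands per column between the maximizers of the two neighbors, plus a
constant. By monotonicity these lengths telescope, so the current maximizer serves as a potential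
and a whole level costs `O(U)`. -/
theorem sweep_spec {M U L R : ℕ} {b : Bool} {h : HState} (hM : 100 * (U + 2) ^ 4 ≤ M)
    (hC : Consts U L h) (hG : HasArc U R h)
    (hF : ∀ x, 1 ≤ x → x ≤ U →
      h.a (F b) x 0 0 ≤ 2 * U * U + 2 * U * (2 * U) * (2 * U * (2 * U)))
    {s : ℕ} (hs : h.v st = s) (hs1 : 1 ≤ s) (hsU : s ≤ U)
    (hval : Monge fun X x => h.a (F b) x 0 0 + arc U R (gap X x))
    (hL : Level U (fun X x => h.a (F b) x 0 0 + arc U R (gap X x)) (2 * s)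
      fun i => h.a arg i 0 0) :
    WP M (sweep b) h fun h' n =>
      Level U (fun X x => h.a (F b) x 0 0 + arc U R (gap X x)) s (fun i => h'.a arg i 0 0) ∧
      n ≤ 20 * U + 2 := by
  have hsz := size_bound hM
  refine WP.seq (WP.assign (by simp) ?_)
  refine WP.loop (fun h' n => ∃ j, j ≤ U ∧ h'.v vX = 2 * (j * s) + s ∧
      PartialLevel U (fun X x => h.a (F b) x 0 0 + arc U R (gap X x)) s j
        (fun i => h'.a arg i 0 0) ∧ n + 6 * h'.a arg (2 * (j * s)) 0 0 ≤ 6 * U + 14 * j)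
    (fun h' => 4 * U - h'.v vX) ⟨0, Nat.zero_le _, ?_, hL.toPartial, ?_⟩ ?_
  · simp [hs]
  · have := hL.zero
    simp [this]
  · rintro h' n hf ⟨j, hj, hX, hP, hn⟩
    have hf0 : Frame (vX :: (scan b ;; vX <== var vX + 2 * var st).regs)
        (scan b ;; vX <== var vX + 2 * var st).arrs h h' :=
      hf.of_set
    have hC' : Consts U L h' := hC.frame hf0 (by cases b <;> decide)
    have hG' : HasArc U R h' := hG.frame hf0 (by cases b <;> decide)
    have hF' : h'.a (F b) = h.a (F b) := hf0.a _ (by cases b <;> decide)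
    have hs' : h'.v st = s := by rw [hf0.v _ (by cases b <;> decide), hs]
    refine ⟨?_, fun hc => ?_, fun hc => ?_⟩
    · simp [hC'.vU]; omega
    · simp only [eval_lt, eval_var, eval_add, eval_ofNat, hC'.vU, hX, ite_eq_right_iff, one_ne_zero,
        imp_false, not_lt] at hc
      exact ⟨hP.toLevel hs1 hsU (by omega), by omega⟩
    · simp only [eval_lt, eval_var, eval_add, eval_ofNat, hC'.vU, hX, ne_eq, ite_eq_right_iff,
        one_ne_zero, imp_false, not_lt, not_le] at hc
      have hjU : 2 * (j * s) + s ≤ U := by omega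
      obtain ⟨l1, l2, l3⟩ := hP.low_le hs1 hsU hjU
      refine WP.seq ((scan_spec hM hG' (by rw [hF']; exact hF) hX hjU hs' hsU rfl
        (by rw [Nat.add_sub_cancel]) (by rwa [add_assoc, ← two_mul]) (by rwa [add_assoc, ← two_mul])
        l3).mono ?_)
      rintro h1 n1 f1 ⟨⟨a, ha1, ha2, ha3, ha4⟩, hn1⟩
      rw [add_assoc, ← two_mul] at ha1 ha3 hn1
      have hX1 : h1.v vX = 2 * (j * s) + s := by rw [f1.v _ (by cases b <;> decide), hX]
      have hs1' : h1.v st = s := by rw [f1.v _ (by cases b <;> decide), hs']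
      have hjs : j ≤ j * s := Nat.le_mul_of_pos_right j hs1
      rw [hF'] at ha3
      refine WP.assign ?_ ⟨⟨j + 1, by omega, ?_, hP.step hval hs1 hjU ha1 ha2 ha3 ha4, ?_⟩, ?_⟩
      · simp [hX1, hs1']; omega
      · simp [hX1, hs1']; ring
      · have e : 2 * ((j + 1) * s) = 2 * (j * s) + 2 * s := by ring
        have e' : h1.a arg (2 * (j * s) + 2 * s) 0 0 = h'.a arg (2 * (j * s) + 2 * s) 0 0 := by
          rw [ha4, if_neg (by omega)]
        simp only [HState.set_a, e, e']
        omega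
      · simp [hX1, hs1', hX]; omega

/-- The program `bounds` computes column bounds in time `O(U log U)`. -/
theorem bounds_spec {M U L R : ℕ} {b : Bool} {h : HState} (hM : 100 * (U + 2) ^ 4 ≤ M)
    (hC : Consts U L h) (hG : HasArc U R h)
    (hF : ∀ x, 1 ≤ x → x ≤ U →
      h.a (F b) x 0 0 ≤ 2 * U * U + 2 * U * (2 * U) * (2 * U * (2 * U))) :
    WP M (bounds b) h fun h' n =>
      (∀ X, 1 ≤ X → X ≤ U → IsBound U R (fun x => h.a (F b) x 0 0) X (h'.a (A b) X 0 0)) ∧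
      n ≤ 50 * U * (L + 1) := by
  have hsz := size_bound hM
  have hU1 := hC.U_pos
  -- The weights depend on `x` only and cancel.
  have hval : Monge fun X x => h.a (F b) x 0 0 + arc U R (gap X x) := by
    intro X X' x x' hX hx
    have := arc_monge hU1 hG.R_le hx hX
    simp only; omega
  refine WP.seq (WP.forRange (fun j h' n => n ≤ 3 * j ∧ ∀ i < j, h'.a arg i 0 0 = 1) (3 * U + 1)
    (by simp; omega) (by simp) ⟨by simp, by simp⟩ ?_ (by cases b <;> decide) (by omega) ?_ ?_)
  · intro j h' n hf _ _ _ _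
    have : h'.v .U = U := by rw [hf.v _ (by cases b <;> decide), hC.vU]
    simp [this]; omega
  · rintro j h' n hf - - hx ⟨hn, ha⟩
    refine WP.put₁ (by simp) (by simp; omega) (by omega) ⟨by omega, fun i hi => ?_⟩
    simp only [HState.set_a, eval_var, eval_ofNat, HState.put_a, hx, true_and, and_true]
    split_ifs with hc
    · rfl
    · exact ha i (by omega)
  rintro h1 n1 f1 - ⟨hn1, ha1⟩
  have hC1 : Consts U L h1 := hC.frame f1 (by cases b <;> decide)
  have hG1 : HasArc U R h1 := hG.frame f1 (by cases b <;> decide)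
  have hF1 : h1.a (F b) = h.a (F b) := f1.a _ (by cases b <;> decide)
  refine WP.seq (WP.put₁ (by simp; omega) (by simp) (by omega) ?_)
  refine WP.seq (WP.assign (by simp) ?_)
  refine WP.seq ((WP.loop (Q := fun h' n =>
      Level U (fun X x => h.a (F b) x 0 0 + arc U R (gap X x)) 1 (fun i => h'.a arg i 0 0) ∧
      n ≤ L * (20 * U + 4) + 1) (fun h' n => ∃ k, k ≤ L ∧ h'.v st = 2 ^ k ∧
      Level U (fun X x => h.a (F b) x 0 0 + arc U R (gap X x)) (2 ^ k)
        (fun i => h'.a arg i 0 0) ∧ n + k * (20 * U + 4) ≤ L * (20 * U + 4))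
    (fun h' => h'.v st) ⟨L, le_rfl, by simp [hC1.vK], ?_, by simp⟩ ?_).mono ?_)
  · refine Level.init hU1 hC.lt_pow hC.pow_le (by simp [hC1.vU]) fun X hX hX' => ?_
    simp only [HState.set_a, HState.put_a, eval_ofNat]
    rw [if_neg (by omega), ha1 X (by omega)]
  · rintro h2 n2 f2 ⟨k, hk, hst, hlev, hn2⟩
    refine ⟨by simp; omega, fun hc => ?_, fun hc => ?_⟩
    · have : ¬ 1 < 2 ^ k := by
        intro h1; simp [hst, h1] at hc
      have hk0 : k = 0 := by
        by_contra h0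
        exact this (Nat.one_lt_two_pow h0)
      subst hk0
      exact ⟨by simpa using hlev, by omega⟩
    · have hk0 : k ≠ 0 := by
        rintro rfl
        simp [hst] at hc
      obtain ⟨l, rfl⟩ := Nat.exists_eq_succ_of_ne_zero hk0
      have f2' := f2.of_set.of_put
      have hC2 : Consts U L h2 := hC1.frame f2' (by cases b <;> decide)
      have hG2 : HasArc U R h2 := hG1.frame f2' (by cases b <;> decide)
      have hF2 : h2.a (F b) = h.a (F b) := by rw [f2'.a _ (by cases b <;> decide), ← hF1]
      have hpow : 2 ^ (l + 1) = 2 * 2 ^ l := by ring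
      have hpos : 1 ≤ 2 ^ l := Nat.one_le_two_pow
      have hlU : 2 ^ l ≤ U := by
        have h4 : 2 ^ (l + 1) ≤ 2 ^ L := Nat.pow_le_pow_right (by norm_num) hk
        have h5 := hC.pow_le
        omega
      refine WP.seq (WP.assign (by simp; omega) ?_)
      have hst' : 2 ^ l.succ / 2 = 2 ^ l := by rw [Nat.succ_eq_add_one, hpow]; omega
      simp only [eval_div, eval_var, eval_ofNat, hst, hst']
      refine (sweep_spec (L := L) (R := R) hM ?_ ?_ ?_ (s := 2 ^ l) (by simp) hpos hlU ?_ ?_).mono ?_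
      · exact ⟨hU1, by simp [hC2.vU], by simp [hC2.vN], by simp [hC2.vN2], by simp [hC2.vOFF],
          by simp [hC2.vK], hC.lt_pow, hC.pow_le⟩
      · exact ⟨hG.R_le, hG2.arr⟩
      · simp only [HState.set_a, hF2]; exact hF
      · simp only [HState.set_a, hF2]; exact hval
      · simp only [HState.set_a, hF2]
        rw [Nat.succ_eq_add_one, hpow] at hlev
        exact hlev
      · rintro h3 n3 f3 ⟨hlev3, hn3⟩
        simp only [HState.set_a, hF2] at hlev3
        have hst3 : h3.v st = 2 ^ l := by
          rw [f3.v _ (by cases b <;> decide)]; simp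
        have e : (l + 1) * (20 * U + 4) = l * (20 * U + 4) + (20 * U + 4) := by ring
        rw [Nat.succ_eq_add_one, e] at hn2
        refine ⟨⟨l, by omega, hst3, hlev3, by omega⟩, ?_⟩
        omega
  rintro h2 n2 f2 ⟨hlev, hn2⟩
  have f2' := f2.of_set.of_put
  have hC2 : Consts U L h2 := hC1.frame f2' (by cases b <;> decide)
  have hG2 : HasArc U R h2 := hG1.frame f2' (by cases b <;> decide)
  have hF2 : h2.a (F b) = h.a (F b) := by rw [f2'.a _ (by cases b <;> decide), ← hF1]
  refine WP.forRange (fun j h' n => n ≤ 4 * (j - 1) ∧ ∀ X, 1 ≤ X → X < j →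
      IsBound U R (fun x => h.a (F b) x 0 0) X (h'.a (A b) X 0 0)) (U + 1)
    (by simp; omega) (by simp) ⟨by simp, fun X hX hX' => by simp at hX'; omega⟩ ?_ (by cases b <;> decide)
    (by omega) ?_ ?_
  · intro j h' n hf _ _ _ _
    have : h'.v .U = U := by rw [hf.v _ (by cases b <;> decide), hC2.vU]
    simp [this]; omega
  · rintro j h3 n3 f3 hj hj' hx ⟨hn3, ha3⟩
    simp only [eval_ofNat] at hj
    have hC3 : Consts U L h3 := hC2.frame f3 (by cases b <;> decide)
    have hF3 : h3.a (F b) = h.a (F b) := by rw [f3.a _ (by cases b <;> decide), hF2]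
    have harg : h3.a arg = h2.a arg := by rw [f3.a _ (by cases b <;> decide)]
    have hopt := hlev.opt j (by omega) (by omega)
    rw [mul_one] at hopt
    have hgap : gap j (h2.a arg j 0 0) ≤ U := gap_le (by omega) hopt.le
    have hgap' : j - h2.a arg j 0 0 + (h2.a arg j 0 0 - j) = gap j (h2.a arg j 0 0) := rfl
    have hG3 : h3.a G (gap j (h2.a arg j 0 0)) 0 0 = arc U R (gap j (h2.a arg j 0 0)) := by
      rw [f3.a _ (by cases b <;> decide), hG2.arr _ hgap]
    have harc := @arc_le_of_le U R _ hgap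
    have hFj := hF _ hopt.one_le hopt.le
    refine WP.seq (WP.assign (by simp; omega) (WP.put₁ (by simp) ?_ (by omega) ?_))
    · simp only [fits_min, fits_div, fits_add, fits_sub, fits_get₁, fits_dist, fits_var, fits_ofNat,
        eval_add, eval_sub, eval_var, eval_ofNat, eval_get₁, eval_dist, HState.set_v, HState.set_a,
        hx, hgap', reduceCtorEq, if_false, if_true, hC3.vU, hC3.vN, hC3.vN2, hC3.vOFF, harg, hF3,
        hG3, true_and, and_true]
      omega
    · simp only [eval_min, eval_div,
        eval_add, eval_sub, eval_var, eval_ofNat, eval_get₁, eval_dist, HState.set_v, HState.set_a,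
        HState.put_a, hx, hgap', reduceCtorEq, if_false, if_true, hC3.vU, hC3.vN, hC3.vN2, hC3.vOFF,
        harg, hF3, hG3, true_and, and_true]
      refine ⟨by omega, fun X hX hX' => ?_⟩
      split_ifs with hXj
      · subst hXj
        refine ⟨min_le_left _ _, fun Y hY => ?_⟩
        rw [← clip, clip_le_iff (by omega) hY]
        -- The inequality at the maximizing column implies it at all columns.
        exact ⟨fun hle x hx1 hx2 => (hopt.max x hx1 hx2).trans hle,
          fun H => H _ hopt.one_le hopt.le⟩
      · exact ha3 X hX (by omega)
  · rintro h3 n3 f3 - ⟨hn3, ha3⟩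
    refine ⟨fun X hX hX' => ha3 X hX (by omega), ?_⟩
    have e : 50 * U * (L + 1) = L * (20 * U) + L * (30 * U) + 50 * U := by ring
    have e' : L * (20 * U + 4) = L * (20 * U) + L * 4 := by ring
    have e2 : L * 4 ≤ L * (30 * U) := Nat.mul_le_mul_left _ (by omega)
    omega

end Structured

/-! ### Precomputed tables, and the centers blocked by a single point. -/

namespace Structured

open GridDisk HExpr IB2C

open Reg Arr

/-- What the precomputed tables contain. -/
structure Tables (U : ℕ) (T : List PointPair) (h : HState) : Prop where
  inGrid : ∀ p ∈ T, p.InGrid U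
  top : ∀ b px py, 1 ≤ px → px ≤ U → 1 ≤ py → py ≤ U →
    IsTop U (flip U b (Adj T (px, py))) (h.a (Q b) px py)
  prev : ∀ b x, 1 ≤ x → x ≤ U → ∀ y ≤ U, IsPrev (flip U b (Pts T) x) y (h.a (P b) x y 0)

theorem Tables.frame {U : ℕ} {T : List PointPair} {h h' : HState} {rs : List Reg} {as : List Arr}
    (H : Tables U T h) (hf : Frame rs as h h')
    (has : Q false ∉ as ∧ Q true ∉ as ∧ P false ∉ as ∧ P true ∉ as) : Tables U T h' := by
  have hQ : ∀ b, h'.a (Q b) = h.a (Q b) := fun b => by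
    cases b
    · exact hf.a _ has.1
    · exact hf.a _ has.2.1
  have hP : ∀ b, h'.a (P b) = h.a (P b) := fun b => by
    cases b
    · exact hf.a _ has.2.2.1
    · exact hf.a _ has.2.2.2
  exact ⟨H.inGrid, fun b => by rw [hQ]; exact H.top b, fun b => by rw [hP]; exact H.prev b⟩

theorem flip_inBox {U : ℕ} {S : ℕ → ℕ → Prop} (hS : InBox U S) (b : Bool) :
    InBox U (flip U b S) := by
  cases b
  · exact hS
  · rintro x y ⟨h1, h2, h3⟩
    exact ⟨(hS _ _ h3).1, h1, h2⟩

theorem Tables.top_le {U : ℕ} {T : List PointPair} {h : HState} (H : Tables U T h) (b : Bool)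
    {px py x : ℕ} (hx1 : 1 ≤ px) (hx2 : px ≤ U) (hy1 : 1 ≤ py) (hy2 : py ≤ U) (h1 : 1 ≤ x)
    (h2 : x ≤ U) : h.a (Q b) px py x ≤ U :=
  (H.top b px py hx1 hx2 hy1 hy2).le (flip_inBox (adj_inBox H.inGrid _) b) h1 h2

/-! ### The table of the function `arc` -/

/-- Fill the array `G` for the squared radius in the register `R`. -/
def arcTable : HProg :=
  .forRange d 0 (var U + 1)
    (s <== 0 ;;
      t <== var N2 * (var R - var d * var d) ;;
      -- Integer square root by linear search: at most `(2U)²` rounds for each of `U + 1` distances,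
      -- which is still `O(U³)` per radius.
      .loop (lt ((var s + 1) * (var s + 1)) (var t + 1)) (s <== var s + 1) ;;
      put₁ G (var d) (var N2 - var s + var N2 * (var d * var d - var R)))

theorem arcTable_spec {M U L R : ℕ} {h : HState} (hM : 100 * (U + 2) ^ 4 ≤ M)
    (hC : Consts U L h) (hR : h.v Reg.R = R) (hRU : R ≤ 2 * U * (2 * U)) :
    WP M arcTable h fun h' n => HasArc U R h' ∧ n ≤ 30 * U ^ 3 := by
  have hsz := size_bound hM
  have hU1 := hC.U_pos
  refine WP.forRange (fun j h' n => n ≤ j * (8 * U * U + 6) ∧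
      ∀ d < j, h'.a G d 0 0 = arc U R d) (U + 1)
    (by simp; omega) (by simp) ⟨by simp, by simp⟩ ?_ (by decide) (by omega) ?_ ?_
  · intro j h' n hf _ _ _ _
    have : h'.v .U = U := by rw [hf.v _ (by decide), hC.vU]
    simp [this]; omega
  · rintro j h1 n1 f1 - hj hx ⟨hn1, ha1⟩
    have hC1 : Consts U L h1 := hC.frame f1 (by decide)
    have hR1 : h1.v Reg.R = R := by rw [f1.v _ (by decide), hR]
    have hjj : j * j ≤ U * U := Nat.mul_self_le_mul_self (by omega)
    have hUU : U * U ≤ 2 * U * (2 * U) := Nat.mul_le_mul (by omega) (by omega)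
    have hmul : 2 * U * (2 * U) * (R - j * j) ≤ 2 * U * (2 * U) * (2 * U * (2 * U)) :=
      Nat.mul_le_mul_left _ (by omega)
    have hmul' : 2 * U * (2 * U) * (j * j - R) ≤ 2 * U * (2 * U) * (U * U) :=
      Nat.mul_le_mul_left _ (by omega)
    have hsq := sqrt_le_scale (d := j * j) hRU
    have hsz' : (2 * U * (2 * U) + 1) * (2 * U * (2 * U) + 1) < M := by
      have : (2 * U * (2 * U) + 1) * (2 * U * (2 * U) + 1) =
        2 * U * (2 * U) * (2 * U * (2 * U)) + 2 * (2 * U * (2 * U)) + 1 := by ring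
      omega
    refine WP.seq (WP.assign (by simp; omega) (WP.seq (WP.assign ?_ ?_)))
    · simp only [fits_mul, fits_sub, fits_var, eval_mul, eval_sub, eval_var, HState.set_v, hx, hR1,
        hC1.vN2, reduceCtorEq, if_false, true_and]
      omega
    simp only [eval_mul, eval_sub, eval_var, HState.set_v, hx, hR1, hC1.vN2, reduceCtorEq, if_false,
      eval_ofNat]
    refine WP.seq ((WP.loop (Q := fun h' n =>
        h'.v s = Nat.sqrt (2 * U * (2 * U) * (R - j * j)) ∧ n ≤ 8 * U * U + 1)
      (fun h' n => n = 2 * h'.v s ∧ h'.v s ≤ Nat.sqrt (2 * U * (2 * U) * (R - j * j)))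
      (fun h' => 2 * U * (2 * U) - h'.v s) ⟨by simp, by simp⟩ ?_).mono ?_)
    · rintro h2 n2 f2 ⟨hn2, hs2⟩
      have ht2 : h2.v t = 2 * U * (2 * U) * (R - j * j) := by rw [f2.v _ (by decide)]; simp
      have hss : (h2.v s + 1) * (h2.v s + 1) ≤ (2 * U * (2 * U) + 1) * (2 * U * (2 * U) + 1) :=
        Nat.mul_self_le_mul_self (by omega)
      refine ⟨?_, fun hc => ?_, fun hc => ?_⟩
      · simp only [fits_lt, fits_mul, fits_add, fits_var, fits_ofNat, eval_add, eval_var,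
          eval_ofNat, ht2, true_and]
        omega
      · simp only [eval_lt, eval_mul, eval_add, eval_var, eval_ofNat, ht2, ite_eq_right_iff,
          one_ne_zero, imp_false, not_lt] at hc
        refine ⟨le_antisymm hs2 (Nat.le_of_lt_succ (Nat.sqrt_lt.2 (by
          simp only [Nat.succ_eq_add_one]; omega))), ?_⟩
        have e : 8 * U * U = 2 * (2 * U * (2 * U)) := by ring
        omega
      · simp only [eval_lt, eval_mul, eval_add, eval_var, eval_ofNat, ht2, ne_eq, ite_eq_right_iff,
          one_ne_zero, imp_false, not_lt, not_le] at hc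
        have := Nat.le_sqrt.2 (Nat.le_of_lt_succ hc)
        refine WP.assign (by simp; omega) ⟨⟨?_, ?_⟩, ?_⟩
        · simp [hn2]; ring
        · simpa using this
        · simp; omega
    rintro h2 n2 f2 ⟨hs2, hn2⟩
    have f2' := f2.of_set.of_set
    have hC2 : Consts U L h2 := hC1.frame f2' (by decide)
    have hd2 : h2.v d = j := by rw [f2'.v _ (by decide), hx]
    have hR2 : h2.v Reg.R = R := by rw [f2'.v _ (by decide), hR1]
    refine WP.put₁ (by simp) ?_ (by omega) ⟨?_, fun d hd => ?_⟩
    · simp only [fits_add, fits_sub, fits_mul, fits_var, eval_mul, eval_sub, eval_var, hd2, hR2, hs2,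
        hC2.vN2, true_and, and_true]
      omega
    · rw [Nat.succ_mul]; omega
    · simp only [HState.set_a, HState.put_a, eval_add, eval_sub, eval_mul, eval_var, hd2, hR2, hs2,
        hC2.vN2, true_and, and_true]
      split_ifs with hdj
      · rw [hdj, arc]
      · rw [f2'.a _ (by decide)]
        exact ha1 d (by omega)
  · rintro h1 n1 f1 - ⟨hn1, ha1⟩
    refine ⟨⟨hRU, fun d hd => ha1 d (by omega)⟩, ?_⟩
    have e1 : (U + 1) * (8 * U * U + 6) = 8 * U ^ 3 + 8 * U ^ 2 + 6 * U + 6 := by ring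
    have e2 : U ^ 2 ≤ U ^ 3 := Nat.pow_le_pow_right hU1 (by norm_num)
    have e3 : U ≤ U ^ 3 := Nat.le_self_pow (by norm_num) U
    omega

/-! ### Bounds for a set of points -/

/-- The weight of a column with top `t`. -/
def encExpr : HExpr := lt 0 (var t) * (var N * var t + var OFF)

theorem encExpr_eval {U L : ℕ} {h : HState} (hC : Consts U L h) :
    encExpr.eval h = enc U (h.v t) := by
  simp only [encExpr, eval_mul, eval_lt, eval_add, eval_var, eval_ofNat, hC.vN, hC.vOFF, enc]
  rcases Nat.eq_zero_or_pos (h.v t) with h0 | h0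
  · simp [h0]
  · simp [h0, h0.ne']

theorem encExpr_fits {M U L : ℕ} {h : HState} (hM : 100 * (U + 2) ^ 4 ≤ M) (hC : Consts U L h)
    (ht : h.v t ≤ U) : encExpr.Fits M h := by
  have hsz := size_bound hM
  have h1 : 2 * U * h.v t ≤ 2 * U * U := Nat.mul_le_mul_left _ ht
  have h2 := enc_le ht
  have h3 : encExpr.eval h < M := by rw [encExpr_eval hC]; omega
  refine (fits_mul _ _ _ _).2 ⟨by simp; omega, ?_, h3⟩
  simp only [fits_mul, fits_add, fits_var, eval_mul, eval_var, hC.vN, hC.vOFF, true_and]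
  omega

def bothBounds : HProg := bounds false ;; bounds true

theorem bothBounds_spec {M U L R : ℕ} {h : HState} (hM : 100 * (U + 2) ^ 4 ≤ M)
    (hC : Consts U L h) (hG : HasArc U R h) {S : ℕ → ℕ → Prop} (hS : InBox U S)
    {f : Bool → ℕ → ℕ} (hf : ∀ b, IsTop U (flip U b S) (f b))
    (hF : ∀ b x, 1 ≤ x → x ≤ U → h.a (F b) x 0 0 = enc U (f b x)) :
    WP M bothBounds h fun h' n =>
      (∀ b X, 1 ≤ X → X ≤ U → h'.a (A b) X 0 0 ≤ U + 1) ∧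
      (∀ X, 1 ≤ X → X ≤ U → ∀ Y, 1 ≤ Y → Y ≤ U → ((∀ x y, S x y → Near R (x, y) (X, Y)) ↔
        h'.a (A false) X 0 0 ≤ Y ∧ h'.a (A true) X 0 0 ≤ U + 1 - Y)) ∧
      n ≤ 100 * U * (L + 1) := by
  have hle : ∀ b x, 1 ≤ x → x ≤ U →
      h.a (F b) x 0 0 ≤ 2 * U * U + 2 * U * (2 * U) * (2 * U * (2 * U)) := by
    intro b x h1 h2
    rw [hF b x h1 h2]
    exact enc_le ((hf b).le (flip_inBox hS b) h1 h2)
  refine WP.seq ((bounds_spec hM hC hG (hle false)).mono ?_)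
  rintro h1 n1 f1 ⟨hb1, hn1⟩
  have hF1 : h1.a (F true) = h.a (F true) := f1.a _ (by decide)
  refine (bounds_spec hM (hC.frame f1 (by decide)) (hG.frame f1 (by decide))
    (by rw [hF1]; exact hle true)).mono ?_
  rintro h2 n2 f2 ⟨hb2, hn2⟩
  rw [hF1] at hb2
  have hA2 : h2.a (A false) = h1.a (A false) := f2.a _ (by decide)
  rw [← hA2] at hb1
  have hB : ∀ b X, 1 ≤ X → X ≤ U → IsBound U R (fun x => enc U (f b x)) X (h2.a (A b) X 0 0) := by
    intro b X hX hX'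
    have : IsBound U R (fun x => h.a (F b) x 0 0) X (h2.a (A b) X 0 0) := by
      cases b
      · exact hb1 X hX hX'
      · exact hb2 X hX hX'
    refine ⟨this.1, fun Y hY => (this.2 Y hY).trans ?_⟩
    refine forall_congr' fun x => forall_congr' fun h1 => forall_congr' fun h2 => ?_
    simp only [hF b x h1 h2]
  refine ⟨fun b X hX hX' => (hB b X hX hX').1, fun X hX hX' Y hY hY' => ?_, ?_⟩
  · exact forall_near_iff hC.U_pos hG.R_le hS hf hX' (a := fun b => h2.a (A b) X 0 0)
      (fun b => hB b X hX hX') hY hY'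
  · have : 100 * U * (L + 1) = 50 * U * (L + 1) + 50 * U * (L + 1) := by ring
    omega

/-- The lower boundary, in the column `col`, of the disk around a point of height `y` in the column
`px`. -/
def lowExpr (col : Reg) (y : HExpr) : HExpr :=
  min (var U + 1)
    ((var N * y + get₁ G (dist (var col) (var px)) - var N2 + (var N - 1)) / var N)

theorem lowExpr_spec {M U L R : ℕ} {h : HState} (hM : 100 * (U + 2) ^ 4 ≤ M)
    (hC : Consts U L h) (hG : HasArc U R h) {col : Reg} {y : HExpr} (hcol : h.v col ≤ U)
    (hpx : h.v px ≤ U) (hy : y.Fits M h) (hyU : y.eval h ≤ U) :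
    (lowExpr col y).Fits M h ∧
      (lowExpr col y).eval h = low U R (y.eval h) (gap (h.v col) (h.v px)) := by
  have hsz := size_bound hM
  have hgap : gap (h.v col) (h.v px) ≤ U := gap_le hcol hpx
  have hgap' : h.v col - h.v px + (h.v px - h.v col) = gap (h.v col) (h.v px) := rfl
  have harc := @arc_le_of_le U R _ hgap
  have hmul : 2 * U * y.eval h ≤ 2 * U * U := Nat.mul_le_mul_left _ hyU
  constructor
  · simp only [lowExpr, fits_min, fits_div, fits_add, fits_sub, fits_mul, fits_get₁, fits_dist,
      fits_var, fits_ofNat, eval_add, eval_sub, eval_mul, eval_var, eval_ofNat, eval_get₁,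
      eval_dist, hgap', hC.vU, hC.vN, hC.vN2, hG.arr _ hgap, hy, true_and, and_true]
    omega
  · simp only [lowExpr, eval_min, eval_div, eval_add, eval_sub, eval_mul, eval_var, eval_ofNat,
      eval_get₁, eval_dist, hgap', hC.vU, hC.vN, hC.vN2, hG.arr _ hgap, low, clip]

/-! ### Centers whose disks meet all pairs -/

/-- Copy the tops of the points that form a pair with `(px, py)`. -/
def fill (b : Bool) : HProg :=
  .forRange vx 1 (var U + 1) (t <== .get (Q b) (var px) (var py) (var vx) ;;
    put₁ (F b) (var vx) encExpr)

theorem fill_spec {M U L : ℕ} {T : List PointPair} {b : Bool} {h : HState}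
    (hM : 100 * (U + 2) ^ 4 ≤ M) (hC : Consts U L h) (hT : Tables U T h) {p q : ℕ}
    (hp : h.v px = p) (hq : h.v py = q) (hp1 : 1 ≤ p) (hpU : p ≤ U) (hq1 : 1 ≤ q) (hqU : q ≤ U) :
    WP M (fill b) h fun h' n => (∀ x, 1 ≤ x → x ≤ U → h'.a (F b) x 0 0 = enc U (h.a (Q b) p q x)) ∧
      n ≤ 4 * U + 2 := by
  have hsz := size_bound hM
  have hU1 := hC.U_pos
  refine WP.forRange (fun j h' n => n ≤ 4 * (j - 1) ∧
      ∀ x, 1 ≤ x → x < j → h'.a (F b) x 0 0 = enc U (h.a (Q b) p q x)) (U + 1)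
    (by simp; omega) (by simp) ⟨by simp, fun x hx hx' => by simp at hx'; omega⟩ ?_
    (by cases b <;> decide) (by omega) ?_ ?_
  · intro j h' n hf _ _ _ _
    have : h'.v .U = U := by rw [hf.v _ (by cases b <;> decide), hC.vU]
    simp [this]; omega
  · rintro j h1 n1 f1 hj hj' hx ⟨hn1, ha1⟩
    simp only [eval_ofNat] at hj
    have hC1 : Consts U L h1 := hC.frame f1 (by cases b <;> decide)
    have hp' : h1.v px = p := by rw [f1.v _ (by cases b <;> decide), hp]
    have hq' : h1.v py = q := by rw [f1.v _ (by cases b <;> decide), hq]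
    have hQ : h1.a (Q b) = h.a (Q b) := f1.a _ (by cases b <;> decide)
    have hle := hT.top_le b hp1 hpU hq1 hqU hj (by omega : j ≤ U)
    refine WP.seq (WP.assign (by simp) ?_)
    simp only [eval_get, eval_var, hp', hq', hx, hQ]
    have hC2 : Consts U L (h1.set t (h.a (Q b) p q j)) := hC1.frame (Frame.refl [] [] _).of_set
      (by decide)
    refine WP.put₁ (by simp) (encExpr_fits hM hC2 (by simpa using hle)) (by omega)
      ⟨by omega, fun x hx1 hx2 => ?_⟩
    rw [encExpr_eval hC2]
    simp only [eval_var, HState.set_a, HState.put_a, HState.set_v, reduceCtorEq, if_false, if_true,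
      hx, true_and, and_true]
    split_ifs with hxj
    · rw [hxj]
    · exact ha1 x hx1 (by omega)
  · rintro h1 n1 f1 - ⟨hn1, ha1⟩
    exact ⟨fun x hx hx' => ha1 x hx (by omega), by omega⟩

/-- Block the heights `Y < u` with `U + 1 - Y < v` in the column `vX`. -/
def block (u v : HExpr) : HProg :=
  t <== v ;;
  .put reach (var vX) (var U + 2 - var t) 0
    (max (get₂ reach (var vX) (var U + 2 - var t)) u)

/-- All entries of `reach` in the grid are at most `U + 1`. -/
def ReachBound (U : ℕ) (h : HState) : Prop :=
  ∀ X l, 1 ≤ X → X ≤ U → l ≤ U + 2 → h.a reach X l 0 ≤ U + 1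

/-- `t` receives the value of `v` before `u` is evaluated, hence the hypotheses on `u` refer to the
updated state. -/
theorem block_spec {M U L : ℕ} {h : HState} (hM : 100 * (U + 2) ^ 4 ≤ M) (hC : Consts U L h)
    (hr : ReachBound U h) {X : ℕ} (hX : h.v vX = X) (hX1 : 1 ≤ X) (hXU : X ≤ U) {u v : HExpr}
    (hv : v.Fits M h) (hvU : v.eval h ≤ U + 1) {n : ℕ} (hu : u.Fits M (h.set t (v.eval h)))
    (hun : u.eval (h.set t (v.eval h)) = n) (hnU : n ≤ U + 1) :
    WP M (block u v) h fun h' k => ReachBound U h' ∧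
      (∀ X', X' ≠ X → ∀ l, h'.a reach X' l 0 = h.a reach X' l 0) ∧
      (∀ Y ≤ U, Blocked (fun l => h'.a reach X l 0) Y ↔
        Blocked (fun l => h.a reach X l 0) Y ∨ Y < n ∧ U + 1 - Y < v.eval h) ∧ k = 2 := by
  have hsz := size_bound hM
  have hrX := hr X (U + 2 - v.eval h) hX1 hXU (by omega)
  refine WP.seq (WP.assign hv (WP.put (by simp) ?_ (by simp; omega) ?_
    ⟨?_, fun X' hX' l => ?_, fun Y hY => ?_, rfl⟩))
  · simp [hC.vU]; omega
  · simp [hC.vU, hX, hu, hun]; omega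
  · intro X' l h1 h2 h3
    have := hr X' l h1 h2 h3
    simp only [HState.put_a, HState.set_a, HState.set_v, eval_max, eval_get₂, eval_var, eval_sub,
      eval_add, eval_ofNat, hC.vU, hX, hun, reduceCtorEq, if_false, if_true, true_and, and_true]
    split_ifs <;> omega
  · simp only [HState.put_a, HState.set_a, HState.set_v, eval_var, hX, reduceCtorEq, if_false,
      true_and, hX', false_and]
  · refine blocked_update hY hvU fun l => ?_
    simp only [HState.put_a, HState.set_a, HState.set_v, eval_max, eval_get₂, eval_var, eval_sub,
      eval_add, eval_ofNat, hC.vU, hX, hun, reduceCtorEq, if_false, if_true, true_and, and_true]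

/-- Block the centers whose disks miss a pair with the point `(px, py)`. -/
def forbid : HProg :=
  fill false ;; fill true ;; bothBounds ;;
  .forRange vX 1 (var U + 1)
    (la <== lowExpr vX (var py) ;;
      lb <== lowExpr vX (var U + 1 - var py) ;;
      -- A bad center violates one end of each of two intervals, which gives four combinations. When
      -- both violated ends are lower ones the upper condition is made vacuous by `U + 1`, and
      -- conversely.
      block (min (var la) (get₁ (A false) (var vX))) (var U + 1) ;;
      block (var la) (get₁ (A true) (var vX)) ;;
      block (get₁ (A false) (var vX)) (var lb) ;;
      block (var U + 1) (min (var lb) (get₁ (A true) (var vX))))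

/-- The disk around `(X, Y)` contains neither `p` nor all points that form a pair with `p`. -/
def Bad (R : ℕ) (T : List PointPair) (p : ℕ × ℕ) (X Y : ℕ) : Prop :=
  ¬ (Near R p (X, Y) ∨ ∀ x y, Adj T p x y → Near R (x, y) (X, Y))

theorem forbid_spec {M U L R : ℕ} {T : List PointPair} {h : HState}
    (hM : 100 * (U + 2) ^ 4 ≤ M) (hC : Consts U L h) (hG : HasArc U R h) (hT : Tables U T h)
    (hr : ReachBound U h) {p q : ℕ}
    (hp : h.v px = p) (hq : h.v py = q) (hp1 : 1 ≤ p) (hpU : p ≤ U) (hq1 : 1 ≤ q) (hqU : q ≤ U) :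
    WP M forbid h fun h' n => ReachBound U h' ∧
      (∀ X, 1 ≤ X → X ≤ U → ∀ Y, 1 ≤ Y → Y ≤ U → (Blocked (fun l => h'.a reach X l 0) Y ↔
        Blocked (fun l => h.a reach X l 0) Y ∨ Bad R T (p, q) X Y)) ∧
      n ≤ 130 * U * (L + 1) := by
  have hsz := size_bound hM
  have hU1 := hC.U_pos
  refine WP.seq ((fill_spec hM hC hT hp hq hp1 hpU hq1 hqU).mono ?_)
  rintro h1 n1 f1 ⟨hF1, hn1⟩
  refine WP.seq ((fill_spec hM (hC.frame f1 (by decide)) (hT.frame f1 (by decide))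
    (by rw [f1.v _ (by decide), hp]) (by rw [f1.v _ (by decide), hq]) hp1 hpU hq1 hqU).mono ?_)
  rintro h2 n2 f2 ⟨hF2, hn2⟩
  have f12 : Frame ((fill false).regs ++ (fill true).regs) ((fill false).arrs ++ (fill true).arrs)
    h h2 := (f1.mono (by simp) (by simp)).trans (f2.mono (by simp) (by simp))
  have hC2 : Consts U L h2 := hC.frame f12 (by decide)
  have hG2 : HasArc U R h2 := hG.frame f12 (by decide)
  refine WP.seq ((bothBounds_spec hM hC2 hG2 (S := Adj T (p, q))
    (f := fun b => h.a (Q b) p q) (adj_inBox hT.inGrid _) (fun b => hT.top b p q hp1 hpU hq1 hqU)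
    ?_).mono ?_)
  · intro b x hx hx'
    cases b
    · rw [f2.a _ (by decide)]; exact hF1 x hx hx'
    · rw [hF2 x hx hx', f1.a _ (by decide)]
  rintro h3 n3 f3 ⟨hA, hiff, hn3⟩
  have f13 : Frame (((fill false).regs ++ (fill true).regs) ++ bothBounds.regs)
    (((fill false).arrs ++ (fill true).arrs) ++ bothBounds.arrs)
    h h3 := (f12.mono (by simp) (by simp)).trans (f3.mono (by simp) (by simp))
  have hr3 : h3.a reach = h.a reach := f13.a _ (by decide)
  have hC3 : Consts U L h3 := hC.frame f13 (by decide)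
  have hG3 : HasArc U R h3 := hG.frame f13 (by decide)
  have hp3 : h3.v px = p := by rw [f13.v _ (by decide), hp]
  have hq3 : h3.v py = q := by rw [f13.v _ (by decide), hq]
  refine WP.forRange (fun j h' n => n ≤ 12 * (j - 1) ∧ ReachBound U h' ∧
      (∀ X, j ≤ X → ∀ l, h'.a reach X l 0 = h.a reach X l 0) ∧
      ∀ X, 1 ≤ X → X < j → ∀ Y, 1 ≤ Y → Y ≤ U → (Blocked (fun l => h'.a reach X l 0) Y ↔
        Blocked (fun l => h.a reach X l 0) Y ∨ Bad R T (p, q) X Y)) (U + 1)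
    (by simp; omega) (by simp) ⟨by simp, ?_, ?_, fun X hX hX' => by simp at hX'; omega⟩ ?_
    (by decide) (by omega) ?_ ?_
  · intro X l; simp only [HState.set_a, hr3]; exact hr X l
  · intro X _ l; simp only [HState.set_a, hr3]
  · intro j h' n hf _ _ _ _
    have : h'.v .U = U := by rw [hf.v _ (by decide), hC3.vU]
    simp [this]; omega
  · rintro j h4 n4 f4 hj hj' hx ⟨hn4, hr4, hsame, hblk⟩
    simp only [eval_ofNat] at hj
    have hjU : j ≤ U := by omega
    have hC4 : Consts U L h4 := hC3.frame f4 (by decide)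
    have hG4 : HasArc U R h4 := hG3.frame f4 (by decide)
    have hp4 : h4.v px = p := by rw [f4.v _ (by decide), hp3]
    have hq4 : h4.v py = q := by rw [f4.v _ (by decide), hq3]
    have hA4 : ∀ b, h4.a (A b) = h3.a (A b) := fun b => f4.a _ (by cases b <;> decide)
    have hA0 := hA false j hj hjU
    have hA1 := hA true j hj hjU
    set a0 := h3.a (A false) j 0 0
    set a1 := h3.a (A true) j 0 0
    obtain ⟨fl, el⟩ := lowExpr_spec (col := vX) (y := var py) hM hC4 hG4 (by rw [hx]; omega)
      (by rw [hp4]; omega) (by simp) (by simp [hq4, hqU])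
    refine WP.seq (WP.assign fl ?_)
    rw [el]
    simp only [eval_var, hq4, hx, hp4]
    have hCs : Consts U L (h4.set la (low U R q (gap j p))) :=
      hC4.frame (Frame.refl [] [] _).of_set (by decide)
    obtain ⟨fl', el'⟩ := lowExpr_spec (h := h4.set la (low U R q (gap j p))) (col := vX)
      (y := var Reg.U + 1 - var py) hM hCs (hG4.frame (Frame.refl [] [] _).of_set (by decide))
      (by simp [hx]; omega) (by simp [hp4]; omega) (by simp [hC4.vU]; omega)
      (by simp [hC4.vU, hq4]; omega)
    refine WP.seq (WP.assign fl' ?_)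
    rw [el']
    simp only [eval_var, eval_sub, eval_add, eval_ofNat, HState.set_v, reduceCtorEq, if_false,
      hC4.vU, hq4, hx, hp4]
    have hl0 : low U R q (gap j p) ≤ U + 1 := clip_le _ _ _ _
    have hl1 : low U R (U + 1 - q) (gap j p) ≤ U + 1 := clip_le _ _ _ _
    have near := fun Y hY hY' => near_iff_low (x := p) (y := q) (X := j) (Y := Y) hC.U_pos hG.R_le
      hqU hY hY'
    set l0 := low U R q (gap j p)
    set l1 := low U R (U + 1 - q) (gap j p)
    set h5 := (h4.set la l0).set lb l1 with h5_def
    have f5 : Frame [la, lb] [] h4 h5 := (Frame.refl [] [] _).of_set.of_set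
    have hla5 : h5.v la = l0 := by simp [h5_def]
    have hlb5 : h5.v lb = l1 := by simp [h5_def]
    have hX5 : h5.v vX = j := by simp [h5_def, hx]
    have hC5 : Consts U L h5 := hC4.frame f5 (by decide)
    have hr5 : h5.a reach = h4.a reach := f5.a _ (by decide)
    have hA5 : ∀ b, h5.a (A b) = h3.a (A b) := fun b => by rw [← hA4]; exact f5.a _ (by simp)
    clear_value h5
    refine WP.seq ((block_spec hM hC5 (by rw [ReachBound, hr5]; exact hr4) hX5 hj hjU
      (v := var Reg.U + 1) (u := min (var la) (get₁ (A false) (var vX))) (n := Min.min l0 a0)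
      (by simp [hC5.vU]; omega) (by simp [hC5.vU]) (by simp; omega)
      (by simp [hla5, hX5, hA5, a0]) (by omega)).mono ?_)
    rintro h6 n6 f6 ⟨hr6, hs6, hb6, hn6⟩
    have hla6 : h6.v la = l0 := by rw [f6.v _ (by decide), hla5]
    have hlb6 : h6.v lb = l1 := by rw [f6.v _ (by decide), hlb5]
    have hX6 : h6.v vX = j := by rw [f6.v _ (by decide), hX5]
    have hC6 : Consts U L h6 := hC5.frame f6 (by decide)
    have hA6 : ∀ b, h6.a (A b) = h3.a (A b) := fun b => by
      rw [f6.a _ (by cases b <;> decide), hA5]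
    refine WP.seq ((block_spec hM hC6 hr6 hX6 hj hjU
      (v := get₁ (A true) (var vX)) (u := var la) (n := l0)
      (by simp; omega) (by simp [hX6, hA6]; exact hA1) (by simp)
      (by simp [hla6]) (by omega)).mono ?_)
    rintro h7 n7 f7 ⟨hr7, hs7, hb7, hn7⟩
    have hlb7 : h7.v lb = l1 := by rw [f7.v _ (by decide), hlb6]
    have hX7 : h7.v vX = j := by rw [f7.v _ (by decide), hX6]
    have hC7 : Consts U L h7 := hC6.frame f7 (by decide)
    have hA7 : ∀ b, h7.a (A b) = h3.a (A b) := fun b => by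
      rw [f7.a _ (by cases b <;> decide), hA6]
    refine WP.seq ((block_spec hM hC7 hr7 hX7 hj hjU
      (v := var lb) (u := get₁ (A false) (var vX)) (n := a0)
      (by simp) (by simp [hlb7]; exact hl1) (by simp; omega)
      (by simp [hX7, hA7, a0]) (by omega)).mono ?_)
    rintro h8 n8 f8 ⟨hr8, hs8, hb8, hn8⟩
    have hlb8 : h8.v lb = l1 := by rw [f8.v _ (by decide), hlb7]
    have hX8 : h8.v vX = j := by rw [f8.v _ (by decide), hX7]
    have hC8 : Consts U L h8 := hC7.frame f8 (by decide)
    have hA8 : ∀ b, h8.a (A b) = h3.a (A b) := fun b => by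
      rw [f8.a _ (by cases b <;> decide), hA7]
    refine (block_spec hM hC8 hr8 hX8 hj hjU
      (v := min (var lb) (get₁ (A true) (var vX))) (u := var Reg.U + 1) (n := U + 1)
      (by simp; omega) (by simp [hlb8, hX8, hA8]; omega) (by simp [hC8.vU]; omega)
      (by simp [hC8.vU]) (by omega)).mono ?_
    rintro h9 n9 f9 ⟨hr9, hs9, hb9, hn9⟩
    refine ⟨by omega, hr9, fun X hX l => ?_, fun X hX hX' Y hY hY' => ?_⟩
    · have hne : X ≠ j := by omega
      rw [HState.set_a, hs9 X hne, hs8 X hne, hs7 X hne, hs6 X hne, hr5]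
      exact hsame X (by omega) l
    · simp only [HState.set_a]
      by_cases hXj : X = j
      · subst hXj
        have key : Bad R T (p, q) X Y ↔
            ¬ ((l0 ≤ Y ∧ l1 ≤ U + 1 - Y) ∨ (a0 ≤ Y ∧ a1 ≤ U + 1 - Y)) := by
          rw [Bad, near Y hY hY', hiff X hX hjU Y hY hY']
        have hold : (fun l => h5.a reach X l 0) = fun l => h.a reach X l 0 := by
          funext l; rw [hr5, hsame X le_rfl]
        rw [hb9 Y hY', hb8 Y hY', hb7 Y hY', hb6 Y hY', key, hold]
        simp only [eval_min, eval_var, eval_get₁, eval_add, eval_ofNat, hC5.vU, hX6, hA6, hlb7,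
          hlb8, hX8, hA8]
        simp only [or_assoc]
        refine or_congr_right ?_
        omega
      · have hs : (fun l => h9.a reach X l 0) = fun l => h4.a reach X l 0 := by
          funext l
          rw [hs9 X hXj, hs8 X hXj, hs7 X hXj, hs6 X hXj, hr5]
        rw [hs]
        exact hblk X hX (by omega) Y hY hY'
  · rintro h4 n4 f4 - ⟨hn4, hr4, -, hblk⟩
    refine ⟨hr4, fun X hX hX' => hblk X hX (by omega), ?_⟩
    have e : 130 * U * (L + 1) = 100 * U * (L + 1) + 30 * U * (L + 1) := by ring
    have e' : 30 * U * 1 ≤ 30 * U * (L + 1) := Nat.mul_le_mul_left _ (by omega)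
    omega

end Structured

/-! ### Centers that meet all pairs, and the search for a partner of one center. -/

namespace Structured

open GridDisk HExpr IB2C

open Reg Arr

/-- `reach` is reused for every tested radius. Index `U + 2` must be cleared too, since it is the
left end of empty ranges. -/
def clearReach : HProg :=
  .forRange vX 1 (var U + 1) (.forRange vy 0 (var U + 3) (put₂ reach (var vX) (var vy) 0))

theorem clearReach_spec {M U L : ℕ} {h : HState} (hM : 100 * (U + 2) ^ 4 ≤ M)
    (hC : Consts U L h) :
    WP M clearReach h fun h' n =>
      (∀ X l, 1 ≤ X → X ≤ U → l ≤ U + 2 → h'.a reach X l 0 = 0) ∧ n ≤ 20 * (U * U) := by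
  have hsz := size_bound hM
  have hU1 := hC.U_pos
  refine WP.forRange (fun j h' n => n ≤ (j - 1) * (3 * U + 13) ∧
      ∀ X l, 1 ≤ X → X < j → l ≤ U + 2 → h'.a reach X l 0 = 0) (U + 1)
    (by simp; omega) (by simp) ⟨by simp, fun x _ hx hx' => by simp at hx'; omega⟩ ?_
    (by decide) (by omega) ?_ ?_
  · intro j h' n hf _ _ _ _
    have : h'.v .U = U := by rw [hf.v _ (by decide), hC.vU]
    simp [this]; omega
  · rintro j h1 n1 f1 hj hj' hx ⟨hn1, ha1⟩
    simp only [eval_ofNat] at hj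
    have hC1 : Consts U L h1 := hC.frame f1 (by decide)
    refine WP.forRange (fun i h' n => n ≤ 3 * i ∧
        (∀ X l, 1 ≤ X → X < j → l ≤ U + 2 → h'.a reach X l 0 = 0) ∧
        ∀ l < i, h'.a reach j l 0 = 0) (U + 3)
      (by simp; omega) (by simp) ⟨by simp, by simpa using ha1, by simp⟩ ?_
      (by decide) (by omega) ?_ ?_
    · intro i h' n hf _ _ _ _
      have : h'.v .U = U := by rw [hf.v _ (by decide), hC1.vU]
      simp [this]; omega
    · rintro i h2 n2 f2 - hi hy ⟨hn2, hb2, ha2⟩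
      have hX2 : h2.v vX = j := by rw [f2.v _ (by decide), hx]
      refine WP.put₂ (by simp) (by simp) (by simp; omega) (by omega)
        ⟨by omega, fun X l hX hX' hl => ?_, fun l hl => ?_⟩
      · simp only [HState.set_a, HState.put_a, eval_var, eval_ofNat, hX2, hy, true_and, and_true]
        split_ifs
        · rfl
        · exact hb2 X l hX hX' hl
      · simp only [HState.set_a, HState.put_a, eval_var, eval_ofNat, hX2, hy, true_and, and_true]
        split_ifs
        · rfl
        · exact ha2 l (by omega)
    · rintro h2 n2 f2 - ⟨hn2, hb2, ha2⟩
      refine ⟨?_, fun X l hX hX' hl => ?_⟩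
      · obtain ⟨i, rfl⟩ := Nat.exists_eq_add_of_le' hj
        simp only [Nat.add_sub_cancel] at hn1 ⊢
        rw [Nat.succ_mul]
        omega
      · simp only [HState.set_a]
        rcases Nat.lt_succ_iff_lt_or_eq.1 hX' with h4 | rfl
        · exact hb2 X l hX h4 hl
        · exact ha2 l (by omega)
  · rintro h1 n1 f1 - ⟨hn1, ha1⟩
    refine ⟨fun X l hX hX' hl => ha1 X l hX (by omega) hl, ?_⟩
    rw [Nat.add_sub_cancel] at hn1
    have e : U * (3 * U + 13) = 3 * (U * U) + 13 * U := by ring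
    have e2 : U * 1 ≤ U * U := Nat.mul_le_mul_left _ hU1
    omega

/-- All grid points may serve as the missed point: one without partners blocks no center. -/
def forbidAll : HProg :=
  .forRange px 1 (var U + 1) (.forRange py 1 (var U + 1) forbid)

theorem forbidAll_spec {M U L R : ℕ} {T : List PointPair} {h : HState}
    (hM : 100 * (U + 2) ^ 4 ≤ M) (hC : Consts U L h) (hG : HasArc U R h) (hT : Tables U T h)
    (hr : ∀ X l, 1 ≤ X → X ≤ U → l ≤ U + 2 → h.a reach X l 0 = 0) :
    WP M forbidAll h fun h' n => ReachBound U h' ∧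
      (∀ X, 1 ≤ X → X ≤ U → ∀ Y, 1 ≤ Y → Y ≤ U → (Blocked (fun l => h'.a reach X l 0) Y ↔
        ¬ Meets R T (X, Y))) ∧
      n ≤ 140 * U ^ 3 * (L + 1) := by
  have hsz := size_bound hM
  have hU1 := hC.U_pos
  refine WP.forRange (fun j h' n => n ≤ (j - 1) * (U * (130 * U * (L + 1) + 2) + 4) ∧
      ReachBound U h' ∧
      ∀ X, 1 ≤ X → X ≤ U → ∀ Y, 1 ≤ Y → Y ≤ U → (Blocked (fun l => h'.a reach X l 0) Y ↔
        ∃ p q, (1 ≤ p ∧ p < j) ∧ (1 ≤ q ∧ q ≤ U) ∧ Bad R T (p, q) X Y)) (U + 1)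
    (by simp; omega) (by simp) ⟨by simp, ?_, ?_⟩ ?_ (by decide) (by omega) ?_ ?_
  · intro X l h1 h2 h3
    simp only [HState.set_a, hr X l h1 h2 h3]; omega
  · intro X hX hX' Y hY hY'
    refine iff_of_false ?_ ?_
    · rintro ⟨l, h1, h2, h3⟩
      simp only [HState.set_a, hr X l hX hX' (by omega)] at h3
      omega
    · rintro ⟨p, q, h1, -⟩
      simp only [eval_ofNat] at h1
      omega
  · intro j h' n hf _ _ _ _
    have : h'.v .U = U := by rw [hf.v _ (by decide), hC.vU]
    simp [this]; omega
  · rintro j h1 n1 f1 hj hj' hp ⟨hn1, hr1, hb1⟩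
    simp only [eval_ofNat] at hj
    have hC1 : Consts U L h1 := hC.frame f1 (by decide)
    have hG1 : HasArc U R h1 := hG.frame f1 (by decide)
    have hT1 : Tables U T h1 := hT.frame f1 (by decide)
    refine WP.forRange (fun i h' n => n ≤ (i - 1) * (130 * U * (L + 1) + 2) ∧ ReachBound U h' ∧
        ∀ X, 1 ≤ X → X ≤ U → ∀ Y, 1 ≤ Y → Y ≤ U → (Blocked (fun l => h'.a reach X l 0) Y ↔
          Blocked (fun l => h1.a reach X l 0) Y ∨
          ∃ q, (1 ≤ q ∧ q < i) ∧ Bad R T (j, q) X Y)) (U + 1)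
      (by simp; omega) (by simp) ⟨by simp, hr1, ?_⟩ ?_ (by decide) (by omega) ?_ ?_
    · intro X hX hX' Y hY hY'
      refine ⟨Or.inl, fun H => H.resolve_right ?_⟩
      rintro ⟨q, h1, -⟩
      simp only [eval_ofNat] at h1
      omega
    · intro i h' n hf _ _ _ _
      have : h'.v .U = U := by rw [hf.v _ (by decide), hC1.vU]
      simp [this]; omega
    · rintro i h2 n2 f2 hi hi' hq ⟨hn2, hr2, hb2⟩
      simp only [eval_ofNat] at hi
      refine (forbid_spec hM (hC1.frame f2 (by decide)) (hG1.frame f2 (by decide))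
        (hT1.frame f2 (by decide)) hr2 (by rw [f2.v _ (by decide), hp]) hq hj (by omega) hi
        (by omega)).mono ?_
      rintro h3 n3 f3 ⟨hr3, hb3, hn3⟩
      refine ⟨?_, hr3, fun X hX hX' Y hY hY' => ?_⟩
      · obtain ⟨k, rfl⟩ := Nat.exists_eq_add_of_le' hi
        simp only [Nat.add_sub_cancel] at hn2 ⊢
        rw [Nat.succ_mul]
        omega
      · simp only [HState.set_a]
        rw [hb3 X hX hX' Y hY hY', hb2 X hX hX' Y hY hY', or_assoc]
        refine or_congr_right ⟨?_, ?_⟩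
        · rintro (⟨q, ⟨h1, h2⟩, h3⟩ | h3)
          · exact ⟨q, ⟨h1, by omega⟩, h3⟩
          · exact ⟨i, ⟨hi, by omega⟩, h3⟩
        · rintro ⟨q, ⟨h1, h2⟩, h3⟩
          rcases Nat.lt_succ_iff_lt_or_eq.1 h2 with h4 | rfl
          · exact Or.inl ⟨q, ⟨h1, h4⟩, h3⟩
          · exact Or.inr h3
    · rintro h2 n2 f2 - ⟨hn2, hr2, hb2⟩
      refine ⟨?_, hr2, fun X hX hX' Y hY hY' => ?_⟩
      · obtain ⟨k, rfl⟩ := Nat.exists_eq_add_of_le' hj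
        simp only [Nat.add_sub_cancel] at hn1 hn2 ⊢
        rw [Nat.succ_mul]
        omega
      · simp only [HState.set_a]
        rw [hb2 X hX hX' Y hY hY', hb1 X hX hX' Y hY hY']
        constructor
        · rintro (⟨p, q, ⟨h1, h2⟩, h3⟩ | ⟨q, ⟨h1, h2⟩, h3⟩)
          · exact ⟨p, q, ⟨h1, by omega⟩, h3⟩
          · exact ⟨j, q, ⟨hj, by omega⟩, ⟨h1, by omega⟩, h3⟩
        · rintro ⟨p, q, ⟨h1, h2⟩, ⟨h3, h4⟩, h5⟩
          rcases Nat.lt_succ_iff_lt_or_eq.1 h2 with h6 | rfl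
          · exact Or.inl ⟨p, q, ⟨h1, h6⟩, ⟨h3, h4⟩, h5⟩
          · exact Or.inr ⟨q, ⟨h3, by omega⟩, h5⟩
  · rintro h1 n1 f1 - ⟨hn1, hr1, hb1⟩
    refine ⟨hr1, fun X hX hX' Y hY hY' => ?_, ?_⟩
    · rw [hb1 X hX hX' Y hY hY', meets_iff]
      simp only [not_forall]
      constructor
      · rintro ⟨p, q, -, -, h5⟩
        exact ⟨(p, q), h5⟩
      · rintro ⟨p, h5⟩
        have h6 : ∃ x y, Adj T p x y := by
          by_contra! hno
          exact h5 (Or.inr fun x y hxy => absurd hxy (hno x y))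
        obtain ⟨x, y, hxy⟩ := h6
        have hbox := adj_left_inBox hT.inGrid hxy
        exact ⟨p.1, p.2, ⟨hbox.1.1, by omega⟩, hbox.2, h5⟩
    · rw [Nat.add_sub_cancel] at hn1
      have e : U * (U * (130 * U * (L + 1) + 2) + 4) =
        130 * U ^ 3 * (L + 1) + 2 * U ^ 2 + 4 * U := by ring
      have e' : 140 * U ^ 3 * (L + 1) = 130 * U ^ 3 * (L + 1) + 10 * U ^ 3 * (L + 1) := by ring
      have e1 : 10 * U ^ 3 * 1 ≤ 10 * U ^ 3 * (L + 1) := Nat.mul_le_mul_left _ (by omega)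
      have e2 : U ^ 2 ≤ U ^ 3 := Nat.pow_le_pow_right hU1 (by norm_num)
      have e3 : U ≤ U ^ 3 := Nat.le_self_pow (by norm_num) U
      omega

/-- Compute, for every cell, the largest height of a center below it whose disk meets all pairs. -/
def columns : HProg :=
  .forRange vX 1 (var U + 1)
    (cur <== 0 ;;
      put₂ V (var vX) 0 0 ;;
      .forRange vy 1 (var U + 1)
        -- `cur` is the largest right end among the ranges that start at or below `vy`; so `vy` is
        -- blocked exactly when it is below `cur`.
        (cur <== max (var cur) (get₂ reach (var vX) (var vy)) ;;
          .ite (lt (var vy) (var cur))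
            (put₂ V (var vX) (var vy) (get₂ V (var vX) (var vy - 1)))
            (put₂ V (var vX) (var vy) (var vy))))

theorem columns_spec {M U L R : ℕ} {T : List PointPair} {h : HState}
    (hM : 100 * (U + 2) ^ 4 ≤ M) (hC : Consts U L h) (hr : ReachBound U h)
    (hb : ∀ X, 1 ≤ X → X ≤ U → ∀ Y, 1 ≤ Y → Y ≤ U → (Blocked (fun l => h.a reach X l 0) Y ↔
        ¬ Meets R T (X, Y))) :
    WP M columns h fun h' n =>
      (∀ X, 1 ≤ X → X ≤ U → ∀ y ≤ U, IsPrev (fun Y => Meets R T (X, Y)) y (h'.a V X y 0)) ∧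
      n ≤ 20 * (U * U) := by
  have hsz := size_bound hM
  have hU1 := hC.U_pos
  refine WP.forRange (fun j h' n => n ≤ (j - 1) * (5 * U + 6) ∧
      ∀ X, 1 ≤ X → X < j → ∀ y ≤ U, IsPrev (fun Y => Meets R T (X, Y)) y (h'.a V X y 0)) (U + 1)
    (by simp; omega) (by simp) ⟨by simp, fun x hx hx' => by simp at hx'; omega⟩ ?_
    (by decide) (by omega) ?_ ?_
  · intro j h' n hf _ _ _ _
    have : h'.v .U = U := by rw [hf.v _ (by decide), hC.vU]
    simp [this]; omega
  · rintro X h1 n1 f1 hX hX' hx ⟨hn1, ha1⟩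
    simp only [eval_ofNat] at hX
    have hC1 : Consts U L h1 := hC.frame f1 (by decide)
    have hr1 : h1.a reach = h.a reach := f1.a _ (by decide)
    refine WP.seq (WP.assign (by simp; omega) (WP.seq (WP.put₂ (by simp) (by simp; omega)
      (by simp; omega) (by omega) ?_)))
    simp only [eval_ofNat, eval_var, HState.set_v, reduceCtorEq, if_false, hx]
    refine WP.forRange (fun i h' n => n ≤ 5 * (i - 1) ∧ h'.v cur ≤ U + 1 ∧
        (∀ X', 1 ≤ X' → X' < X → ∀ y ≤ U,
          IsPrev (fun Y => Meets R T (X', Y)) y (h'.a V X' y 0)) ∧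
        (∀ Y, Y < h'.v cur ↔ ∃ l, 1 ≤ l ∧ l < i ∧ Y < h.a reach X l 0) ∧
        ∀ y < i, IsPrev (fun Y => Meets R T (X, Y)) y (h'.a V X y 0)) (U + 1)
      (by simp; omega) (by simp) ⟨by simp, by simp, ?_, ?_, ?_⟩ ?_ (by decide) (by omega) ?_ ?_
    · intro X' h1 h2 y hy
      simp only [HState.set_a, HState.put_a, true_and, and_true, show X' ≠ X by omega, false_and,
        if_false]
      exact ha1 X' h1 h2 y hy
    · intro Y
      refine iff_of_false (by simp) ?_
      rintro ⟨l, h1, h2, -⟩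
      simp only [eval_ofNat] at h2
      omega
    · intro y hy
      simp only [eval_ofNat] at hy
      obtain rfl : y = 0 := by omega
      simp [IsPrev.zero]
    · intro i h' n hf _ _ _ _
      have := hf.v .U (by decide)
      simp only [HState.put_v, HState.set_v, reduceCtorEq, if_false, hC1.vU] at this
      simp [this]; omega
    · rintro i h2 n2 f2 hi hi' hy ⟨hn2, hc2, ho2, hcur2, hv2⟩
      simp only [eval_ofNat] at hi
      have f2' := f2.of_put.of_set
      have hX2 : h2.v vX = X := by rw [f2'.v _ (by decide), hx]
      have hr2 : h2.a reach = h.a reach := by rw [f2'.a _ (by decide), hr1]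
      have hri := hr X i hX (by omega) (by omega)
      refine WP.seq (WP.assign (by simp [hX2, hy, hr2]; omega) ?_)
      simp only [eval_max, eval_var, eval_get₂, hX2, hy, hr2]
      have hcur : ∀ Y, Y < Max.max (h2.v cur) (h.a reach X i 0) ↔
          ∃ l, 1 ≤ l ∧ l < i + 1 ∧ Y < h.a reach X l 0 := by
        intro Y
        rw [lt_max_iff, hcur2]
        constructor
        · rintro (⟨l, h1, h2, h3⟩ | h3)
          · exact ⟨l, h1, by omega, h3⟩
          · exact ⟨i, hi, by omega, h3⟩
        · rintro ⟨l, h1, h2, h3⟩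
          rcases Nat.lt_succ_iff_lt_or_eq.1 h2 with h4 | rfl
          · exact Or.inl ⟨l, h1, h4, h3⟩
          · exact Or.inr h3
      have hmeet : i < Max.max (h2.v cur) (h.a reach X i 0) ↔ ¬ Meets R T (X, i) := by
        rw [hcur, ← hb X hX (by omega) i hi (by omega)]
        exact ⟨fun ⟨l, h1, h2, h3⟩ => ⟨l, h1, by omega, h3⟩,
          fun ⟨l, h1, h2, h3⟩ => ⟨l, h1, by omega, h3⟩⟩
      obtain ⟨k, rfl⟩ := Nat.exists_eq_add_of_le' hi
      refine WP.ite (by simp) (fun hc => ?_) (fun hc => ?_)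
      · simp only [eval_lt, eval_var, HState.set_v, hy, reduceCtorEq, if_false, if_true, ne_eq,
          ite_eq_right_iff, one_ne_zero, imp_false, not_not] at hc
        refine WP.put₂ (by simp) (by simp) (by simp; omega) (by omega) ⟨by omega, ?_, ?_, ?_, ?_⟩
        · simp; omega
        · intro X' h1 h2 y hy'
          simp only [HState.set_a, HState.put_a, eval_var, HState.set_v, reduceCtorEq, if_false, hX2,
            show X' ≠ X by omega, false_and, and_false]
          exact ho2 X' h1 h2 y hy'
        · simpa using hcur
        · intro y hy'
          simp only [HState.set_a, HState.put_a, HState.set_v, eval_var, eval_get₂, eval_sub,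
            eval_ofNat, hX2, hy, reduceCtorEq, if_false, true_and, and_true]
          split_ifs with hyk
          · rw [hyk]
            exact (hv2 k (by omega)).succ_of_notMem (hmeet.1 hc)
          · exact hv2 y (by omega)
      · simp only [eval_lt, eval_var, HState.set_v, hy, reduceCtorEq, if_false, if_true,
          ite_eq_right_iff, one_ne_zero, imp_false] at hc
        refine WP.put₂ (by simp) (by simp) (by simp) (by omega) ⟨by omega, ?_, ?_, ?_, ?_⟩
        · simp; omega
        · intro X' h1 h2 y hy'
          simp only [HState.set_a, HState.put_a, eval_var, HState.set_v, reduceCtorEq, if_false, hX2,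
            show X' ≠ X by omega, false_and, and_false]
          exact ho2 X' h1 h2 y hy'
        · simpa using hcur
        · intro y hy'
          simp only [HState.set_a, HState.put_a, HState.set_v, eval_var,
            hX2, hy, reduceCtorEq, if_false, true_and, and_true]
          split_ifs with hyk
          · rw [hyk]
            exact IsPrev.succ_of_mem (not_not.1 fun hn => hc (hmeet.2 hn))
          · exact hv2 y (by omega)
    · rintro h2 n2 f2 - ⟨hn2, -, ho2, -, hv2⟩
      refine ⟨?_, fun X' h1 h2 y hy => ?_⟩
      · obtain ⟨i, rfl⟩ := Nat.exists_eq_add_of_le' hX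
        simp only [Nat.add_sub_cancel] at hn1 hn2 ⊢
        rw [Nat.succ_mul]
        omega
      · simp only [HState.set_a]
        rcases Nat.lt_succ_iff_lt_or_eq.1 h2 with h4 | rfl
        · exact ho2 X' h1 h4 y hy
        · exact hv2 y (by omega)
  · rintro h1 n1 f1 - ⟨hn1, ha1⟩
    refine ⟨fun X hX hX' => ha1 X hX (by omega), ?_⟩
    rw [Nat.add_sub_cancel] at hn1
    have e : U * (5 * U + 6) = 5 * (U * U) + 6 * U := by ring
    have e2 : U * 1 ≤ U * U := Nat.mul_le_mul_left _ hU1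
    omega

/-! ### Search for a pair of centers -/

/-- The top of the points of the column `vx` that are missed by a disk with the column bounds `a`
and `a'`. -/
def missedTop (b : Bool) (a a' : Reg) : HProg :=
  .ite (lt (var U + 1) (var a' + get₂ (P b) (var vx) (var U)))
    (t <== get₂ (P b) (var vx) (var U))
    (t <== get₂ (P b) (var vx) (var a - 1)) ;;
  put₁ (F b) (var vx) encExpr

theorem missedTop_spec {M U L : ℕ} {T : List PointPair} {b : Bool} {h : HState}
    (hM : 100 * (U + 2) ^ 4 ≤ M) (hC : Consts U L h) (hT : Tables U T h) {a a' : Reg} {x : ℕ}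
    (hx : h.v vx = x) (hx1 : 1 ≤ x) (hxU : x ≤ U) (ha : h.v a ≤ U + 1) (ha' : h.v a' ≤ U + 1) :
    WP M (missedTop b a a') h fun h' n =>
      (∀ i, h'.a (F b) i 0 0 = if i = x then enc U (if U + 1 < h.v a' + h.a (P b) x U 0 then
        h.a (P b) x U 0 else h.a (P b) x (h.v a - 1) 0) else h.a (F b) i 0 0) ∧ n = 3 := by
  have hsz := size_bound hM
  have h1 := (hT.prev b x hx1 hxU U le_rfl).1
  have h2 := (hT.prev b x hx1 hxU (h.v a - 1) (by omega)).1
  refine WP.seq (WP.ite ?_ (fun hc => ?_) (fun hc => ?_))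
  · simp [hC.vU, hx]; omega
  all_goals
    simp only [eval_lt, eval_add, eval_var, eval_ofNat, eval_get₂, hC.vU, hx, ne_eq,
      ite_eq_right_iff, one_ne_zero, imp_false, not_not] at hc
    refine WP.assign (by simp; omega) ?_
    simp only [eval_get₂, eval_var, eval_sub, eval_ofNat, hC.vU, hx]
    have hC' : ∀ n, Consts U L (h.set t n) := fun n => hC.frame (Frame.refl [] [] _).of_set
      (by decide)
    refine WP.put₁ (by simp) (encExpr_fits hM (hC' _) (by simp; omega)) (by omega)
      ⟨fun i => ?_, rfl⟩
    rw [encExpr_eval (hC' _)]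
    simp [hx, hc]

/-- Look for a second center for the first center `(px, py)`. -/
def probe : HProg :=
  .forRange vx 1 (var U + 1)
    (la <== lowExpr vx (var py) ;;
      lb <== lowExpr vx (var U + 1 - var py) ;;
      missedTop false la lb ;; missedTop true lb la) ;;
  bothBounds ;;
  .forRange vX 1 (var U + 1)
    -- The highest admissible center under the upper end of the interval is the best candidate: if
    -- it lies below the lower end, the interval contains no admissible center. The value 0 means
    -- that there is none, and the product of comparisons is a conjunction.
    (t <== get₂ V (var vX) (min (var U) (var U + 1 - get₁ (A true) (var vX))) ;;
      .ite (lt 0 (var t) * lt (get₁ (A false) (var vX)) (var t + 1))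
        (found <== 1 ;; fx1 <== var px ;; fy1 <== var py ;; fx2 <== var vX ;; fy2 <== var t)
        .skip)

/-- The disks with squared radius `R` around the found centers are a solution, if `found ≠ 0`. -/
def Found (U R : ℕ) (T : List PointPair) (h : HState) : Prop :=
  h.v found ≠ 0 → ((1 ≤ h.v fx1 ∧ h.v fx1 ≤ U) ∧ (1 ≤ h.v fy1 ∧ h.v fy1 ≤ U) ∧
    (1 ≤ h.v fx2 ∧ h.v fx2 ≤ U) ∧ 1 ≤ h.v fy2 ∧ h.v fy2 ≤ U) ∧
    Covers R T (h.v fx1, h.v fy1) (h.v fx2, h.v fy2)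

theorem probe_spec {M U L R : ℕ} {T : List PointPair} {h : HState}
    (hM : 100 * (U + 2) ^ 4 ≤ M) (hC : Consts U L h) (hG : HasArc U R h) (hT : Tables U T h)
    (hV : ∀ X, 1 ≤ X → X ≤ U → ∀ y ≤ U, IsPrev (fun Y => Meets R T (X, Y)) y (h.a V X y 0))
    (hfound : Found U R T h) {p q : ℕ}
    (hp : h.v px = p) (hq : h.v py = q) (hp1 : 1 ≤ p) (hpU : p ≤ U) (hq1 : 1 ≤ q) (hqU : q ≤ U)
    (hpq : Meets R T (p, q)) :
    WP M probe h fun h' n => Found U R T h' ∧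
      (h'.v found = 0 → h.v found = 0 ∧
        ∀ X Y, 1 ≤ X → X ≤ U → 1 ≤ Y → Y ≤ U → ¬ Covers R T (p, q) (X, Y)) ∧
      n ≤ 130 * U * (L + 1) := by
  have hsz := size_bound hM
  have hU1 := hC.U_pos
  obtain ⟨a, ha⟩ : ∃ a : Bool → ℕ → ℕ, a = fun b x =>
    bif b then low U R (U + 1 - q) (gap x p) else low U R q (gap x p) := ⟨_, rfl⟩
  have ha1 : ∀ b x, a b x ≤ U + 1 := by
    intro b x
    rw [ha]
    cases b <;> exact clip_le _ _ _ _
  have hmiss : ∀ x y, missed U (Pts T) a x y ↔ Pts T x y ∧ ¬ Near R (x, y) (p, q) := by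
    intro x y
    refine and_congr_right fun hxy => ?_
    have hbox := pts_inBox hT.inGrid _ _ hxy
    -- Nearness is symmetric, so the bounds for centers around a point also describe the points
    -- inside a disk.
    rw [near_comm, near_iff_low hC.U_pos hG.R_le hqU hbox.2.1 hbox.2.2, ha]
    simp only [cond_true, cond_false]
    omega
  refine WP.seq (WP.forRange (fun j h' n => n ≤ 10 * (j - 1) ∧ ∀ b x, 1 ≤ x → x < j →
      h'.a (F b) x 0 0 = enc U (if U + 1 < a (!b) x + h.a (P b) x U 0 then h.a (P b) x U 0
        else h.a (P b) x (a b x - 1) 0)) (U + 1)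
    (by simp; omega) (by simp) ⟨by simp, fun b x hx hx' => by simp at hx'; omega⟩ ?_
    (by decide) (by omega) ?_ ?_)
  · intro j h' n hf _ _ _ _
    have : h'.v .U = U := by rw [hf.v _ (by decide), hC.vU]
    simp [this]; omega
  · rintro j h1 n1 f1 hj hj' hx ⟨hn1, hF1⟩
    simp only [eval_ofNat] at hj
    have hjU : j ≤ U := by omega
    have hC1 : Consts U L h1 := hC.frame f1 (by decide)
    have hG1 : HasArc U R h1 := hG.frame f1 (by decide)
    have hT1 : Tables U T h1 := hT.frame f1 (by decide)
    have hp' : h1.v px = p := by rw [f1.v _ (by decide), hp]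
    have hq' : h1.v py = q := by rw [f1.v _ (by decide), hq]
    have hP1 : ∀ b, h1.a (P b) = h.a (P b) := fun b => f1.a _ (by cases b <;> decide)
    obtain ⟨fl, el⟩ := lowExpr_spec (col := vx) (y := var py) hM hC1 hG1 (by rw [hx]; omega)
      (by rw [hp']; omega) (by simp) (by simp [hq', hqU])
    refine WP.seq (WP.assign fl ?_)
    rw [el]
    simp only [eval_var, hq', hx, hp']
    have hCs : Consts U L (h1.set la (low U R q (gap j p))) :=
      hC1.frame (Frame.refl [] [] _).of_set (by decide)
    obtain ⟨fl', el'⟩ := lowExpr_spec (h := h1.set la (low U R q (gap j p))) (col := vx)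
      (y := var Reg.U + 1 - var py) hM hCs (hG1.frame (Frame.refl [] [] _).of_set (by decide))
      (by simp [hx]; omega) (by simp [hp']; omega) (by simp [hC1.vU]; omega)
      (by simp [hC1.vU, hq']; omega)
    refine WP.seq (WP.assign fl' ?_)
    rw [el']
    simp only [eval_var, eval_sub, eval_add, eval_ofNat, HState.set_v, reduceCtorEq, if_false,
      hC1.vU, hq', hx, hp']
    have h0 : low U R q (gap j p) = a false j := by rw [ha]; rfl
    have h1' : low U R (U + 1 - q) (gap j p) = a true j := by rw [ha]; rfl
    rw [h0, h1']
    set h2 := (h1.set la (a false j)).set lb (a true j) with h2_def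
    have f2 : Frame [la, lb] [] h1 h2 := (Frame.refl [] [] _).of_set.of_set
    have hla2 : h2.v la = a false j := by simp [h2_def]
    have hlb2 : h2.v lb = a true j := by simp [h2_def]
    have hx2 : h2.v vx = j := by simp [h2_def, hx]
    clear_value h2
    refine WP.seq ((missedTop_spec hM (hC1.frame f2 (by decide)) (hT1.frame f2 (by decide)) hx2 hj
      hjU (by rw [hla2]; exact ha1 _ _) (by rw [hlb2]; exact ha1 _ _)).mono ?_)
    rintro h3 n3 f3 ⟨hF3, hn3⟩
    have f23 : Frame ([la, lb] ++ (missedTop false la lb).regs) (missedTop false la lb).arrs h1 h3 :=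
      (f2.mono (by simp) (by simp)).trans (f3.mono (by simp) (by simp))
    have hla3 : h3.v la = a false j := by rw [f3.v _ (by decide), hla2]
    have hlb3 : h3.v lb = a true j := by rw [f3.v _ (by decide), hlb2]
    refine (missedTop_spec hM (hC1.frame f23 (by decide)) (hT1.frame f23 (by decide))
      (by rw [f3.v _ (by decide), hx2]) hj
      hjU (by rw [hlb3]; exact ha1 _ _) (by rw [hla3]; exact ha1 _ _)).mono ?_
    rintro h4 n4 f4 ⟨hF4, hn4⟩
    refine ⟨by omega, fun b x hx1 hx2 => ?_⟩
    rw [HState.set_a]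
    by_cases hc : x = j
    · subst hc
      cases b
      · rw [f4.a _ (by decide), hF3, if_pos rfl, hla2, hlb2, f2.a _ (by simp), hP1]; rfl
      · rw [hF4, if_pos rfl, hla3, hlb3, f23.a _ (by decide), hP1]; rfl
    · rw [← hF1 b x hx1 (by omega)]
      cases b
      · rw [f4.a _ (by decide), hF3, if_neg hc, f2.a _ (by simp)]
      · rw [hF4, if_neg hc, f23.a _ (by decide)]
  rintro h1 n1 f1 - ⟨hn1, hF1⟩
  have hS : InBox U (missed U (Pts T) a) := fun x y hxy => pts_inBox hT.inGrid x y hxy.1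
  refine WP.seq ((bothBounds_spec hM (hC.frame f1 (by decide)) (hG.frame f1 (by decide)) hS
    (isTop_missed (pts_inBox hT.inGrid) ha1 (p := fun b x y => h.a (P b) x y 0) hT.prev)
    (fun b x hx hx' => hF1 b x hx (by omega))).mono ?_)
  rintro h2 n2 f2 ⟨hA, hiff, hn2⟩
  have f12 : Frame ([vx, la, lb, t] ++ bothBounds.regs) ([F false, F true] ++ bothBounds.arrs) h h2 :=
    (f1.mono (by decide) (by decide)).trans
      (f2.mono (List.subset_append_right _ _) (List.subset_append_right _ _))
  have hC2 : Consts U L h2 := hC.frame f12 (by decide)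
  have hV2 : h2.a V = h.a V := f12.a _ (by decide)
  have hcov : ∀ X Y, 1 ≤ X → X ≤ U → 1 ≤ Y → Y ≤ U → (Covers R T (p, q) (X, Y) ↔
      Meets R T (X, Y) ∧ h2.a (A false) X 0 0 ≤ Y ∧ h2.a (A true) X 0 0 ≤ U + 1 - Y) := by
    intro X Y hX hX' hY hY'
    rw [covers_iff, ← hiff X hX hX' Y hY hY']
    simp only [hmiss, hpq, true_and]
    refine and_congr_right fun _ => forall_congr' fun x => forall_congr' fun y => ?_
    tauto
  refine WP.forRange (fun j h' n => n ≤ 9 * (j - 1) ∧ Found U R T h' ∧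
      (h'.v found = 0 → h.v found = 0 ∧
        ∀ X Y, 1 ≤ X → X < j → 1 ≤ Y → Y ≤ U → ¬ Covers R T (p, q) (X, Y))) (U + 1)
    (by simp; omega) (by simp) ⟨by simp, ?_, ?_⟩ ?_
    (by decide) (by omega) ?_ ?_
  · unfold Found at hfound ⊢
    simp only [HState.set_v, reduceCtorEq, if_false]
    rw [f12.v _ (by decide), f12.v _ (by decide), f12.v _ (by decide), f12.v _ (by decide),
      f12.v _ (by decide)]
    exact hfound
  · simp only [HState.set_v, reduceCtorEq, if_false, eval_ofNat]
    rw [f12.v _ (by decide)]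
    exact fun h0 => ⟨h0, fun X Y h1 h2 => by omega⟩
  · intro j h' n hf _ _ _ _
    have : h'.v .U = U := by rw [hf.v _ (by decide), hC2.vU]
    simp [this]; omega
  · rintro j h3 n3 f3 hj hj' hx ⟨hn3, hf3, hno3⟩
    simp only [eval_ofNat] at hj
    have hjU : j ≤ U := by omega
    have hC3 : Consts U L h3 := hC2.frame f3 (by decide)
    have hA3 : ∀ b, h3.a (A b) = h2.a (A b) := fun b => f3.a _ (by cases b <;> decide)
    have hV3 : h3.a V = h.a V := by rw [f3.a _ (by decide), hV2]
    have hp3 : h3.v px = p := by rw [f3.v _ (by decide), f12.v _ (by decide), hp]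
    have hq3 : h3.v py = q := by rw [f3.v _ (by decide), f12.v _ (by decide), hq]
    have hA0 := hA false j hj hjU
    have hA1 := hA true j hj hjU
    refine WP.seq (WP.assign (by simp [hC3.vU]; omega) ?_)
    simp only [eval_get₂, eval_get₁, eval_sub, eval_add, eval_min, eval_var, eval_ofNat, hC3.vU, hx,
      hA3, hV3]
    have hcovj := fun Y => hcov j Y hj hjU
    obtain ⟨hv1, hv2, hv3⟩ :=
      hV j hj hjU (Min.min U (U + 1 - h2.a (A true) j 0 0)) (min_le_left _ _)
    set v := h.a V j (Min.min U (U + 1 - h2.a (A true) j 0 0)) 0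
    have hvU : v ≤ U := hv1.trans (min_le_left _ _)
    have hv1' := hv1.trans (min_le_right _ _)
    refine WP.ite ?_ (fun hc => ?_) (fun hc => ?_)
    · simp only [fits_mul, fits_lt, fits_add, fits_get₁, fits_var, fits_ofNat, eval_lt, eval_add,
        eval_get₁, eval_var, eval_ofNat, HState.set_v, HState.set_a, hx, reduceCtorEq, if_false,
        if_true, hA3, true_and, and_true]
      split_ifs <;> omega
    · simp only [eval_mul, eval_lt, eval_add, eval_get₁, eval_var, eval_ofNat, HState.set_v,
        HState.set_a, hx, hA3, reduceCtorEq, if_false, if_true, ne_eq, mul_eq_zero, not_or,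
        ite_eq_right_iff, one_ne_zero, imp_false, not_not, Nat.lt_add_one_iff] at hc
      have hcv := (hcovj v hc.1 hvU).2 ⟨hv2 (by omega), hc.2, by omega⟩
      refine WP.seq (WP.assign (by simp; omega) (WP.seq (WP.assign (by simp) (WP.seq
        (WP.assign (by simp) (WP.seq (WP.assign (by simp) (WP.assign (by simp) ?_))))))))
      refine ⟨by omega, ?_, ?_⟩
      · intro _
        simp only [HState.set_v, eval_var, reduceCtorEq, if_false, if_true, hx, hp3, hq3]
        exact ⟨⟨⟨hp1, hpU⟩, ⟨hq1, hqU⟩, ⟨hj, hjU⟩, hc.1, hvU⟩, hcv⟩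
      · simp
    · simp only [eval_mul, eval_lt, eval_add, eval_get₁, eval_var, eval_ofNat, HState.set_v,
        HState.set_a, hx, hA3, reduceCtorEq, if_false, if_true, mul_eq_zero,
        ite_eq_right_iff, one_ne_zero, imp_false, Nat.lt_add_one_iff] at hc
      refine WP.skip ⟨by omega, ?_, fun h0 => ?_⟩
      · unfold Found at hf3 ⊢
        simpa using hf3
      · simp only [HState.set_v, reduceCtorEq, if_false] at h0
        refine ⟨(hno3 h0).1, fun X Y h1 h2 h3 h4 => ?_⟩
        rcases Nat.lt_succ_iff_lt_or_eq.1 h2 with h5 | rfl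
        · exact (hno3 h0).2 X Y h1 h5 h3 h4
        · intro hcv
          obtain ⟨i1, i2, i3⟩ := (hcovj Y h3 h4).1 hcv
          have := hv3 Y h3 (le_min h4 (by omega)) i1
          omega
  · rintro h3 n3 f3 - ⟨hn3, hf3, hno3⟩
    refine ⟨hf3, fun h0 => ⟨(hno3 h0).1, fun X Y h1 h2 => (hno3 h0).2 X Y h1 (by omega)⟩, ?_⟩
    have e : 130 * U * (L + 1) = 100 * U * (L + 1) + 30 * U * (L + 1) := by ring
    have e' : 30 * U * 1 ≤ 30 * U * (L + 1) := Nat.mul_le_mul_left _ (by omega)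
    omega

end Structured

/-! ### Decision for one radius, binary search and input. -/

namespace Structured

open GridDisk HExpr IB2C

open Reg Arr

/-- Try all first centers. -/
def search : HProg :=
  .forRange px 1 (var U + 1) (.forRange py 1 (var U + 1)
    -- The largest admissible height up to `py` is `py` itself exactly when this center meets all
    -- pairs.
    (.ite (.eq (get₂ V (var px) (var py)) (var py)) probe .skip))

theorem Found.congr {U R : ℕ} {T : List PointPair} {h h' : HState} (H : Found U R T h)
    (h0 : h'.v found = h.v found) (h1 : h'.v fx1 = h.v fx1) (h2 : h'.v fy1 = h.v fy1)
    (h3 : h'.v fx2 = h.v fx2) (h4 : h'.v fy2 = h.v fy2) : Found U R T h' := by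
  unfold Found at H ⊢
  rw [h0, h1, h2, h3, h4]
  exact H

theorem search_spec {M U L R : ℕ} {T : List PointPair} {h : HState}
    (hM : 100 * (U + 2) ^ 4 ≤ M) (hC : Consts U L h) (hG : HasArc U R h) (hT : Tables U T h)
    (hV : ∀ X, 1 ≤ X → X ≤ U → ∀ y ≤ U, IsPrev (fun Y => Meets R T (X, Y)) y (h.a V X y 0))
    (h0 : h.v found = 0) :
    WP M search h fun h' n => Found U R T h' ∧
      (h'.v found = 0 → ∀ p q X Y, (1 ≤ p ∧ p ≤ U) → (1 ≤ q ∧ q ≤ U) → (1 ≤ X ∧ X ≤ U) →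
        (1 ≤ Y ∧ Y ≤ U) → ¬ Covers R T (p, q) (X, Y)) ∧
      n ≤ 140 * U ^ 3 * (L + 1) := by
  have hsz := size_bound hM
  have hU1 := hC.U_pos
  refine WP.forRange (fun j h' n => n ≤ (j - 1) * (U * (130 * U * (L + 1) + 4) + 4) ∧
      Found U R T h' ∧
      (h'.v found = 0 → ∀ p q X Y, (1 ≤ p ∧ p < j) → (1 ≤ q ∧ q ≤ U) → (1 ≤ X ∧ X ≤ U) →
        (1 ≤ Y ∧ Y ≤ U) → ¬ Covers R T (p, q) (X, Y))) (U + 1)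
    (by simp; omega) (by simp) ⟨by simp, fun hne => absurd (by simpa using h0) hne, ?_⟩ ?_
    (by decide) (by omega) ?_ ?_
  · intro _ p q X Y hp
    simp only [eval_ofNat] at hp
    omega
  · intro j h' n hf _ _ _ _
    have : h'.v .U = U := by rw [hf.v _ (by decide), hC.vU]
    simp [this]; omega
  · rintro j h1 n1 f1 hj hj' hp ⟨hn1, hf1, hno1⟩
    simp only [eval_ofNat] at hj
    have hC1 : Consts U L h1 := hC.frame f1 (by decide)
    have hG1 : HasArc U R h1 := hG.frame f1 (by decide)
    have hT1 : Tables U T h1 := hT.frame f1 (by decide)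
    have hV1 : h1.a V = h.a V := f1.a _ (by decide)
    refine WP.forRange (fun i h' n => n ≤ (i - 1) * (130 * U * (L + 1) + 4) ∧
        Found U R T h' ∧
        (h'.v found = 0 → h1.v found = 0 ∧ ∀ q X Y, (1 ≤ q ∧ q < i) → (1 ≤ X ∧ X ≤ U) →
          (1 ≤ Y ∧ Y ≤ U) → ¬ Covers R T (j, q) (X, Y))) (U + 1)
      (by simp; omega) (by simp) ⟨by simp, hf1.congr (by simp) (by simp) (by simp) (by simp)
        (by simp), ?_⟩ ?_ (by decide) (by omega) ?_ ?_
    · intro h2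
      refine ⟨by simpa using h2, fun q X Y hq => ?_⟩
      simp only [eval_ofNat] at hq
      omega
    · intro i h' n hf _ _ _ _
      have : h'.v .U = U := by rw [hf.v _ (by decide), hC1.vU]
      simp [this]; omega
    · rintro i h2 n2 f2 hi hi' hq ⟨hn2, hf2, hno2⟩
      simp only [eval_ofNat] at hi
      have hp2 : h2.v px = j := by rw [f2.v _ (by decide), hp]
      have hV2 : h2.a V = h.a V := by rw [f2.a _ (by decide), hV1]
      have hcost : (i - 1) * (130 * U * (L + 1) + 4) + (130 * U * (L + 1) + 4) =
          (i + 1 - 1) * (130 * U * (L + 1) + 4) := by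
        obtain ⟨k, rfl⟩ := Nat.exists_eq_add_of_le' hi
        simp only [Nat.add_sub_cancel]
        ring
      obtain ⟨hv1, hv2, hv3⟩ := hV j hj (by omega) i (by omega)
      refine WP.ite (by simp; omega) (fun hc => ?_) (fun hc => ?_)
      · simp only [eval_eq, eval_get₂, eval_var, hp2, hq, hV2, ne_eq, ite_eq_right_iff, one_ne_zero,
          imp_false, not_not] at hc
        have hmeet : Meets R T (j, i) := by
          have := hv2 (by omega)
          rwa [hc] at this
        refine (probe_spec hM (hC1.frame f2 (by decide)) (hG1.frame f2 (by decide))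
          (hT1.frame f2 (by decide)) (by rw [hV2]; exact hV) hf2 hp2 hq hj (by omega) hi
          (by omega) hmeet).mono ?_
        rintro h3 n3 f3 ⟨hf3, hno3, hn3⟩
        refine ⟨by omega, hf3.congr (by simp) (by simp) (by simp) (by simp) (by simp), fun h4 => ?_⟩
        simp only [HState.set_v, reduceCtorEq, if_false] at h4
        obtain ⟨h5, h6⟩ := hno3 h4
        obtain ⟨h7, h8⟩ := hno2 h5
        refine ⟨h7, fun q X Y hq hX hY => ?_⟩
        rcases Nat.lt_succ_iff_lt_or_eq.1 hq.2 with h9 | rfl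
        · exact h8 q X Y ⟨hq.1, h9⟩ hX hY
        · exact h6 X Y hX.1 hX.2 hY.1 hY.2
      · simp only [eval_eq, eval_get₂, eval_var, hp2, hq, hV2, ite_eq_right_iff, one_ne_zero,
          imp_false] at hc
        refine WP.skip ⟨by omega, hf2.congr (by simp) (by simp) (by simp) (by simp) (by simp),
          fun h4 => ?_⟩
        simp only [HState.set_v, reduceCtorEq, if_false] at h4
        obtain ⟨h7, h8⟩ := hno2 h4
        refine ⟨h7, fun q X Y hq hX hY => ?_⟩
        rcases Nat.lt_succ_iff_lt_or_eq.1 hq.2 with h9 | rfl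
        · exact h8 q X Y ⟨hq.1, h9⟩ hX hY
        · intro hcov
          have := hv3 q hi le_rfl (covers_iff.1 hcov).1
          omega
    · rintro h2 n2 f2 - ⟨hn2, hf2, hno2⟩
      refine ⟨?_, hf2.congr (by simp) (by simp) (by simp) (by simp) (by simp), fun h4 => ?_⟩
      · obtain ⟨k, rfl⟩ := Nat.exists_eq_add_of_le' hj
        simp only [Nat.add_sub_cancel] at hn1 hn2 ⊢
        rw [Nat.succ_mul]
        omega
      · simp only [HState.set_v, reduceCtorEq, if_false] at h4
        obtain ⟨h7, h8⟩ := hno2 h4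
        intro p q X Y hp hq hX hY
        rcases Nat.lt_succ_iff_lt_or_eq.1 hp.2 with h9 | rfl
        · exact hno1 h7 p q X Y ⟨hp.1, h9⟩ hq hX hY
        · exact h8 q X Y ⟨hq.1, by omega⟩ hX hY
  · rintro h1 n1 f1 - ⟨hn1, hf1, hno1⟩
    refine ⟨hf1, fun h4 p q X Y hp => hno1 h4 p q X Y ⟨hp.1, by omega⟩, ?_⟩
    rw [Nat.add_sub_cancel] at hn1
    have e : U * (U * (130 * U * (L + 1) + 4) + 4) =
      130 * U ^ 3 * (L + 1) + 4 * U ^ 2 + 4 * U := by ring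
    have e' : 140 * U ^ 3 * (L + 1) = 130 * U ^ 3 * (L + 1) + 10 * U ^ 3 * (L + 1) := by ring
    have e1 : 10 * U ^ 3 * 1 ≤ 10 * U ^ 3 * (L + 1) := Nat.mul_le_mul_left _ (by omega)
    have e2 : U ^ 2 ≤ U ^ 3 := Nat.pow_le_pow_right hU1 (by norm_num)
    have e3 : U ≤ U ^ 3 := Nat.le_self_pow (by norm_num) U
    omega

/-- Decide whether the squared radius in the register `R` suffices. -/
def decideRadius : HProg :=
  found <== 0 ;; arcTable ;; clearReach ;; forbidAll ;; columns ;; search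

theorem decideRadius_spec {M U L R : ℕ} {T : List PointPair} {h : HState}
    (hM : 100 * (U + 2) ^ 4 ≤ M) (hC : Consts U L h) (hT : Tables U T h)
    (hR : h.v Reg.R = R) (hRU : R ≤ 2 * U * U) :
    WP M decideRadius h fun h' n => Found U R T h' ∧
      (h'.v found = 0 → ∀ p q X Y, (1 ≤ p ∧ p ≤ U) → (1 ≤ q ∧ q ≤ U) → (1 ≤ X ∧ X ≤ U) →
        (1 ≤ Y ∧ Y ≤ U) → ¬ Covers R T (p, q) (X, Y)) ∧
      n ≤ 360 * U ^ 3 * (L + 1) := by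
  have hsz := size_bound hM
  have hU1 := hC.U_pos
  have hRU' : R ≤ 2 * U * (2 * U) := hRU.trans (Nat.mul_le_mul_left _ (by omega))
  refine WP.seq (WP.assign (by simp; omega) ?_)
  have f0 : Frame [found] [] h (h.set found (eval h 0)) := (Frame.refl [] [] _).of_set
  refine WP.seq ((arcTable_spec (R := R) hM (hC.frame f0 (by decide)) (by simp [hR]) hRU').mono ?_)
  rintro h1 n1 f1 ⟨hG1, hn1⟩
  have f1' : Frame ([found] ++ arcTable.regs) arcTable.arrs h h1 :=
    (f0.mono (by decide) (by decide)).trans (f1.mono (by decide) (by decide))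
  refine WP.seq ((clearReach_spec hM (hC.frame f1' (by decide))).mono ?_)
  rintro h2 n2 f2 ⟨hr2, hn2⟩
  have f2' : Frame ([found] ++ arcTable.regs ++ clearReach.regs)
      (arcTable.arrs ++ clearReach.arrs) h h2 :=
    (f1'.mono (by decide) (by decide)).trans (f2.mono (by decide) (by decide))
  have hG2 : HasArc U R h2 := hG1.frame f2 (by decide)
  refine WP.seq ((forbidAll_spec hM (hC.frame f2' (by decide)) hG2
    (hT.frame f2' (by decide)) hr2).mono ?_)
  rintro h3 n3 f3 ⟨hr3, hb3, hn3⟩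
  have f3' : Frame ([found] ++ arcTable.regs ++ clearReach.regs ++ forbidAll.regs)
      (arcTable.arrs ++ clearReach.arrs ++ forbidAll.arrs) h h3 :=
    (f2'.mono (by decide) (by decide)).trans (f3.mono (by decide) (by decide))
  have hG3 : HasArc U R h3 := hG2.frame f3 (by decide)
  refine WP.seq ((columns_spec hM (hC.frame f3' (by decide)) hr3 hb3).mono ?_)
  rintro h4 n4 f4 ⟨hV4, hn4⟩
  have f4' : Frame ([found] ++ arcTable.regs ++ clearReach.regs ++ forbidAll.regs ++ columns.regs)
      (arcTable.arrs ++ clearReach.arrs ++ forbidAll.arrs ++ columns.arrs) h h4 :=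
    (f3'.mono (by decide) (by decide)).trans (f4.mono (by decide) (by decide))
  refine (search_spec hM (hC.frame f4' (by decide)) (hG3.frame f4 (by decide))
    (hT.frame f4' (by decide)) hV4 ?_).mono ?_
  · rw [f4.v _ (by decide), f3.v _ (by decide), f2.v _ (by decide), f1.v _ (by decide)]
    simp
  rintro h5 n5 f5 ⟨hf5, hno5, hn5⟩
  refine ⟨hf5, hno5, ?_⟩
  have e : 360 * U ^ 3 * (L + 1) =
    140 * U ^ 3 * (L + 1) + 140 * U ^ 3 * (L + 1) + 80 * U ^ 3 * (L + 1) := by ring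
  have e1 : 80 * U ^ 3 * 1 ≤ 80 * U ^ 3 * (L + 1) := Nat.mul_le_mul_left _ (by omega)
  have e2 : U * U ≤ U ^ 3 := by
    rw [← sq]; exact Nat.pow_le_pow_right hU1 (by norm_num)
  have e3 : U ≤ U ^ 3 := Nat.le_self_pow (by norm_num) U
  omega

/-! ### Binary search for the smallest squared radius -/

/-- The squared radius `2U²` suffices for any two grid centers, so both disks start at `(1, 1)` and
the stored centers always form a cover with the squared radius in `hi`. -/
def binarySearch : HProg :=
  lo <== 0 ;; hi <== 2 * var U * var U ;;
  bx1 <== 1 ;; by1 <== 1 ;; bx2 <== 1 ;; by2 <== 1 ;;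
  .loop (lt (var lo) (var hi))
    (R <== (var lo + var hi) / 2 ;;
      decideRadius ;;
      .ite (var found)
        (hi <== var R ;; bx1 <== var fx1 ;; by1 <== var fy1 ;; bx2 <== var fx2 ;; by2 <== var fy2)
        (lo <== var R + 1))

/-- The registers contain an optimal pair of grid centers. -/
def Optimal (U : ℕ) (T : List PointPair) (h : HState) : Prop :=
  Covers (h.v hi) T (h.v bx1, h.v by1) (h.v bx2, h.v by2) ∧
  ∀ R < h.v hi, ∀ p q X Y, (1 ≤ p ∧ p ≤ U) → (1 ≤ q ∧ q ≤ U) → (1 ≤ X ∧ X ≤ U) →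
    (1 ≤ Y ∧ Y ≤ U) → ¬ Covers R T (p, q) (X, Y)

theorem near_of_le {U : ℕ} {p c : ℕ × ℕ} (hp : (1 ≤ p.1 ∧ p.1 ≤ U) ∧ 1 ≤ p.2 ∧ p.2 ≤ U)
    (hc : (1 ≤ c.1 ∧ c.1 ≤ U) ∧ 1 ≤ c.2 ∧ c.2 ≤ U) : Near (2 * U * U) p c := by
  unfold Near
  have h1 : ((p.1 : ℤ) - c.1) ^ 2 ≤ (U : ℤ) ^ 2 := sq_le_sq' (by omega) (by omega)
  have h2 : ((p.2 : ℤ) - c.2) ^ 2 ≤ (U : ℤ) ^ 2 := sq_le_sq' (by omega) (by omega)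
  push_cast
  linarith

theorem Covers.mono {R R' : ℕ} {T : List PointPair} {c₁ c₂ : ℕ × ℕ} (h : Covers R T c₁ c₂)
    (hR : R ≤ R') : Covers R' T c₁ c₂ := by
  have hn : ∀ p c, Near R p c → Near R' p c := fun p c h => by
    unfold Near at h ⊢
    exact h.trans (by exact_mod_cast hR)
  intro p hp
  exact (h p hp).imp (fun h => ⟨hn _ _ h.1, hn _ _ h.2⟩) (fun h => ⟨hn _ _ h.1, hn _ _ h.2⟩)

theorem binarySearch_spec {M U L : ℕ} {T : List PointPair} {h : HState}
    (hM : 100 * (U + 2) ^ 4 ≤ M) (hC : Consts U L h) (hT : Tables U T h) :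
    WP M binarySearch h fun h' n => Optimal U T h' ∧
      n ≤ 7 + (2 * L + 1) * (360 * U ^ 3 * (L + 1) + 8) := by
  have hsz := size_bound hM
  have hU1 := hC.U_pos
  have hUU : 2 * U * U ≤ 2 * U * (2 * U) := Nat.mul_le_mul_left _ (by omega)
  refine WP.seq (WP.assign (by simp; omega) (WP.seq (WP.assign (by simp [hC.vU]; omega) ?_)))
  refine WP.seq (WP.assign (by simp; omega) (WP.seq (WP.assign (by simp; omega) ?_)))
  refine WP.seq (WP.assign (by simp; omega) (WP.seq (WP.assign (by simp; omega) ?_)))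
  simp only [eval_ofNat, eval_mul, eval_var, HState.set_v, reduceCtorEq, if_false, hC.vU]
  -- The squared radius `hi` is feasible, everything below `lo` is infeasible, and `k` bounds the
  -- remaining rounds because the gap stays below `2 ^ k`.
  refine WP.loop (fun h' n => h'.v lo ≤ h'.v hi ∧ h'.v hi ≤ 2 * U * U ∧
      Covers (h'.v hi) T (h'.v bx1, h'.v by1) (h'.v bx2, h'.v by2) ∧
      (∀ R < h'.v lo, ∀ p q X Y, (1 ≤ p ∧ p ≤ U) → (1 ≤ q ∧ q ≤ U) → (1 ≤ X ∧ X ≤ U) →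
        (1 ≤ Y ∧ Y ≤ U) → ¬ Covers R T (p, q) (X, Y)) ∧
      ∃ k, h'.v hi - h'.v lo < 2 ^ k ∧
        n + k * (360 * U ^ 3 * (L + 1) + 8) ≤ (2 * L + 1) * (360 * U ^ 3 * (L + 1) + 8))
    (fun h' => h'.v hi - h'.v lo) ⟨by simp, by simp, ?_, by simp, 2 * L + 1, ?_, by simp⟩ ?_
  · simp only [HState.set_v, reduceCtorEq, if_false, if_true]
    intro p hp
    exact Or.inl ⟨near_of_le (hT.inGrid p hp).1 ⟨⟨le_rfl, hU1⟩, le_rfl, hU1⟩,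
      near_of_le (hT.inGrid p hp).2 ⟨⟨le_rfl, hU1⟩, le_rfl, hU1⟩⟩
  · simp only [HState.set_v, reduceCtorEq, if_false, if_true, Nat.sub_zero]
    have := hC.lt_pow
    calc 2 * U * U < 2 * 2 ^ L * 2 ^ L := by
          rw [mul_assoc, mul_assoc]
          exact Nat.mul_lt_mul_of_pos_left (Nat.mul_self_lt_mul_self this) (by norm_num)
      _ = 2 ^ (2 * L + 1) := by ring
  · rintro h1 n1 f1 ⟨hlh, hhU, hcov, hno, k, hk, hn1⟩
    refine ⟨by simp, fun hc => ?_, fun hc => ?_⟩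
    · have hlt : ¬ h1.v lo < h1.v hi := fun hn => by simp [hn] at hc
      refine ⟨⟨hcov, fun R hR => hno R (by omega)⟩, ?_⟩
      have := Nat.zero_le (k * (360 * U ^ 3 * (L + 1) + 8))
      omega
    · have hlt : h1.v lo < h1.v hi := by
        by_contra hn
        simp [hn] at hc
      have f1' := f1.of_set.of_set.of_set.of_set.of_set.of_set
      have hC1 : Consts U L h1 := hC.frame f1' (by decide)
      have hT1 : Tables U T h1 := hT.frame f1' (by decide)
      obtain ⟨k', rfl⟩ : ∃ k', k = k' + 1 := by
        refine Nat.exists_eq_succ_of_ne_zero ?_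
        rintro rfl
        simp only [pow_zero] at hk
        omega
      rw [pow_succ] at hk
      rw [Nat.succ_mul] at hn1
      refine WP.seq (WP.assign (by simp; omega) ?_)
      simp only [eval_add, eval_div, eval_var, eval_ofNat]
      obtain ⟨r, hr⟩ : ∃ r, (h1.v lo + h1.v hi) / 2 = r := ⟨_, rfl⟩
      rw [hr]
      have f2 : Frame [Reg.R] [] h1 (h1.set Reg.R r) := (Frame.refl [] [] _).of_set
      refine WP.seq ((decideRadius_spec (R := r) hM (hC1.frame f2 (by decide))
        (hT1.frame f2 (by decide)) (by simp) (by omega)).mono ?_)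
      rintro h3 n3 f3 ⟨hf3, hno3, hn3⟩
      have hlo3 : h3.v lo = h1.v lo := by rw [f3.v _ (by decide)]; simp
      have hhi3 : h3.v hi = h1.v hi := by rw [f3.v _ (by decide)]; simp
      have hR3 : h3.v Reg.R = r := by rw [f3.v _ (by decide)]; simp
      have hx1 : h3.v bx1 = h1.v bx1 := by rw [f3.v _ (by decide)]; simp
      have hy1 : h3.v by1 = h1.v by1 := by rw [f3.v _ (by decide)]; simp
      have hx2 : h3.v bx2 = h1.v bx2 := by rw [f3.v _ (by decide)]; simp
      have hy2 : h3.v by2 = h1.v by2 := by rw [f3.v _ (by decide)]; simp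
      refine WP.ite (by simp) (fun hc => ?_) (fun hc => ?_)
      · have hF := hf3 hc
        refine WP.seq (WP.assign (by simp) (WP.seq (WP.assign (by simp) (WP.seq
          (WP.assign (by simp) (WP.seq (WP.assign (by simp) (WP.assign (by simp) ?_))))))))
        simp only [HState.set_v, eval_var, reduceCtorEq, if_false, if_true, hlo3, hR3]
        exact ⟨⟨by omega, by omega, hF.2, hno, k', by omega, by omega⟩, by omega⟩
      · refine WP.assign (by simp [hR3]; omega) ?_
        simp only [HState.set_v, eval_var, eval_add, eval_ofNat, reduceCtorEq, if_false, if_true,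
          hhi3, hR3, hx1, hy1, hx2, hy2]
        refine ⟨⟨by omega, by omega, hcov, fun R hR p q X Y hp hq hX hY hcv => ?_, k', by omega,
          by omega⟩, by omega⟩
        -- Enlarging the radius preserves covers, so infeasibility of the tested radius passes to
        -- all smaller ones.
        exact hno3 hc p q X Y hp hq hX hY (Covers.mono hcv (by omega))

/-! ### Reading the input -/

/-- Register `q = (c, d')` as a partner of `p = (a, b)`. -/
def link (a b c d' : Reg) : HProg :=
  .put (Q false) (var a) (var b) (var c)
    (max (.get (Q false) (var a) (var b) (var c)) (var d')) ;;
  .put (Q true) (var a) (var b) (var c)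
    (max (.get (Q true) (var a) (var b) (var c)) (var U + 1 - var d'))

theorem isTop_flip_insert {U : ℕ} {P : ℕ → ℕ → Prop} {b : Bool} {f f' : ℕ → ℕ} {x₀ y₀ : ℕ}
    (hf : IsTop U (flip U b P) f) (hy : 1 ≤ y₀) (hyU : y₀ ≤ U)
    (hf' : ∀ x, f' x = if x = x₀ then Max.max (f x₀) (flipY U b y₀) else f x) :
    IsTop U (flip U b fun x y => P x y ∨ x = x₀ ∧ y = y₀) f' := by
  intro x hx hx'
  obtain ⟨h1, h2⟩ := hf x hx hx'
  rw [hf']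
  cases b
  · simp only [GridDisk.flip, flipY] at h1 h2 ⊢
    split_ifs with hc
    · subst hc
      refine ⟨fun y hy' => ?_, fun h0 => ?_⟩
      · rcases hy' with h3 | ⟨-, rfl⟩
        · exact (h1 y h3).trans (le_max_left _ _)
        · exact le_max_right _ _
      · rcases le_total (f x) y₀ with h3 | h3
        · rw [max_eq_right h3]; exact Or.inr ⟨rfl, rfl⟩
        · rw [max_eq_left h3]; exact Or.inl (h2 (by omega))
    · exact ⟨fun y hy' => h1 y (hy'.resolve_right fun h => hc h.1), fun h0 => Or.inl (h2 h0)⟩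
  · simp only [GridDisk.flip, flipY, mirror] at h1 h2 ⊢
    split_ifs with hc
    · subst hc
      refine ⟨fun y hy' => ?_, fun h0 => ?_⟩
      · obtain ⟨i1, i2, h3 | ⟨-, h3⟩⟩ := hy'
        · exact (h1 y ⟨i1, i2, h3⟩).trans (le_max_left _ _)
        · exact le_max_of_le_right (by omega)
      · rcases le_total (f x) (U + 1 - y₀) with h3 | h3
        · rw [max_eq_right h3]
          exact ⟨by omega, by omega, Or.inr ⟨rfl, by omega⟩⟩
        · rw [max_eq_left h3]
          obtain ⟨i1, i2, i3⟩ := h2 (by omega)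
          exact ⟨i1, i2, Or.inl i3⟩
    · refine ⟨fun y hy' => h1 y ⟨hy'.1, hy'.2.1, hy'.2.2.resolve_right fun h => hc h.1⟩,
        fun h0 => ?_⟩
      obtain ⟨i1, i2, i3⟩ := h2 h0
      exact ⟨i1, i2, Or.inl i3⟩

theorem link_spec {M U : ℕ} {h : HState} (hM : 100 * (U + 2) ^ 4 ≤ M) (hU : h.v Reg.U = U)
    {A : ℕ × ℕ → ℕ → ℕ → Prop} (hA : ∀ p, InBox U (A p))
    (hQ : ∀ b i j, IsTop U (flip U b (A (i, j))) (h.a (Q b) i j)) {a b c d' : Reg}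
    (hc : 1 ≤ h.v c) (hcU : h.v c ≤ U) (hd : 1 ≤ h.v d') (hdU : h.v d' ≤ U) :
    WP M (link a b c d') h fun h' n =>
      (∀ e i j, IsTop U (flip U e fun x y => A (i, j) x y ∨
        ((i, j) = (h.v a, h.v b) ∧ (x, y) = (h.v c, h.v d'))) (h'.a (Q e) i j)) ∧ n = 2 := by
  have hsz := size_bound hM
  have hle : ∀ e, h.a (Q e) (h.v a) (h.v b) (h.v c) ≤ U := fun e =>
    (hQ e _ _).le (flip_inBox (hA _) e) hc hcU
  have h0 := hle false
  have h1 := hle true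
  refine WP.seq (WP.put (by simp) (by simp) (by simp) (by simp; omega) (WP.put (by simp) (by simp)
    (by simp) (by simp [hU]; omega) ⟨fun e i j => ?_, rfl⟩))
  by_cases hij : (i, j) = (h.v a, h.v b)
  · obtain ⟨rfl, rfl⟩ := Prod.mk.inj hij
    have := isTop_flip_insert (x₀ := h.v c) (y₀ := h.v d') (f' := fun x => if x = h.v c then
      Max.max (h.a (Q e) (h.v a) (h.v b) (h.v c)) (flipY U e (h.v d'))
        else h.a (Q e) (h.v a) (h.v b) x) (hQ e (h.v a) (h.v b)) hd hdU (fun _ => rfl)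
    have h2 : (fun x y => A (h.v a, h.v b) x y ∨ (h.v a, h.v b) = (h.v a, h.v b) ∧
        (x, y) = (h.v c, h.v d')) = fun x y => A (h.v a, h.v b) x y ∨ x = h.v c ∧ y = h.v d' := by
      funext x y; simp
    rw [h2]
    convert this using 1
    funext x
    cases e <;> simp [flipY, hU]
  · have h2 : (fun x y => A (i, j) x y ∨ (i, j) = (h.v a, h.v b) ∧ (x, y) = (h.v c, h.v d')) =
        A (i, j) := by
      funext x y; simp only [hij, false_and, or_false]
    rw [h2]
    convert hQ e i j using 1
    have hij' : ¬ (i = h.v a ∧ j = h.v b) := fun h => hij (by rw [h.1, h.2])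
    funext x
    simp only [HState.put_a, eval_var, HState.put_v]
    rw [if_neg (by tauto), if_neg (by tauto)]

def readInput : HProg :=
  .forRange i 0 (var m)
    (px <== .input (4 * var i) ;;
      py <== .input (4 * var i + 1) ;;
      qx <== .input (4 * var i + 2) ;;
      qy <== .input (4 * var i + 3) ;;
      link px py qx qy ;;
      link qx qy px py ;;
      put₂ S (var px) (var py) 1 ;;
      put₂ S (var qx) (var qy) 1)

theorem length_flatMap_coords (T : List PointPair) :
    (T.flatMap PointPair.coords).length = 4 * T.length := by
  induction T with
  | nil => rfl
  | cons p T ih => simp only [List.flatMap_cons, List.length_append, ih, List.length_cons]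
                   simp only [PointPair.coords, List.length_cons, List.length_nil]; ring

theorem getD_flatMap_coords (T : List PointPair) {i : ℕ} (hi : i < T.length) {k : ℕ} (hk : k < 4) :
    (T.flatMap PointPair.coords).getD (4 * i + k) 0 = (PointPair.coords T[i]).getD k 0 := by
  induction T generalizing i with
  | nil => simp at hi
  | cons p T ih =>
    have hl : (PointPair.coords p).length = 4 := rfl
    rw [List.flatMap_cons]
    cases i with
    | zero =>
      rw [List.getD_append _ _ _ _ (by omega)]
      simp
    | succ i =>
      rw [List.getD_append_right _ _ _ _ (by omega), hl,
        show 4 * (i + 1) + k - 4 = 4 * i + k by omega]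
      simpa using ih (by simpa using hi)

theorem adj_append_singleton {T : List PointPair} {p : PointPair} {q : ℕ × ℕ} {x y : ℕ} :
    Adj (T ++ [p]) q x y ↔ (Adj T q x y ∨ q = p.1 ∧ (x, y) = p.2) ∨ q = p.2 ∧ (x, y) = p.1 := by
  obtain ⟨p1, p2⟩ := p
  simp only [Adj, List.mem_append, List.mem_singleton, Prod.mk.injEq]
  tauto

theorem pts_append_singleton {T : List PointPair} {p : PointPair} {x y : ℕ} :
    Pts (T ++ [p]) x y ↔ Pts T x y ∨ p.1 = (x, y) ∨ p.2 = (x, y) := by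
  simp only [Pts, List.mem_append, List.mem_singleton, or_and_right, exists_or, exists_eq_left]

/-- The tables of tops start out right for the empty list because memory is initially zero, and zero
encodes a column without partners. Each pair is inserted in both directions at constant cost, by
taking maxima. -/
theorem readInput_spec {M U : ℕ} {T : List PointPair} {h : HState} (hM : 100 * (U + 2) ^ 4 ≤ M)
    (hm : 4 * T.length + 10 ≤ M) (hT : ∀ p ∈ T, p.InGrid U) (hU : h.v Reg.U = U)
    (hvm : h.v m = T.length) (hinp : h.inp = T.flatMap PointPair.coords)
    (ha : ∀ k i j l, h.a k i j l = 0) :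
    WP M readInput h fun h' n =>
      (∀ b i j, IsTop U (flip U b (Adj T (i, j))) (h'.a (Q b) i j)) ∧
      (∀ x y, h'.a S x y 0 ≠ 0 ↔ Pts T x y) ∧ n ≤ 12 * T.length + 2 := by
  have hsz := size_bound hM
  refine WP.forRange (fun j h' n => n ≤ 12 * j ∧
      (∀ b i k, IsTop U (flip U b (Adj (T.take j) (i, k))) (h'.a (Q b) i k)) ∧
      (∀ x y, h'.a S x y 0 ≠ 0 ↔ Pts (T.take j) x y)) T.length
    (by simp; omega) (by simp) ⟨by simp, ?_, ?_⟩ ?_ (by decide) (by omega) ?_ ?_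
  · intro b i k x hx hx'
    simp only [eval_ofNat, List.take_zero, HState.set_a, ha]
    refine ⟨fun y hy => ?_, fun h0 => absurd rfl h0⟩
    cases b <;> simp [GridDisk.flip, mirror, Adj] at hy
  · intro x y
    simp [ha, Pts]
  · intro j h' n hf _ _ _ _
    have : h'.v m = T.length := by rw [hf.v _ (by decide), hvm]
    simp [this]
  · rintro j h1 n1 f1 - hj hx ⟨hn1, hQ1, hS1⟩
    have hU1 : h1.v Reg.U = U := by rw [f1.v _ (by decide), hU]
    have hi1 : h1.inp = T.flatMap PointPair.coords := by rw [f1.inp, hinp]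
    have hlen : h1.inp.length = 4 * T.length := by rw [hi1, length_flatMap_coords]
    have hget : ∀ k < 4, h1.inp.getD (4 * j + k) 0 = (PointPair.coords T[j]).getD k 0 := by
      intro k hk
      rw [hi1, getD_flatMap_coords T hj hk]
    have g0 : h1.inp.getD (4 * j) 0 = T[j].1.1 := hget 0 (by norm_num)
    have g1 : h1.inp.getD (4 * j + 1) 0 = T[j].1.2 := hget 1 (by norm_num)
    have g2 : h1.inp.getD (4 * j + 2) 0 = T[j].2.1 := hget 2 (by norm_num)
    have g3 : h1.inp.getD (4 * j + 3) 0 = T[j].2.2 := hget 3 (by norm_num)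
    have hgrid := hT T[j] (List.getElem_mem hj)
    have htake : T.take (j + 1) = T.take j ++ [T[j]] := by
      rw [List.take_append_getElem hj]
    generalize T[j] = p at *
    obtain ⟨⟨hp1, hp2⟩, hp3, hp4⟩ := hgrid
    simp only [Set.mem_Icc] at hp1 hp2 hp3 hp4
    refine WP.seq (WP.assign (by simp [hx, hlen]; omega) (WP.seq (WP.assign
      (by simp [hx, hlen]; omega) (WP.seq (WP.assign (by simp [hx, hlen]; omega) (WP.seq
      (WP.assign (by simp [hx, hlen]; omega) ?_)))))))
    simp only [eval_input, eval_add, eval_mul, eval_var, eval_ofNat, HState.set_v, HState.set_inp,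
      reduceCtorEq, if_false, hx, g0, g1, g2, g3]
    set h2 := (((h1.set px p.1.1).set py p.1.2).set qx p.2.1).set qy p.2.2 with h2_def
    have hv0 : h2.v px = p.1.1 := by simp [h2_def]
    have hv1 : h2.v py = p.1.2 := by simp [h2_def]
    have hv2 : h2.v qx = p.2.1 := by simp [h2_def]
    have hv3 : h2.v qy = p.2.2 := by simp [h2_def]
    have hvU : h2.v Reg.U = U := by simp [h2_def, hU1]
    have ha2 : h2.a = h1.a := rfl
    clear_value h2
    have hbox : ∀ q, InBox U (Adj (T.take j) q) :=
      adj_inBox fun p hp => hT p (List.mem_of_mem_take hp)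
    refine WP.seq ((link_spec hM hvU hbox (by rw [ha2]; exact hQ1) (by omega) (by omega) (by omega)
      (by omega)).mono ?_)
    rintro h3 n3 f3 ⟨hQ3, hn3⟩
    have hv0' : h3.v px = p.1.1 := by rw [f3.v _ (by decide), hv0]
    have hv1' : h3.v py = p.1.2 := by rw [f3.v _ (by decide), hv1]
    have hv2' : h3.v qx = p.2.1 := by rw [f3.v _ (by decide), hv2]
    have hv3' : h3.v qy = p.2.2 := by rw [f3.v _ (by decide), hv3]
    rw [hv0, hv1, hv2, hv3] at hQ3
    refine WP.seq ((link_spec (A := fun q x y => Adj (T.take j) q x y ∨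
      (q = (p.1.1, p.1.2) ∧ (x, y) = (p.2.1, p.2.2))) hM (by rw [f3.v _ (by decide), hvU])
      ?_ hQ3 (by omega) (by omega) (by omega) (by omega)).mono ?_)
    · rintro q x y (hxy | ⟨-, hxy⟩)
      · exact hbox q x y hxy
      · obtain ⟨rfl, rfl⟩ := Prod.mk.inj hxy
        exact ⟨hp3, hp4⟩
    rintro h4 n4 f4 ⟨hQ4, hn4⟩
    rw [hv0', hv1', hv2', hv3'] at hQ4
    have hv0'' : h4.v px = p.1.1 := by rw [f4.v _ (by decide), hv0']
    have hv1'' : h4.v py = p.1.2 := by rw [f4.v _ (by decide), hv1']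
    have hv2'' : h4.v qx = p.2.1 := by rw [f4.v _ (by decide), hv2']
    have hv3'' : h4.v qy = p.2.2 := by rw [f4.v _ (by decide), hv3']
    have hS4 : h4.a S = h1.a S := by rw [f4.a _ (by decide), f3.a _ (by decide), ha2]
    refine WP.seq (WP.put₂ (by simp) (by simp) (by simp; omega) (by omega) (WP.put₂ (by simp)
      (by simp) (by simp; omega) (by omega) ⟨by omega, fun b i k => ?_, fun x y => ?_⟩))
    · have : ∀ b, (((h4.put S (eval h4 (var px)) (eval h4 (var py)) 0 (eval h4 1)).put S
          (eval (h4.put S (eval h4 (var px)) (eval h4 (var py)) 0 (eval h4 1)) (var qx))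
          (eval (h4.put S (eval h4 (var px)) (eval h4 (var py)) 0 (eval h4 1)) (var qy)) 0
          (eval (h4.put S (eval h4 (var px)) (eval h4 (var py)) 0 (eval h4 1)) 1)).set Reg.i
            (j + 1)).a (Q b) i k = h4.a (Q b) i k := by
        intro b; funext l; simp
      rw [this]
      convert hQ4 b i k using 4
      rw [htake]
      exact adj_append_singleton
    · simp only [HState.set_a, HState.put_a, HState.put_v, eval_var, eval_ofNat, hv0'', hv1'',
        hv2'', hv3'', hS4, true_and, and_true]
      rw [htake, pts_append_singleton, ← hS1]
      split_ifs with c1 c2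
      · exact iff_of_true one_ne_zero (Or.inr (Or.inr (by rw [c1.1, c1.2])))
      · exact iff_of_true one_ne_zero (Or.inr (Or.inl (by rw [c2.1, c2.2])))
      · refine (or_iff_left ?_).symm
        rintro (h | h)
        · exact c2 ⟨by rw [h], by rw [h]⟩
        · exact c1 ⟨by rw [h], by rw [h]⟩
  · rintro h1 n1 f1 - ⟨hn1, hQ1, hS1⟩
    rw [List.take_length] at hQ1 hS1
    exact ⟨hQ1, hS1, by omega⟩

end Structured

namespace Structured

open GridDisk HExpr IB2C

open Reg Arr

/-! ### Precomputation -/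

/-- Tabulate the largest height of an input point below each cell. -/
def prevTables : HProg :=
  .forRange vx 1 (var U + 1) (.forRange vy 1 (var U + 1)
    (.ite (get₂ S (var vx) (var vy))
        (put₂ (P false) (var vx) (var vy) (var vy))
        (put₂ (P false) (var vx) (var vy) (get₂ (P false) (var vx) (var vy - 1))) ;;
      .ite (get₂ S (var vx) (var U + 1 - var vy))
        (put₂ (P true) (var vx) (var vy) (var vy))
        (put₂ (P true) (var vx) (var vy) (get₂ (P true) (var vx) (var vy - 1)))))

/-- One step of the tabulation of `IsPrev`. -/
theorem prevStep_spec {M : ℕ} {h : HState} {b : Bool} {e : HExpr} {S' : ℕ → Prop} {x y : ℕ}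
    (hx : h.v vx = x) (hy : h.v vy = y + 1) (hM : y + 1 < M)
    (he : e.Fits M h) (heS : e.eval h ≠ 0 ↔ S' (y + 1)) (hp : IsPrev S' y (h.a (P b) x y 0)) :
    WP M (.ite e (put₂ (P b) (var vx) (var vy) (var vy))
        (put₂ (P b) (var vx) (var vy) (get₂ (P b) (var vx) (var vy - 1)))) h fun h' n =>
      IsPrev S' (y + 1) (h'.a (P b) x (y + 1) 0) ∧
      (∀ x' y', (x', y') ≠ (x, y + 1) → h'.a (P b) x' y' 0 = h.a (P b) x' y' 0) ∧ n = 2 := by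
  have hne : ∀ {x' y'}, (x', y') ≠ (x, y + 1) → ¬ (x' = x ∧ y' = y + 1) := fun h1 h2 =>
    h1 (by rw [h2.1, h2.2])
  refine WP.ite he (fun hc => WP.put₂ (by simp) (by simp) (by simp) (by omega) ⟨?_, ?_, rfl⟩)
    (fun hc => WP.put₂ (by simp) (by simp) (by simp; omega) (by omega) ⟨?_, ?_, rfl⟩)
  · simp only [HState.put_a, eval_var, hx, hy, and_self, if_true]
    exact IsPrev.succ_of_mem (heS.1 hc)
  · intro x' y' h1
    simp only [HState.put_a, eval_var, hx, hy, true_and, and_true, if_neg (hne h1)]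
  · simp only [HState.put_a, eval_var, eval_get₂, eval_sub, eval_ofNat, hx, hy, and_self, if_true,
      Nat.add_sub_cancel]
    exact hp.succ_of_notMem fun h1 => heS.2 h1 hc
  · intro x' y' h1
    simp only [HState.put_a, eval_var, hx, hy, true_and, and_true, if_neg (hne h1)]

theorem prevTables_spec {M U : ℕ} {S' : ℕ → ℕ → Prop} {h : HState}
    (hM : 100 * (U + 2) ^ 4 ≤ M) (hU : h.v Reg.U = U)
    (hS : ∀ x y, h.a S x y 0 ≠ 0 ↔ S' x y) (h0 : ∀ b x, h.a (P b) x 0 0 = 0) :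
    WP M prevTables h fun h' n =>
      (∀ b x, 1 ≤ x → x ≤ U → ∀ y ≤ U, IsPrev (flip U b S' x) y (h'.a (P b) x y 0)) ∧
      n ≤ U * (6 * U + 4) + 2 := by
  have hsz := size_bound hM
  refine WP.forRange (fun j h' n => n ≤ (j - 1) * (6 * U + 4) ∧ (∀ b x, h'.a (P b) x 0 0 = 0) ∧
      ∀ b x, 1 ≤ x → x < j → ∀ y ≤ U, IsPrev (flip U b S' x) y (h'.a (P b) x y 0)) (U + 1)
    (by simp; omega) (by simp) ⟨by simp, h0, fun b x hx hx' => by simp at hx'; omega⟩ ?_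
    (by decide) (by omega) ?_ ?_
  · intro j h' n hf _ _ _ _
    have : h'.v .U = U := by rw [hf.v _ (by decide), hU]
    simp [this]; omega
  · rintro x h1 n1 f1 hx hx' hvx ⟨hn1, h01, hp1⟩
    simp only [eval_ofNat] at hx
    have hU1 : h1.v Reg.U = U := by rw [f1.v _ (by decide), hU]
    have hS1 : h1.a S = h.a S := f1.a _ (by decide)
    refine WP.forRange (fun i h' n => n ≤ 6 * (i - 1) ∧ (∀ b x, h'.a (P b) x 0 0 = 0) ∧
        (∀ b x', 1 ≤ x' → x' < x → ∀ y ≤ U, IsPrev (flip U b S' x') y (h'.a (P b) x' y 0)) ∧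
        ∀ b, ∀ y < i, IsPrev (flip U b S' x) y (h'.a (P b) x y 0)) (U + 1)
      (by simp; omega) (by simp) ⟨by simp, h01, hp1, fun b y hy => ?_⟩ ?_
      (by decide) (by omega) ?_ ?_
    · obtain rfl : y = 0 := by simpa using hy
      simp only [HState.set_a, h01]
      exact IsPrev.zero _
    · intro i h' n hf _ _ _ _
      have : h'.v .U = U := by rw [hf.v _ (by decide), hU1]
      simp [this]; omega
    · rintro i h2 n2 f2 hi hi' hvy ⟨hn2, h02, hp2, hq2⟩
      simp only [eval_ofNat] at hi
      obtain ⟨y, rfl⟩ := Nat.exists_eq_add_of_le' hi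
      have hvx2 : h2.v vx = x := by rw [f2.v _ (by decide), hvx]
      have hU2 : h2.v Reg.U = U := by rw [f2.v _ (by decide), hU1]
      have hS2 : h2.a S = h.a S := by rw [f2.a _ (by decide), hS1]
      refine WP.seq ((prevStep_spec (S' := S' x) hvx2 hvy (by omega) (by simp; omega)
        (by simp only [eval_get₂, eval_var, hvx2, hvy, hS2, hS]) (hq2 false y (by omega))).mono ?_)
      rintro h3 n3 f3 ⟨hp3, hq3, hn3⟩
      have hvx3 : h3.v vx = x := by rw [f3.v _ (by decide), hvx2]
      have hvy3 : h3.v vy = y + 1 := by rw [f3.v _ (by decide), hvy]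
      have hU3 : h3.v Reg.U = U := by rw [f3.v _ (by decide), hU2]
      have hS3 : h3.a S = h.a S := by rw [f3.a _ (by decide), hS2]
      have hP3 : h3.a (P true) = h2.a (P true) := f3.a _ (by decide)
      refine (prevStep_spec (S' := mirror U S' x) hvx3 hvy3 (by omega)
        (by simp [hU3]; omega) ?_ (by rw [hP3]; exact hq2 true y (by omega))).mono ?_
      · simp only [eval_get₂, eval_sub, eval_add, eval_ofNat, eval_var, hvx3, hvy3, hU3, hS3, hS,
          mirror]
        exact ⟨fun h => ⟨by omega, by omega, h⟩, fun h => h.2.2⟩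
      rintro h4 n4 f4 ⟨hp4, hq4, hn4⟩
      have hP4 : h4.a (P false) = h3.a (P false) := f4.a _ (by decide)
      have hkeep : ∀ b x' y', (x', y') ≠ (x, y + 1) → h4.a (P b) x' y' 0 = h2.a (P b) x' y' 0 := by
        rintro (_ | _) x' y' hne
        · rw [hP4, hq3 _ _ hne]
        · rw [hq4 _ _ hne, hP3]
      refine ⟨by omega, fun b x' => ?_, fun b x' h1 h2 y' hy' => ?_, fun b y' hy' => ?_⟩
      · rw [HState.set_a, hkeep _ _ _ (by simp), h02]
      · rw [HState.set_a, hkeep _ _ _ (by simp; omega)]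
        exact hp2 b x' h1 h2 y' hy'
      · rw [HState.set_a]
        rcases Nat.lt_succ_iff_lt_or_eq.1 hy' with h1 | rfl
        · rw [hkeep _ _ _ (by simp; omega)]
          exact hq2 b y' h1
        · cases b
          · rw [hP4]; exact hp3
          · exact hp4
    · rintro h2 n2 f2 - ⟨hn2, h02, hp2, hq2⟩
      refine ⟨?_, h02, fun b x' h1 h2 y hy => ?_⟩
      · obtain ⟨k, rfl⟩ := Nat.exists_eq_add_of_le' hx
        simp only [Nat.add_sub_cancel] at hn1 hn2 ⊢
        rw [Nat.succ_mul]
        omega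
      · rcases Nat.lt_succ_iff_lt_or_eq.1 h2 with h3 | rfl
        · exact hp2 b x' h1 h3 y hy
        · exact hq2 b y (by omega)
  · rintro h1 n1 f1 - ⟨hn1, -, hp1⟩
    rw [Nat.add_sub_cancel] at hn1
    exact ⟨fun b x h1 h2 => hp1 b x h1 (by omega), by omega⟩

/-- Compute the constants that depend on `U` only. -/
def init : HProg :=
  N <== 2 * var U ;; N2 <== var N * var N ;; OFF <== var N2 * var N2 ;; K <== 1 ;;
    .loop (lt (var K) (var U + 1)) (K <== 2 * var K)

theorem init_spec {M U : ℕ} {h : HState} (hM : 100 * (U + 2) ^ 4 ≤ M) (hU : h.v Reg.U = U)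
    (hpos : 1 ≤ U) :
    WP M init h fun h' n => Consts U (Nat.log 2 U + 1) h' ∧ n ≤ 2 * Nat.log 2 U + 7 := by
  have hsz := size_bound hM
  have hlog : 2 ^ Nat.log 2 U ≤ U := Nat.pow_log_le_self 2 (by omega)
  have hlog' : U < 2 ^ (Nat.log 2 U + 1) := Nat.lt_pow_succ_log_self (by norm_num) U
  have e1 : U ≤ 2 * U * U := by nlinarith
  refine WP.seq (WP.assign (by simp [hU]; omega) (WP.seq (WP.assign (by simp [hU]; omega)
    (WP.seq (WP.assign (by simp [hU]; omega) (WP.seq (WP.assign (by simp; omega) ?_)))))))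
  simp only [eval_ofNat, eval_mul, eval_var, HState.set_v, reduceCtorEq, if_false, if_true, hU]
  refine WP.loop (fun h' n => ∃ k ≤ Nat.log 2 U + 1, n = 2 * k ∧ h'.v K = 2 ^ k)
    (fun h' => U + 1 - h'.v K) ⟨0, by omega, rfl, by simp⟩ ?_
  rintro h1 n1 f1 ⟨k, hk, hn1, hK⟩
  have vU : h1.v Reg.U = U := by rw [f1.v _ (by decide)]; simp [hU]
  have hkk : 2 ^ k ≤ 2 ^ (Nat.log 2 U + 1) := Nat.pow_le_pow_right (by norm_num) hk
  rw [pow_succ] at hkk hlog'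
  refine ⟨by simp [vU]; omega, fun hc => ?_, fun hc => ?_⟩
  · have hle : ¬ 2 ^ k < U + 1 := fun hn => by simp [hK, vU, hn] at hc
    obtain rfl : k = Nat.log 2 U + 1 := by
      by_contra hne
      have : 2 ^ k ≤ 2 ^ Nat.log 2 U := Nat.pow_le_pow_right (by norm_num) (by omega)
      omega
    refine ⟨⟨hpos, vU, ?_, ?_, ?_, hK, by omega, by rw [pow_succ]; omega⟩, by omega⟩
    · rw [f1.v _ (by decide)]; simp
    · rw [f1.v _ (by decide)]; simp
    · rw [f1.v _ (by decide)]; simp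
  · have hlt : 2 ^ k < U + 1 := by
      by_contra hn
      simp [hK, vU, hn] at hc
    have hk' : k + 1 ≤ Nat.log 2 U + 1 := by
      by_contra hne
      obtain rfl : k = Nat.log 2 U + 1 := by omega
      rw [pow_succ] at hlt
      omega
    refine WP.assign (by simp [hK]; omega) ⟨⟨k + 1, hk', by omega, ?_⟩, ?_⟩
    · simp [hK, pow_succ, mul_comm]
    · have : 0 < 2 ^ k := Nat.two_pow_pos k
      simp [hK]; omega

/-- For `U = 0` the list of pairs is empty and the zero registers already describe an optimal
solution. -/
def main : HProg :=
  .ite (var U) (init ;; readInput ;; prevTables ;; binarySearch) .skip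

theorem main_spec {M U : ℕ} {T : List PointPair} {h : HState} (hM : 100 * (U + 2) ^ 4 ≤ M)
    (hm : 4 * T.length + 10 ≤ M) (hT : ∀ p ∈ T, p.InGrid U) (hU : h.v Reg.U = U)
    (hvm : h.v m = T.length) (hinp : h.inp = T.flatMap PointPair.coords)
    (ha : ∀ k i j l, h.a k i j l = 0) (hv : ∀ x, x ≠ Reg.U → x ≠ m → h.v x = 0) :
    WP M main h fun h' n => Optimal U T h' ∧ (U = 0 → h'.v hi = 0) ∧
      n ≤ 12 * T.length + 800 * (U ^ 3 * (Nat.log 2 U + 2) ^ 2) + 2 := by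
  refine WP.ite (by simp) (fun hc => ?_) (fun hc => ?_)
  · have hpos : 1 ≤ U := by simp only [eval_var, hU] at hc; omega
    refine WP.seq ((init_spec hM hU hpos).mono ?_)
    rintro h1 n1 f1 ⟨hC1, hn1⟩
    refine WP.seq ((readInput_spec (T := T) hM hm hT hC1.vU (by rw [f1.v _ (by decide), hvm])
      (by rw [f1.inp, hinp]) (fun k i j l => by rw [f1.a _ (by simp [init, HProg.arrs]), ha])).mono
      ?_)
    rintro h2 n2 f2 ⟨hQ2, hS2, hn2⟩
    have hC2 : Consts U _ h2 := hC1.frame f2 (by decide)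
    refine WP.seq ((prevTables_spec hM hC2.vU hS2 fun b x => ?_).mono ?_)
    · rw [f2.a _ (by cases b <;> decide), f1.a _ (by simp [init, HProg.arrs]), ha]
    rintro h3 n3 f3 ⟨hp3, hn3⟩
    have hC3 : Consts U _ h3 := hC2.frame f3 (by decide)
    have hT3 : Tables U T h3 := ⟨hT, fun b px py _ _ _ _ => by
      rw [f3.a _ (by cases b <;> decide)]; exact hQ2 b px py, hp3⟩
    refine (binarySearch_spec hM hC3 hT3).mono ?_
    rintro h4 n4 f4 ⟨hopt, hn4⟩
    refine ⟨hopt, by omega, ?_⟩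
    generalize Nat.log 2 U = l at *
    have e0 : 1 ≤ U ^ 3 := Nat.one_le_pow _ _ hpos
    have e2 : U * U ≤ U ^ 3 := by
      rw [← sq]; exact Nat.pow_le_pow_right hpos (by norm_num)
    have e3 : U ≤ U ^ 3 := Nat.le_self_pow (by norm_num) U
    have e4 : (l + 2) * 1 ≤ (l + 2) * U ^ 3 := Nat.mul_le_mul_left _ e0
    -- The exponent of the power of two is `l + 1`; the search runs at most `2 (l + 1) + 1` rounds,
    -- which produces the second logarithmic factor.
    have key : (2 * (l + 1) + 1) * (360 * U ^ 3 * (l + 1 + 1) + 8) =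
        720 * (U ^ 3 * (l + 2) ^ 2) + 16 * (l + 2) - (360 * ((l + 2) * U ^ 3) + 8) := by
      refine (Nat.sub_eq_of_eq_add ?_).symm
      ring
    have e5 : (l + 2) * U ^ 3 * 2 ≤ (l + 2) * U ^ 3 * (l + 2) := Nat.mul_le_mul_left _ (by omega)
    have e6 : (l + 2) * U ^ 3 * (l + 2) = U ^ 3 * (l + 2) ^ 2 := by ring
    have e7 : U * (6 * U + 4) = 6 * (U * U) + 4 * U := by ring
    have e8 : U ^ 3 * 2 ≤ U ^ 3 * (l + 2) := Nat.mul_le_mul_left _ (by omega)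
    have e9 : U ^ 3 * (l + 2) = (l + 2) * U ^ 3 := mul_comm _ _
    rw [key] at hn4
    omega
  · have hU0 : U = 0 := by simpa [hU] using hc
    subst hU0
    obtain rfl : T = [] := by
      refine List.eq_nil_iff_forall_not_mem.2 fun p hp => ?_
      have h1 := (hT p hp).1.1
      simp only [Set.mem_Icc] at h1
      omega
    have h0 : h.v hi = 0 := hv _ (by decide) (by decide)
    exact WP.skip ⟨⟨fun p hp => absurd hp List.not_mem_nil, fun R hR => by omega⟩, fun _ => h0,
      by omega⟩

end Structured

/-! ## Integral disks and grid disks -/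

namespace GridDisk

open IB2C

theorem gridPoint_mem_closedBall {p c : ℤ × ℤ} {r : ℝ} (hr : 0 ≤ r) :
    gridPoint p ∈ Metric.closedBall (gridPoint c) r ↔
      (((p.1 - c.1) ^ 2 + (p.2 - c.2) ^ 2 : ℤ) : ℝ) ≤ r ^ 2 := by
  rw [Metric.mem_closedBall, EuclideanSpace.dist_eq, Real.sqrt_le_iff, Fin.sum_univ_two]
  simp [gridPoint, hr, Real.dist_eq, sq_abs]

theorem near_iff_mem {R : ℕ} {p c : ℕ × ℕ} :
    Near R p c ↔ gridPoint (p.1, p.2) ∈ Metric.closedBall (gridPoint (c.1, c.2)) (√(R : ℝ)) := by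
  rw [gridPoint_mem_closedBall (Real.sqrt_nonneg _), Real.sq_sqrt (Nat.cast_nonneg _), Near,
    ← Int.cast_natCast R]
  exact Int.cast_le.symm

/-- The nearest number in `{1, …, U}`. -/
def clamp (U : ℕ) (z : ℤ) : ℕ := max 1 (min U z.toNat)

theorem clamp_mem {U : ℕ} (hU : 1 ≤ U) (z : ℤ) : 1 ≤ clamp U z ∧ clamp U z ≤ U := by
  unfold clamp
  omega

/-- Projection to an interval does not increase the distance to a point of the interval. -/
theorem sq_sub_clamp_le {U p : ℕ} (hp : p ∈ Set.Icc 1 U) (z : ℤ) :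
    ((p : ℤ) - clamp U z) ^ 2 ≤ ((p : ℤ) - z) ^ 2 := by
  obtain ⟨h1, h2⟩ := hp
  rw [← Int.natAbs_le_iff_sq_le]
  unfold clamp
  omega

/-- Squared distances of integral points are integers, so the bound may be rounded down. The second
radius `r'` allows both disks to be enlarged to the larger of the two radii. -/
theorem near_clamp {U : ℕ} {p : ℕ × ℕ} (hp : p.1 ∈ Set.Icc 1 U ∧ p.2 ∈ Set.Icc 1 U) {c : ℤ × ℤ}
    {r r' : ℝ} (hr : 0 ≤ r) (hrr : r ≤ r')
    (h : gridPoint (p.1, p.2) ∈ Metric.closedBall (gridPoint c) r) :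
    Near ⌊r' ^ 2⌋₊ p (clamp U c.1, clamp U c.2) := by
  rw [gridPoint_mem_closedBall hr] at h
  unfold Near
  obtain ⟨n, hn⟩ := Int.eq_ofNat_of_zero_le
    (show 0 ≤ ((p.1 : ℤ) - c.1) ^ 2 + ((p.2 : ℤ) - c.2) ^ 2 by positivity)
  have h1 : n ≤ ⌊r' ^ 2⌋₊ := by
    refine Nat.le_floor ?_
    rw [hn] at h
    exact (by exact_mod_cast h : (n : ℝ) ≤ r ^ 2).trans (pow_le_pow_left₀ hr hrr 2)
  have h2 := sq_sub_clamp_le hp.1 c.1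
  have h3 := sq_sub_clamp_le hp.2 c.2
  simp only
  omega

theorem covers_clamp {U : ℕ} {T : List PointPair} (hT : ∀ p ∈ T, p.InGrid U)
    {E₁ E₂ : IntegralDisk} (h : BichromaticallyCover E₁ E₂ T) :
    Covers ⌊max E₁.radius E₂.radius ^ 2⌋₊ T (clamp U E₁.center.1, clamp U E₁.center.2)
      (clamp U E₂.center.1, clamp U E₂.center.2) := by
  intro p hp
  have hg := hT p hp
  rcases h p hp with ⟨h1, h2⟩ | ⟨h1, h2⟩
  · exact Or.inl ⟨near_clamp hg.1 E₁.radius_nonneg (le_max_left _ _) h1,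
      near_clamp hg.2 E₂.radius_nonneg (le_max_right _ _) h2⟩
  · exact Or.inr ⟨near_clamp hg.2 E₁.radius_nonneg (le_max_left _ _) h1,
      near_clamp hg.1 E₂.radius_nonneg (le_max_right _ _) h2⟩

/-- An optimal pair of grid disks is optimal among all pairs of integral disks. -/
theorem isSolution_of_covers {U R : ℕ} {T : List PointPair} (hT : ∀ p ∈ T, p.InGrid U)
    {c₁ c₂ : ℕ × ℕ} (hcov : Covers R T c₁ c₂)
    (hopt : ∀ R' < R, ∀ p q X Y, (1 ≤ p ∧ p ≤ U) → (1 ≤ q ∧ q ≤ U) → (1 ≤ X ∧ X ≤ U) →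
      (1 ≤ Y ∧ Y ≤ U) → ¬ Covers R' T (p, q) (X, Y))
    (h0 : U = 0 → R = 0) {D₁ D₂ : IntegralDisk} (hc₁ : D₁.center = (↑c₁.1, ↑c₁.2))
    (hc₂ : D₂.center = (↑c₂.1, ↑c₂.2)) (hr₁ : D₁.radius = √(R : ℝ)) (hr₂ : D₂.radius = √(R : ℝ)) :
    IsSolution T D₁ D₂ := by
  refine ⟨fun p hp => ?_, fun E₁ E₂ hE => ?_⟩
  · simp only [IntegralDisk.toSet, hc₁, hc₂, hr₁, hr₂]
    exact (hcov p hp).imp (fun h => ⟨near_iff_mem.1 h.1, near_iff_mem.1 h.2⟩)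
      fun h => ⟨near_iff_mem.1 h.1, near_iff_mem.1 h.2⟩
  · rw [hr₁, hr₂, max_self]
    have hnn : 0 ≤ max E₁.radius E₂.radius := E₁.radius_nonneg.trans (le_max_left _ _)
    by_contra hlt
    rw [not_le, Real.lt_sqrt hnn] at hlt
    have hlt' : ⌊max E₁.radius E₂.radius ^ 2⌋₊ < R := (Nat.floor_lt (sq_nonneg _)).2 hlt
    have hU : 1 ≤ U := Nat.one_le_iff_ne_zero.2 fun h => by have := h0 h; omega
    exact hopt _ hlt' _ _ _ _ (clamp_mem hU _) (clamp_mem hU _) (clamp_mem hU _)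
      (clamp_mem hU _) (covers_clamp hT hE)

end GridDisk

/-! ## The algorithm -/

namespace Structured

open GridDisk IB2C WordRAM

open Reg

/-- Move the input parameters to the registers of the structured language. -/
def prologue : Program :=
  -- The base address of the arrays is `4 m`, the first cell behind the input.
  .seq (.assign 8 (.op .mul (.const 4) (.reg 1)))
    (.seq (.assign (Reg.U.code + 10) (.reg 0)) (.assign (m.code + 10) (.reg 1)))

/-- Move the centers and the squared radius to the output registers. -/
def epilogue : Program :=
  .seq (.assign 0 (.reg (bx1.code + 10))) (.seq (.assign 1 (.reg (by1.code + 10)))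
    (.seq (.assign 2 (.reg (hi.code + 10))) (.seq (.assign 3 (.reg (bx2.code + 10)))
      (.seq (.assign 4 (.reg (by2.code + 10))) (.assign 5 (.reg (hi.code + 10)))))))

/-- The structured state that holds the input. -/
def inputHState (U : ℕ) (T : List PointPair) : HState where
  v x := if x = .U then U else if x = m then T.length else 0
  a _ _ _ _ := 0
  inp := T.flatMap PointPair.coords

theorem getD_coords_le {U : ℕ} {T : List PointPair} (hT : ∀ p ∈ T, p.InGrid U) (i : ℕ) :
    (T.flatMap PointPair.coords).getD i 0 ≤ U := by
  rcases Nat.lt_or_ge i (T.flatMap PointPair.coords).length with h | h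
  · rw [List.getD_eq_getElem _ _ h]
    obtain ⟨p, hp, hx⟩ := List.mem_flatMap.1 (List.getElem_mem h)
    obtain ⟨⟨h1, h2⟩, h3, h4⟩ := hT p hp
    simp only [Set.mem_Icc] at h1 h2 h3 h4
    simp only [PointPair.coords, List.mem_cons, List.not_mem_nil, or_false] at hx
    omega
  · rw [List.getD_eq_default _ _ h]
    exact Nat.zero_le _

theorem inputHState_bounded {M U : ℕ} {T : List PointPair} (hT : ∀ p ∈ T, p.InGrid U)
    (hU : U < M) (hm : 4 * T.length < M) : (inputHState U T).Bounded M := by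
  refine ⟨fun x => ?_, fun _ _ _ _ => ?_, fun i => (getD_coords_le hT i).trans_lt hU, ?_⟩
  · simp only [inputHState]
    split_ifs <;> omega
  · exact (Nat.zero_le _).trans_lt hU
  · simpa only [inputHState, length_flatMap_coords] using hm

theorem prologue_spec {W U : ℕ} {T : List PointPair} (hU : U < W) (hm : 4 * T.length < W)
    (hW : 4 < W) :
    ∃ s, Exec W prologue (inputState U T) s 8 ∧ Rep (inputHState U T) s := by
  refine ⟨_, .seq (.assign _ _ _ ?_) (.seq (.assign _ _ _ ?_) (.assign _ _ _ ?_)),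
    fun x => ?_, ?_, fun k i j l => ?_, fun i hi => rfl⟩
  · change 4 < W ∧ T.length < W ∧ 4 * T.length < W
    omega
  · exact hU
  · change T.length < W
    omega
  · cases x <;> rfl
  · exact (length_flatMap_coords T).symm
  · exact List.getD_eq_default _ _ (Nat.le_add_right _ _)

theorem epilogue_spec {M W : ℕ} (hW : M ≤ W) {h : HState} {s : State} (hs : Rep h s)
    (hb : h.Bounded M) :
    ∃ s', Exec W epilogue s s' 12 ∧ s'.reg 0 = h.v bx1 ∧ s'.reg 1 = h.v by1 ∧
      s'.reg 2 = h.v hi ∧ s'.reg 3 = h.v bx2 ∧ s'.reg 4 = h.v by2 ∧ s'.reg 5 = h.v hi := by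
  have key : ∀ x : Reg, s.reg (x.code + 10) < W := fun x => by
    rw [hs.reg]
    exact (hb.v x).trans_le hW
  refine ⟨_, .seq (.assign _ _ _ ?_) (.seq (.assign _ _ _ ?_) (.seq (.assign _ _ _ ?_)
    (.seq (.assign _ _ _ ?_) (.seq (.assign _ _ _ ?_) (.assign _ _ _ ?_))))),
    hs.reg bx1, hs.reg by1, hs.reg hi, hs.reg bx2, hs.reg by2, hs.reg hi⟩
  · exact key bx1
  · exact key by1
  · exact key hi
  · exact key bx2
  · exact key by2
  · exact key hi

/-- Since `log 2 > 1/2`, for `U ≥ 2` both `Nat.log 2 U ≤ 2 log U` and `2 ≤ 4 log U` hold, which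
gives the factor `6² = 36`. The summand 1 covers `U = 1`, where the logarithm vanishes. -/
theorem pow_three_mul_log_le (U : ℕ) :
    (U : ℝ) ^ 3 * ((Nat.log 2 U : ℝ) + 2) ^ 2 ≤ 36 * ((U : ℝ) ^ 3 * Real.log U ^ 2 + 1) := by
  rcases Nat.lt_or_ge U 2 with h | h
  · interval_cases U <;> norm_num
  · have h2 : (1 / 2 : ℝ) < Real.log 2 := by linarith [Real.log_two_gt_d9]
    have hU : Real.log 2 ≤ Real.log U := Real.log_le_log (by norm_num) (by exact_mod_cast h)
    have hl : (Nat.log 2 U : ℝ) * Real.log 2 ≤ Real.log U := by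
      rw [← Real.log_pow]
      exact Real.log_le_log (by positivity)
        (by exact_mod_cast Nat.pow_log_le_self 2 (show U ≠ 0 by omega))
    have hn : (0 : ℝ) ≤ Nat.log 2 U := Nat.cast_nonneg _
    have h3 : (Nat.log 2 U : ℝ) + 2 ≤ 6 * Real.log U := by nlinarith
    calc (U : ℝ) ^ 3 * ((Nat.log 2 U : ℝ) + 2) ^ 2 ≤ (U : ℝ) ^ 3 * (6 * Real.log U) ^ 2 := by
          gcongr
      _ ≤ 36 * ((U : ℝ) ^ 3 * Real.log U ^ 2 + 1) := by ring_nf; linarith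

end Structured

open Structured in
theorem mainTheorem2 :
    ∃ (P : WordRAM.Program) (c : ℕ) (C : ℝ),
      ∀ (U : ℕ) (T : List IB2C.PointPair), (∀ p ∈ T, p.InGrid U) →
        ∃ (s : WordRAM.State) (n : ℕ),
          WordRAM.Exec ((T.length + U + 2) ^ c) P (IB2C.inputState U T) s n ∧
          IB2C.IsSolution T (IB2C.outputDisk s 0) (IB2C.outputDisk s 3) ∧
          (n : ℝ) ≤ C * (T.length + (U : ℝ) ^ 3 * Real.log U ^ 2 + 1) := by
  -- With `x = m + U + 2`, all values of the structured program are below `M = x ^ 11` and addresses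
  -- require `M ^ 12`, hence `132 = 11 * 12`. The constant 30000 exceeds `800 * 36` with room for
  -- the lower terms, and 20 counts the steps of `prologue` and `epilogue`.
  refine ⟨.seq prologue (.seq Structured.main.compile epilogue), 132,
    Structured.main.weight * 30000 + 20, fun U T hT => ?_⟩
  obtain ⟨x, hx⟩ : ∃ x, T.length + U + 2 = x := ⟨_, rfl⟩
  rw [hx]
  have hM1 : 100 * (U + 2) ^ 4 ≤ x ^ 11 := by
    calc 100 * (U + 2) ^ 4 ≤ x ^ 7 * x ^ 4 := by
          gcongr
          · exact le_trans (by norm_num) (Nat.pow_le_pow_left (show 2 ≤ x by omega) 7)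
          · omega
      _ = x ^ 11 := by ring
  have hM2 : 4 * T.length + 10 ≤ x ^ 11 := by
    calc 4 * T.length + 10 ≤ 2 ^ 10 * x := by omega
      _ ≤ x ^ 10 * x := by gcongr; omega
      _ = x ^ 11 := by ring
  have hM3 : U + 20 < x ^ 11 := by
    calc U + 20 < 2 ^ 10 * x := by omega
      _ ≤ x ^ 10 * x := by gcongr; omega
      _ = x ^ 11 := by ring
  have hW : (x ^ 11) ^ 12 = x ^ 132 := by rw [← pow_mul]
  have hMW : x ^ 11 ≤ x ^ 132 := Nat.pow_le_pow_right (by omega) (by norm_num)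
  obtain ⟨s1, e1, r1⟩ := prologue_spec (W := x ^ 132) (U := U) (T := T) (by omega) (by omega)
    (by omega)
  obtain ⟨h2, k, e2, hopt, h0, hk⟩ := main_spec (h := inputHState U T) hM1 hM2 hT rfl rfl rfl
    (fun _ _ _ _ => rfl) (fun y hy hy' => by simp [inputHState, hy, hy'])
  obtain ⟨s2, n2, e2', r2, b2, hn2⟩ := e2.compile (by omega) hW.le s1 r1
    (inputHState_bounded hT (by omega) (by omega))
  obtain ⟨s3, e3, o0, o1, o2, o3, o4, o5⟩ := epilogue_spec hMW r2 b2
  refine ⟨s3, _, .seq e1 (.seq e2' e3), ?_, ?_⟩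
  · refine GridDisk.isSolution_of_covers hT hopt.1 hopt.2 h0 ?_ ?_ ?_ ?_ <;>
      simp [IB2C.outputDisk, o0, o1, o2, o3, o4, o5]
  · have hlog := pow_three_mul_log_le U
    have hn : (n2 : ℝ) ≤ Structured.main.weight *
        (12 * T.length + 800 * ((U : ℝ) ^ 3 * ((Nat.log 2 U : ℝ) + 2) ^ 2) + 2) := by
      exact_mod_cast hn2.trans (Nat.mul_le_mul_left _ hk)
    have hm : (0 : ℝ) ≤ T.length := Nat.cast_nonneg _
    have hX : 0 ≤ (U : ℝ) ^ 3 * Real.log U ^ 2 := by positivity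
    have hw : (0 : ℝ) ≤ Structured.main.weight := Nat.cast_nonneg _
    generalize (Structured.main.weight : ℝ) = w at *
    have h1 : w * (12 * T.length + 800 * ((U : ℝ) ^ 3 * ((Nat.log 2 U : ℝ) + 2) ^ 2) + 2) ≤
        w * (30000 * (T.length + (U : ℝ) ^ 3 * Real.log U ^ 2 + 1)) :=
      mul_le_mul_of_nonneg_left (by linarith) hw
    push_cast
    linarith
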